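/- **Geometry.** Let $Y\subset\mathbb R^n$ be open with $\partial Y=\partial_NY\sqcup\partial_DY$, $\partial_DY$ closed. Let $Y\cup\partial_NY=\bigsqcup_{i\in I}\Omega_i$ be a finite partition, $\Omega_i=\phi_{0,i}(X_i)$, where $X_i\subset\mathbb R^{d_i}$ is open, bounded and connected, $\overline X_i$ is a smooth manifold with boundary $\overline X_i\setminus X_i$, and $\phi_{0,i}$ is smooth on $\overline X_i$ and an embedding on $X_i$. Let $\mathfrak F$ be a finite forest conforming to this partition: it is the disjoint union of trees (rooted directed acyclic graphs) $\mathfrak S_i$, $i\in I$; each node $j$ has a domain $\Omega_{s_j}$ ($s_i=i$ for the root $i$ of $\mathfrak S_i$), with the coordinate domain $X_j=X_{s_j}$, $d_j=d_{s_j}$, and the coordinate map $\phi_{0,j}=\phi_{0,s_j}$. If $I_l$ is the set of descendants of the node $l$, then for $j\in I_l$ there is an injective smooth map $\phi_{l,j}:\overline X_j\to\partial X_l$, immersive on $X_j$, with $\phi_{l,j}=\phi_{l,m}\circ\phi_{m,j}$ for $m \in I_l$, $j\in I_m$, and $\phi_{0,j}=\phi_{0,l}\circ\phi_{l,j}$;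 and $\overline X_l\setminus\phi_{0,l}^{-1}(\partial_DY)=X_l\sqcup\bigsqcup_{j\in I_l}\phi_{l,j}(X_j)$. For a node $j$, $\hat\jmath$ denotes the root of its tree. For $j\in I_l$ with $d_l=d_j+1$, $\varepsilon(\Omega_{s_j},\partial_j\Omega_l)=\pm1$ compares, through $\phi_{l,j}$, the standard orientation of $X_j$ with the boundary orientation of $\partial X_l$. Each node $j$ moreover carries an orientation, recorded by a sign $\kappa_j=\pm1$ relative to $\Omega_{s_j}$, with $\kappa_j=1$ for roots; these signs are otherwise arbitrary ($\kappa_j=\varepsilon(\Omega_{s_j},\partial_j\Omega_{\hat\jmath})$ and $\kappa\equiv1$ are both allowed). **Forms.** All forms on $\Omega_{s_j}$ are regarded as forms on $X_j$, with the Euclidean metric. For $j\in I_l$ put $\operatorname{Tr}_ja=\kappa_j\kappa_l\,\phi_{l,j}^*a$ for forms $a$ on $\overline X_l$, and, if $d_l=d_j+1$, define $\operatorname{Tr}^*_j$ by $\star_\partial\operatorname{Tr}^*_ja=\operatorname{Tr}_j(\star a)$, with $\star_\partial=\varepsilon(\Omega_{s_j},\partial_j\Omega_l)\,\star_{X_j}$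 the Hodge star of $X_j$ for the boundary orientation. Let $d^*=(-1)^q\star^{-1}d\,\star$ on $q$-forms. A mixed-dimensional $k$-form is a family $\mathfrak a=(a_j)_{j\in\mathfrak F}$, $a_j=\iota_j\mathfrak a$, of forms $a_j$ of degree $k-(n-d_{\hat\jmath})$ on $X_j$ (zero if this degree is not in $\{0,\dots,d_j\}$). It is in $L^2\mathfrak L^k$ if all $a_j$ are square integrable, with $(\mathfrak a,\mathfrak b)=\sum_j(a_j,b_j)_{L^2(X_j)}$. It is in $C\mathfrak L^k$ if each $a_j$ is smooth on $\overline X_j$ and $a_j=\operatorname{Tr}_ja_i$ for all $i\in I$ and $j\in I_i$; and in $\mathring C\mathfrak L^k$ if moreover the restriction of $a_j$ to tangent vectors of $\partial X_j$ vanishes at all points of $\partial X_j\cap\phi_{0,j}^{-1}(\partial_DY)$, for every node $j$. **Differential.** For $\mathfrak a\in C\mathfrak L^k$ let $\iota_j(\mathfrak d\mathfrak a)=da_j+\iota_j(\mathbb d\mathfrak a)$, where on roots $i$ $$\iota_i(\mathbb d\mathfrak a)=(-1)^{n-k}\sum_{l:\ s_l=i,\ d_{\hat l}=d_i+1}\varepsilon(\Omega_i,\partial_l\Omega_{\hat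 l})\,a_l ,$$ and $\iota_j(\mathbb d\mathfrak a)=\operatorname{Tr}_j\iota_i(\mathbb d\mathfrak a)$ for $j\in I_i$. For nodes $j,l$ with $s_j=s_l$ let $\varepsilon_{jl}$ be the following number. If $j=i$ is a root, $\varepsilon_{il}=\varepsilon(\Omega_i,\partial_l\Omega_{\hat l})$ if $d_{\hat l}=d_i+1$, and $0$ otherwise. If $j\in I_i$ with $i$ a root, $\varepsilon_{jl}=\kappa_j\kappa_l\sum_{l'}\kappa_{l'}\,\varepsilon(\Omega_i,\partial_{l'}\Omega_{\hat l})$, the sum being over the nodes $l'$ with $s_{l'}=i$, $l\in I_{l'}$, $d_{\hat l}=d_i+1$ and $\phi_{l',l}=\phi_{i,j}$ on $X_j$. Let $\gamma_j^{-1}=\{l: s_l=s_j,\ \varepsilon_{jl}\ne0\}$, $\gamma_j=\{l: j\in\gamma_l^{-1}\}$, and $J_j^{d_j+1}=\{l: j\in I_l,\ d_l=d_j+1\}$. **Theorem.** Call $\mathfrak c\in L^2\mathfrak L^{k-1}$ a strong coderivative of $\mathfrak a\in C\mathfrak L^k$ if $(\mathfrak c,\mathfrak b)=(\mathfrak a,\mathfrak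 d\mathfrak b)$ for all $\mathfrak b\in\mathring C\mathfrak L^{k-1}$. Every $\mathfrak a\in C\mathfrak L^k$ has a strong coderivative $\mathfrak d^*\mathfrak a\in L^2\mathfrak L^{k-1}$, given for all $j\in\mathfrak F$ by $$\iota_j(\mathfrak d^*\mathfrak a)=d^*a_j+\sum_{l\in J_j^{d_j+1}}\operatorname{Tr}^*_ja_l+(-1)^{n-(k-1)}\sum_{l\in\gamma_j}\varepsilon_{lj}\,a_l ,$$ and it is unique: any strong coderivative $\mathfrak c\in L^2\mathfrak L^{k-1}$ of $\mathfrak a$ satisfies $c_j=\iota_j(\mathfrak d^*\mathfrak a)$ almost everywhere on $X_j$, for all $j\in\mathfrak F$. -/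

import Mathlib

open MeasureTheory Topology
open scoped ContDiff

noncomputable section

namespace MixedDim

/-! ### Differential forms on subsets of `ℝ^d` -/

/-- Euclidean space `ℝ^d`. -/
abbrev Eucl (d : ℕ) : Type := EuclideanSpace ℝ (Fin d)

/-- Alternating `m`-linear forms on `ℝ^d`. -/
abbrev Alt (d m : ℕ) : Type := Eucl d [⋀^Fin m]→L[ℝ] ℝ

/-- Differential forms on `ℝ^d` with all their homogeneous parts: `a m` is the part of degree `m`.
Forms on a subset are represented by such families; only the values on (the closure of) the subset
are ever used. -/
abbrev GForm (d : ℕ) : Type := (m : ℕ) → Eucl d → Alt d m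

/-- The standard basis vectors of `ℝ^d`. -/
def stdVec {d : ℕ} (r : Fin d) : Eucl d := EuclideanSpace.single r 1

/-- There are finitely many ordered selections of `m` out of `d` indices. -/
instance selectionFintype (m d : ℕ) : Fintype (Fin m ↪o Fin d) :=
  Fintype.ofInjective (fun t : Fin m ↪o Fin d => (t : Fin m → Fin d)) DFunLike.coe_injective

/-- The coefficient `α_t` of `α = ∑ t, α_t • dx_{t 0} ∧ ⋯ ∧ dx_{t (m-1)}`. -/
def coeff {d m : ℕ} (α : Alt d m) (t : Fin m ↪o Fin d) : ℝ := α fun r => stdVec (t r)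

/-- The form `dx_{t 0} ∧ ⋯ ∧ dx_{t (m-1)}`, i.e. `(v_0, …, v_{m-1}) ↦ det (v_r (t c))`. -/
def dualForm {d m : ℕ} (t : Fin m ↪o Fin d) : Alt d m :=
  { toMultilinearMap :=
      ((Matrix.detRowAlternating (R := ℝ) (n := Fin m)).compLinearMap
        (LinearMap.pi fun c => (EuclideanSpace.proj (𝕜 := ℝ) (t c)).toLinearMap)).toMultilinearMap
    cont := by
      change Continuous fun v : Fin m → Eucl d =>
        Matrix.det (fun r c : Fin m => (v r) (t c))
      apply Continuous.matrix_det
      fun_prop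
    map_eq_zero_of_eq' := fun v i j h hij =>
      ((Matrix.detRowAlternating (R := ℝ) (n := Fin m)).compLinearMap
        (LinearMap.pi fun c =>
          (EuclideanSpace.proj (𝕜 := ℝ) (t c)).toLinearMap)).map_eq_zero_of_eq v h hij }

/-- The sign of the permutation listing first `s`, then its complement, both increasingly. -/
def shuffleSign {d : ℕ} (s : Finset (Fin d)) : ℝ :=
  (-1) ^ ((s ×ˢ sᶜ).filter fun p => p.2 < p.1).card

/-- The set of indices of an ordered selection. -/
def indexSet {d m : ℕ} (t : Fin m ↪o Fin d) : Finset (Fin d) := Finset.univ.map t.toEmbedding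

/-- The increasing enumeration of the indices that do not occur in `t`. -/
def complSel {d m : ℕ} (t : Fin m ↪o Fin d) : Fin (indexSet t)ᶜ.card ↪o Fin d :=
  (indexSet t)ᶜ.orderEmbOfFin rfl

/-- The Euclidean Hodge star: `⋆ dx_s = sign (s, sᶜ) dx_{sᶜ}`, so that `u ∧ ⋆a = ⟨u, a⟩ vol`. -/
def star {d : ℕ} (a : GForm d) : GForm d := fun m x =>
  ∑ t : Fin m ↪o Fin d, (shuffleSign (indexSet t)ᶜ * coeff (a _ x) (complSel t)) • dualForm t

/-- The inverse of the Hodge star: `⋆⁻¹ dx_{tᶜ} = sign (t, tᶜ) dx_t`. -/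
def starInv {d : ℕ} (a : GForm d) : GForm d := fun m x =>
  ∑ t : Fin m ↪o Fin d, (shuffleSign (indexSet t) * coeff (a _ x) (complSel t)) • dualForm t

/-- The exterior derivative of a form on `S`. -/
def dOn {d : ℕ} (S : Set (Eucl d)) (a : GForm d) : GForm d
  | 0 => fun _ => 0
  | m + 1 => fun x => extDerivWithin (a m) S x

/-- The codifferential of a form on `S`: on forms of degree `k` it is `(-1)^k ⋆⁻¹ d ⋆`. The part of
degree `m` of the result comes from the part of degree `k = m + 1`. -/
def codOn {d : ℕ} (S : Set (Eucl d)) (a : GForm d) : GForm d := fun m x =>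
  (-1 : ℝ) ^ (m + 1) • starInv (dOn S (star a)) m x

/-- The `L²` inner product of forms on `S` (the parts of degree `> d` vanish). -/
def innerOn {d : ℕ} (S : Set (Eucl d)) (a b : GForm d) : ℝ :=
  ∑ m ∈ Finset.range (d + 1), ∫ x in S, ∑ t : Fin m ↪o Fin d, coeff (a m x) t * coeff (b m x) t

/-- The closure of the open set `X` is a smooth manifold with boundary `frontier X`: near each
point of the frontier, `X` is a sublevel set of a smooth function with nonzero differential. -/
def HasSmoothBoundary {d : ℕ} (X : Set (Eucl d)) : Prop :=
  ∀ x ∈ frontier X, ∃ U ∈ 𝓝 x, ∃ ρ : Eucl d → ℝ, ContDiff ℝ ∞ ρ ∧ fderiv ℝ ρ x ≠ 0 ∧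
    ∀ y ∈ U, y ∈ X ↔ ρ y < 0

/-! ### Partitions with a conforming forest -/

/-- An open set `Y ⊆ ℝ^n` with `∂Y = ∂_N Y ∪ ∂_D Y`, a finite partition of `Y ∪ ∂_N Y` into
submanifolds `Ω i = φ₀ i '' X i`, and a forest conforming to it.

The nodes `j` with `s_j = i` form the type `Sheet i`; so a node is a pair `j = ⟨s_j, _⟩`. The node
`j` has the same coordinate domain `X_j = X s_j` and the same coordinate map `φ_{0,j} = φ₀ s_j` as
`Ω s_j`. -/
structure ConformingForest (n : ℕ) where
  Y : Set (Eucl n)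
  bdN : Set (Eucl n)
  bdD : Set (Eucl n)
  isOpen_Y : IsOpen Y
  frontier_Y : frontier Y = bdN ∪ bdD
  disjoint_bd : Disjoint bdN bdD
  isClosed_bdD : IsClosed bdD
  /-- the index set of the partition -/
  I : Type
  [fintypeI : Fintype I]
  /-- the dimension of `Ω i` -/
  dim : I → ℕ
  /-- the reference domains -/
  X : (i : I) → Set (Eucl (dim i))
  isOpen_X : ∀ i, IsOpen (X i)
  isConnected_X : ∀ i, IsConnected (X i)
  isBounded_X : ∀ i, Bornology.IsBounded (X i)
  smooth_X : ∀ i, HasSmoothBoundary (X i)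
  /-- the coordinate maps `φ_{0,i}` -/
  φ₀ : (i : I) → Eucl (dim i) → Eucl n
  contDiffOn_φ₀ : ∀ i, ContDiffOn ℝ ∞ (φ₀ i) (closure (X i))
  immersion_φ₀ : ∀ i, ∀ x ∈ X i, Function.Injective (fderiv ℝ (φ₀ i) x)
  isEmbedding_φ₀ : ∀ i, IsEmbedding ((X i).domRestrict (φ₀ i))
  /-- the sets `Ω i` are disjoint and cover `Y ∪ ∂_N Y` -/
  disjoint_Ω : ∀ i i', i ≠ i' → Disjoint (φ₀ i '' X i) (φ₀ i' '' X i')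
  iUnion_Ω : ⋃ i, φ₀ i '' X i = Y ∪ bdN
  /-- the nodes `j` with `s_j = i` -/
  Sheet : I → Type
  [fintypeSheet : ∀ i, Fintype (Sheet i)]
  /-- the root of the tree of `Ω i`; it satisfies `s_i = i` -/
  root : (i : I) → Sheet i
  /-- the tree to which a node belongs -/
  tree : (Σ i, Sheet i) → I
  tree_root : ∀ i, tree ⟨i, root i⟩ = i
  /-- `Desc l j`: the node `j` is a descendant of the node `l`, that is `j ∈ I_l` -/
  Desc : (Σ i, Sheet i) → (Σ i, Sheet i) → Prop
  desc_irrefl : ∀ j, ¬ Desc j j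
  desc_trans : ∀ l m j, Desc l m → Desc m j → Desc l j
  desc_tree : ∀ l j, Desc l j → tree l = tree j
  desc_root : ∀ j, j = ⟨tree j, root (tree j)⟩ ∨ Desc ⟨tree j, root (tree j)⟩ j
  /-- the maps `φ_{l,j}` from `X_j` to the boundary of `X_l`, for `j ∈ I_l` -/
  φ : (l j : Σ i, Sheet i) → Eucl (dim j.1) → Eucl (dim l.1)
  contDiffOn_φ : ∀ l j, Desc l j → ContDiffOn ℝ ∞ (φ l j) (closure (X j.1))
  injOn_φ : ∀ l j, Desc l j → Set.InjOn (φ l j) (closure (X j.1))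
  immersion_φ : ∀ l j, Desc l j → ∀ x ∈ X j.1, Function.Injective (fderiv ℝ (φ l j) x)
  mapsTo_φ : ∀ l j, Desc l j → Set.MapsTo (φ l j) (X j.1) (frontier (X l.1))
  /-- `φ_{l,j} = φ_{l,m} ∘ φ_{m,j}` -/
  telescope : ∀ l m j, Desc l m → Desc m j → ∀ x ∈ closure (X j.1), φ l j x = φ l m (φ m j x)
  /-- `φ_{0,j} = φ_{0,l} ∘ φ_{l,j}` -/
  telescope₀ : ∀ l j, Desc l j → ∀ x ∈ closure (X j.1), φ₀ l.1 (φ l j x) = φ₀ j.1 x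
  /-- every node is uniquely covered by its subtree, up to the Dirichlet boundary -/
  cover : ∀ l, X l.1 ∪ ⋃ j, ⋃ (_ : Desc l j), φ l j '' X j.1 = closure (X l.1) \ φ₀ l.1 ⁻¹' bdD
  disjoint_cover : ∀ l j j', Desc l j → Desc l j' → j ≠ j' →
    Disjoint (φ l j '' X j.1) (φ l j' '' X j'.1)
  /-- the sign comparing the orientation given to the node `j`, as a piece of the boundary of the
  root of its tree, with that of `Ω s_j` -/
  orient : (Σ i, Sheet i) → ℤˣ
  orient_root : ∀ i, orient ⟨i, root i⟩ = 1

namespace ConformingForest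

variable {n : ℕ} (F : ConformingForest n)

instance : Fintype F.I := F.fintypeI

instance (i : F.I) : Fintype (F.Sheet i) := F.fintypeSheet i

/-- The nodes of the forest. -/
abbrev Node : Type := Σ i, F.Sheet i

/-- The root of the tree that belongs to `Ω i`. -/
def rt (i : F.I) : F.Node := ⟨i, F.root i⟩

/-- The sign `ε (Ω s_j, ∂_j Ω_l)` for `j ∈ I_l` with `d_l = d_j + 1`: it is `1` if `φ_{l,j}` carries
the standard orientation of `X_j ⊆ ℝ^{d_j}` to the boundary orientation (outward vector first) of
`∂ X_l`, and `-1` otherwise. -/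
def inc (l j : F.Node) : ℝ :=
  open Classical in
  if ∃ h : F.dim l.1 = F.dim j.1 + 1, ∃ x ∈ F.X j.1, ∃ ν : Eucl (F.dim l.1),
      (∀ᶠ t : ℝ in 𝓝[>] 0, F.φ l j x - t • ν ∈ F.X l.1 ∧ F.φ l j x + t • ν ∉ F.X l.1) ∧
      0 < Matrix.det (Matrix.of fun r c : Fin (F.dim j.1 + 1) =>
        (Fin.cons ν (fun q => fderiv ℝ (F.φ l j) x (stdVec q)) :
          Fin (F.dim j.1 + 1) → Eucl (F.dim l.1)) c (Fin.cast h.symm r))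
  then 1 else -1

/-- The trace of a form on `X_l` on the node `j ∈ I_l`: the pullback by `φ_{l,j}`, with the sign
comparing the orientations given to `l` and `j` (for a root `l` it is the sign of `j`). -/
def trace (l j : F.Node) (a : GForm (F.dim l.1)) : GForm (F.dim j.1) := fun m x =>
  (((F.orient j * F.orient l : ℤˣ) : ℤ) : ℝ) •
    (a m (F.φ l j x)).compContinuousLinearMap (fderivWithin ℝ (F.φ l j) (closure (F.X j.1)) x)

/-- The cotrace on the node `j ∈ I_l`, `d_l = d_j + 1`, of a form on `X_l`, given by
`⋆_∂ (Tr* e) = Tr (⋆ e)`. Here `⋆_∂ = ε (Ω s_j, ∂_j Ω_l) ⋆` is the Hodge star of `X_j` for the boundary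
orientation. -/
def cotrace (l j : F.Node) (a : GForm (F.dim l.1)) : GForm (F.dim j.1) := fun m x =>
  F.inc l j • starInv (F.trace l j (star a)) m x

/-! ### Mixed-dimensional forms -/

/-- Families `(a_j)` of forms on the nodes, `a_j` on `X_j`. -/
abbrev MixedForm : Type := (j : F.Node) → GForm (F.dim j.1)

/-- `𝔏^k`: on the tree of `Ω i`, all forms are of degree `k - (n - d_i)`. -/
def IsForm (k : ℤ) (a : F.MixedForm) : Prop :=
  ∀ (j : F.Node) (m : ℕ), (m : ℤ) ≠ k - (n - F.dim (F.tree j)) → a j m = 0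

/-- `L²𝔏^k`. -/
def L2Form (k : ℤ) : Set F.MixedForm :=
  {a | F.IsForm k a ∧ ∀ (j : F.Node) (m : ℕ), MemLp (a j m) 2 (volume.restrict (F.X j.1))}

/-- The inner product of `L²𝔏^k`. -/
def innerF (a b : F.MixedForm) : ℝ := ∑ j : F.Node, innerOn (F.X j.1) (a j) (b j)

/-- `C𝔏^k`: the forms are smooth up to the boundary, and on every branch they are the traces of the
form on the root. -/
def CForm (k : ℤ) : Set F.MixedForm :=
  {a | F.IsForm k a ∧
    (∀ (j : F.Node) (m : ℕ), ContDiffOn ℝ ∞ (a j m) (closure (F.X j.1))) ∧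
    ∀ (i : F.I) (j : F.Node), F.Desc (F.rt i) j → ∀ m, ∀ x ∈ F.X j.1,
      a j m x = F.trace (F.rt i) j (a (F.rt i)) m x}

/-- The forms in `C𝔏^k` whose trace (restriction to tangent vectors of `∂ X_j`) vanishes on the
Dirichlet boundary. -/
def C0Form (k : ℤ) : Set F.MixedForm :=
  {a | a ∈ F.CForm k ∧ ∀ (j : F.Node) (m : ℕ), ∀ x ∈ frontier (F.X j.1), F.φ₀ j.1 x ∈ F.bdD →
    ∀ v : Fin m → Eucl (F.dim j.1),
      (∀ r, v r ∈ tangentConeAt ℝ (frontier (F.X j.1)) x) → a j m x v = 0}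

/-- The discrete differential of `a ∈ C𝔏^k` on the root of the tree of `Ω i`. -/
def rootJump (k : ℤ) (a : F.MixedForm) (i : F.I) : GForm (F.dim i) := fun m x =>
  open Classical in
  (-1 : ℝ) ^ ((n : ℤ) - k) • ∑ l : F.Sheet i with F.dim (F.tree ⟨i, l⟩) = F.dim i + 1,
    F.inc (F.rt (F.tree ⟨i, l⟩)) ⟨i, l⟩ • a ⟨i, l⟩ m x

/-- The discrete differential of `a ∈ C𝔏^k`. -/
def jump (k : ℤ) (a : F.MixedForm) : F.MixedForm := fun j =>
  open Classical in
  if j = F.rt (F.tree j) then F.rootJump k a j.1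
  else F.trace (F.rt (F.tree j)) j (F.rootJump k a (F.tree j))

/-- The mixed-dimensional exterior derivative of `a ∈ C𝔏^k`. -/
def extD (k : ℤ) (a : F.MixedForm) : F.MixedForm := fun j m x =>
  dOn (closure (F.X j.1)) (a j) m x + F.jump k a j m x

/-- The number `ε_{jl}`, the coefficient (up to the factor `(-1)^(n-k)`) with which `a_l` enters the
discrete differential at `j`, for nodes `j`, `l` with `s_j = s_l = i`. For a root `j` it is
`ε (Ω i, ∂_l Ω i')` if `l` lies in the tree of some `i'` with `d_{i'} = d_i + 1`. For a branch `j` of the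
tree of `i'`, it is the sum of `ε (Ω i', ∂_{l'} Ω i'')`, corrected by the orientations given to the
nodes, over those `l'` with `s_{l'} = i'`, in the tree of some `i''` with `d_{i''} = d_{i'} + 1`, for
which `l` sits in the tree of `l'` at the same place as `j` in the tree of `i'`. -/
def eps {i : F.I} (j l : F.Sheet i) : ℝ :=
  open Classical in
  if (⟨i, j⟩ : F.Node) = F.rt (F.tree ⟨i, j⟩) then
    if F.dim (F.tree ⟨i, l⟩) = F.dim i + 1 then F.inc (F.rt (F.tree ⟨i, l⟩)) ⟨i, l⟩ else 0
  else
    ∑ l' : F.Sheet (F.tree ⟨i, j⟩) with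
        F.dim (F.tree ⟨_, l'⟩) = F.dim (F.tree ⟨i, j⟩) + 1 ∧ F.Desc ⟨_, l'⟩ ⟨i, l⟩ ∧
        ∀ x ∈ F.X i, F.φ ⟨_, l'⟩ ⟨i, l⟩ x = F.φ (F.rt (F.tree ⟨i, j⟩)) ⟨i, j⟩ x,
      (((F.orient ⟨i, j⟩ * F.orient ⟨i, l⟩ * F.orient ⟨_, l'⟩ : ℤˣ) : ℤ) : ℝ) *
        F.inc (F.rt (F.tree ⟨_, l'⟩)) ⟨_, l'⟩

/-- The set `γ_j⁻¹` of the nodes that contribute to the discrete differential at `j`. -/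
def gammaInv {i : F.I} (j : F.Sheet i) : Set (F.Sheet i) := {l | F.eps j l ≠ 0}

/-- The set `γ_j` of the nodes `l` with `j ∈ γ_l⁻¹`. -/
def gamma {i : F.I} (j : F.Sheet i) : Set (F.Sheet i) := {l | j ∈ F.gammaInv l}

/-- The set `J_j^{d_j+1}` of the nodes `l` with `j ∈ I_l` and `d_j = d_l - 1`. -/
def J (j : F.Node) : Set F.Node := {l | F.Desc l j ∧ F.dim l.1 = F.dim j.1 + 1}

/-- `c` is a (strong) mixed-dimensional coderivative of `a ∈ C𝔏^k`: it lies in `L²𝔏^{k-1}` and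
`(c, b) = (a, 𝔡 b)` for all `b ∈ C𝔏^{k-1}` with vanishing trace on the Dirichlet boundary. -/
def IsCoderiv (k : ℤ) (a c : F.MixedForm) : Prop :=
  c ∈ F.L2Form (k - 1) ∧
    ∀ b ∈ F.C0Form (k - 1), F.innerF c b = F.innerF a (F.extD (k - 1) b)

/-- The explicit local form of the coderivative of `a ∈ C𝔏^k`. -/
def explicitCoderiv (k : ℤ) (a : F.MixedForm) : F.MixedForm := fun j m x =>
  open Classical in
  codOn (closure (F.X j.1)) (a j) m x
    + ∑ l : F.Node with l ∈ F.J j, F.cotrace l j (a l) m x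
    + (-1 : ℝ) ^ ((n : ℤ) - k + 1) •
        ∑ l : F.Sheet j.1 with l ∈ F.gamma j.2, F.eps l j.2 • a ⟨j.1, l⟩ m x

end ConformingForest

end MixedDim

end

noncomputable section

namespace MixedDim

/-! ### Coefficients indexed by finite sets -/

/-! The formula for the coderivative is integration by parts on every node, summed over the forest.
For forms a, b on a domain, let V be the vector field with ⟨V, e_r⟩ = ⟨a, dx_r ∧ b⟩ (`flux`). The
Leibniz rule gives div V = ⟨a, db⟩ - ⟨d*a, b⟩ (`divg_flux`), and the flux of V through a hyperplane
is the form b ∧ ⋆a restricted to it (`bdet_flux`). So Green's formula follows from the divergence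
theorem (`integral_divg_eq_flux`).

The boundary of X_l is not treated as a manifold with a surface measure. Up to the Dirichlet part it
is the disjoint union of the pieces φ_{l,j}(X_j), and the flux is written directly as a sum of
integrals over the X_j with d_l = d_j + 1. Pieces of higher codimension project to null sets in a
graph chart (`volume_slice`). On the Dirichlet part V is tangent to the boundary, because b vanishes
on tangent vectors. On a piece of codimension one the integrand is ⟨Tr* a, Tr b⟩, and Tr b_l = b_j
by compatibility of traces (`inc_mul_bdet_flux`, `CForm.eq_trace`). This produces the cotraces
(`green`). The orientation signs occur in pairs and cancel.

The discrete differential is a matrix `eps` acting on nodes with the same coordinate domain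
(`jump_eq`). On a branch this rests on geometry: every sheet of a root carries, at the place of a
given branch, exactly one node (`existsUnique_sheet`, by connectedness). The adjoint of this part is
the transposed matrix, so exchanging the order of summation finishes the duality
(`innerF_explicitCoderiv`).

For uniqueness, the difference of two coderivatives is orthogonal to all admissible b. It is shown
to vanish node by node, by induction on the codimension in the tree (`ae_eq_zero_of_orthogonal`). To
reach a node j, take b = ψ η on the root and its traces on the branches, with ψ supported away from
the Dirichlet boundary and from the closures of all other pieces of dimension at most d_j. Nodes of
larger dimension are settled already, so only j contributes. Pullback along an immersion is
surjective on alternating forms at each point, so such b test every component of the form on X_j. -/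

/-- The value of a family of alternating forms on the vectors `v r`, `r ∈ T`, in increasing order. -/
def ev {d q : ℕ} (A : (m : ℕ) → Alt d m) (v : Fin q → Eucl d) (T : Finset (Fin q)) : ℝ :=
  A T.card fun r => v (T.orderEmbOfFin rfl r)

/-- Degrees agree with `T.card` only propositionally; absorbing the proof of this equality here
avoids casts between spaces of alternating forms. -/
theorem ev_eq {d q m : ℕ} (A : (m : ℕ) → Alt d m) (v : Fin q → Eucl d) (T : Finset (Fin q))
    (h : T.card = m) : A m (fun r => v (T.orderEmbOfFin h r)) = ev A v T := by
  subst h; rfl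

theorem card_indexSet {d m : ℕ} (t : Fin m ↪o Fin d) : (indexSet t).card = m := by
  simp [indexSet]

theorem orderEmbOfFin_indexSet {d m : ℕ} (t : Fin m ↪o Fin d) :
    (indexSet t).orderEmbOfFin (card_indexSet t) = t := by
  symm
  apply Finset.orderEmbOfFin_unique'
  intro x; simp [indexSet]

theorem indexSet_orderEmbOfFin {d m : ℕ} (T : Finset (Fin d)) (h : T.card = m) :
    indexSet (T.orderEmbOfFin h) = T := by
  ext x
  simp only [indexSet, Finset.mem_map, Finset.mem_univ, true_and, RelEmbedding.coe_toEmbedding]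
  exact Set.ext_iff.1 (T.range_orderEmbOfFin h) x

theorem coeff_eq_ev {d m : ℕ} (A : (m : ℕ) → Alt d m) (t : Fin m ↪o Fin d) :
    coeff (A m) t = ev A stdVec (indexSet t) := by
  rw [← ev_eq A stdVec (indexSet t) (card_indexSet t), orderEmbOfFin_indexSet]
  rfl

theorem ev_stdVec {d m : ℕ} (A : (m : ℕ) → Alt d m) (T : Finset (Fin d)) (h : T.card = m) :
    ev A stdVec T = coeff (A m) (T.orderEmbOfFin h) := by
  rw [coeff_eq_ev, indexSet_orderEmbOfFin]

theorem dualForm_apply {d m : ℕ} (t : Fin m ↪o Fin d) (v : Fin m → Eucl d) :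
    dualForm t v = Matrix.det (Matrix.of fun r c => v r (t c)) := rfl

theorem indexSet_injective {d m : ℕ} :
    Function.Injective (indexSet : (Fin m ↪o Fin d) → Finset (Fin d)) := by
  intro t t' h
  have h1 := orderEmbOfFin_indexSet t
  have h2 := orderEmbOfFin_indexSet t'
  rw [← h1, ← h2]
  congr!

theorem coeff_dualForm {d m : ℕ} (t t' : Fin m ↪o Fin d) :
    coeff (dualForm t) t' = if t = t' then 1 else 0 := by
  rw [coeff, dualForm_apply]
  split_ifs with h
  · subst h
    convert Matrix.det_one (n := Fin m) (R := ℝ)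
    ext r c
    simp [stdVec, Matrix.one_apply, eq_comm]
  -- Distinct selections of equal length have distinct index sets of equal size, so some index of
  -- `t'` is missing from `t`; its row in the determinant is zero.
  · have : ∃ r, t' r ∉ indexSet t := by
      by_contra! hc
      apply h
      apply indexSet_injective
      symm
      apply Finset.eq_of_subset_of_card_le
      · intro x hx
        simp only [indexSet, Finset.mem_map, Finset.mem_univ, true_and] at hx
        obtain ⟨r, rfl⟩ := hx
        exact hc r
      · rw [card_indexSet, card_indexSet]
    obtain ⟨r, hr⟩ := this
    apply Matrix.det_eq_zero_of_row_eq_zero r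
    intro c
    have : t' r ≠ t c := by
      intro hh; apply hr; rw [hh]; simp [indexSet]
    simp [stdVec, this.symm]

theorem coeff_add {d m : ℕ} (α β : Alt d m) (t : Fin m ↪o Fin d) :
    coeff (α + β) t = coeff α t + coeff β t := rfl

theorem coeff_smul {d m : ℕ} (c : ℝ) (α : Alt d m) (t : Fin m ↪o Fin d) :
    coeff (c • α) t = c * coeff α t := rfl

theorem coeff_sum {d m : ℕ} {ι : Type*} (s : Finset ι) (α : ι → Alt d m) (t : Fin m ↪o Fin d) :
    coeff (∑ i ∈ s, α i) t = ∑ i ∈ s, coeff (α i) t := by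
  classical
  induction s using Finset.induction_on with
  | empty => simp [coeff]
  | insert i s hi ih => rw [Finset.sum_insert hi, Finset.sum_insert hi, coeff_add, ih]

theorem coeff_sum_dualForm {d m : ℕ} (c : (Fin m ↪o Fin d) → ℝ) (t : Fin m ↪o Fin d) :
    coeff (∑ t', c t' • dualForm t') t = c t := by
  rw [coeff_sum]
  simp [coeff_smul, coeff_dualForm]

/-- An alternating map is determined by its coefficients. -/
theorem alternatingMap_ext {d m : ℕ} {α β : Eucl d [⋀^Fin m]→ₗ[ℝ] ℝ}
    (h : ∀ t : Fin m ↪o Fin d, (α fun r => stdVec (t r)) = β fun r => stdVec (t r)) : α = β := by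
  apply (EuclideanSpace.basisFun (Fin d) ℝ).toBasis.ext_alternating
  intro v hv
  -- On distinct basis vectors the arguments can be sorted into an ordered selection; both maps then
  -- change by the same sign.
  have hm : Monotone (v ∘ Tuple.sort v) := Tuple.monotone_sort v
  have hs : StrictMono (v ∘ Tuple.sort v) :=
    hm.strictMono_of_injective (hv.comp (Tuple.sort v).injective)
  have h1 := h (OrderEmbedding.ofStrictMono _ hs)
  have hw : (fun r => stdVec (OrderEmbedding.ofStrictMono _ hs r)) =
      (fun i => stdVec (d := d) (v i)) ∘ Tuple.sort v := rfl
  rw [hw, α.map_perm, β.map_perm] at h1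
  have h2 : (fun i => (EuclideanSpace.basisFun (Fin d) ℝ).toBasis (v i)) =
      fun i => stdVec (d := d) (v i) := by
    funext i; simp [stdVec]
  rw [h2]
  rcases Int.units_eq_one_or (Equiv.Perm.sign (Tuple.sort v)) with hs | hs
  · rw [hs, one_smul, one_smul] at h1; exact h1
  · rw [hs, Units.neg_smul, Units.neg_smul, one_smul, one_smul] at h1; exact neg_injective h1

theorem alt_ext {d m : ℕ} {α β : Alt d m} (h : ∀ t, coeff α t = coeff β t) : α = β := by
  have key : α.toAlternatingMap = β.toAlternatingMap := alternatingMap_ext h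
  ext v
  exact DFunLike.congr_fun key v

theorem sum_coeff_dualForm {d m : ℕ} (α : Alt d m) : ∑ t, coeff α t • dualForm t = α :=
  alt_ext fun t => coeff_sum_dualForm _ t

theorem ev_star {d : ℕ} (a : GForm d) (x : Eucl d) (T : Finset (Fin d)) :
    ev (fun m => star a m x) stdVec T = shuffleSign Tᶜ * ev (fun m => a m x) stdVec Tᶜ := by
  rw [ev_stdVec _ T rfl]
  simp only [star]
  rw [coeff_sum_dualForm, complSel]
  rw [← ev_stdVec (fun m => a m x), indexSet_orderEmbOfFin]

theorem ev_starInv {d : ℕ} (a : GForm d) (x : Eucl d) (T : Finset (Fin d)) :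
    ev (fun m => starInv a m x) stdVec T = shuffleSign T * ev (fun m => a m x) stdVec Tᶜ := by
  rw [ev_stdVec _ T rfl]
  simp only [starInv]
  rw [coeff_sum_dualForm, complSel]
  rw [← ev_stdVec (fun m => a m x), indexSet_orderEmbOfFin]

/-- Sums over all ordered selections of a fixed length are sums over sets. -/
theorem sum_selection {d m : ℕ} (f : Finset (Fin d) → ℝ) :
    ∑ t : Fin m ↪o Fin d, f (indexSet t) = ∑ T ∈ Finset.powersetCard m Finset.univ, f T := by
  refine Finset.sum_bij (fun t _ => indexSet t) ?_ ?_ ?_ ?_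
  · intro t _; simp [Finset.mem_powersetCard, card_indexSet]
  · intro t _ t' _ h; exact indexSet_injective h
  · intro T hT
    rw [Finset.mem_powersetCard] at hT
    exact ⟨T.orderEmbOfFin hT.2, Finset.mem_univ _, indexSet_orderEmbOfFin T hT.2⟩
  · intro t _; rfl

/-- All degrees are merged: selections of any length correspond to subsets of `Fin d`. Integrability
is what allows the finite sum over degrees to move under the integral. -/
theorem innerOn_eq {d : ℕ} (S : Set (Eucl d)) (a b : GForm d)
    (h : ∀ (m : ℕ) (t : Fin m ↪o Fin d),
      IntegrableOn (fun x => coeff (a m x) t * coeff (b m x) t) S) :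
    innerOn S a b = ∫ x in S, ∑ T : Finset (Fin d),
      ev (fun m => a m x) stdVec T * ev (fun m => b m x) stdVec T := by
  rw [innerOn, ← integral_finsetSum]
  · congr 1; ext x
    have h1 : ∀ m, ∑ t : Fin m ↪o Fin d, coeff (a m x) t * coeff (b m x) t =
        ∑ T ∈ Finset.powersetCard m Finset.univ,
          ev (fun m => a m x) stdVec T * ev (fun m => b m x) stdVec T := by
      intro m
      rw [← sum_selection]
      refine Finset.sum_congr rfl fun t _ => ?_
      rw [← coeff_eq_ev (fun m => a m x), ← coeff_eq_ev (fun m => b m x)]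
    simp_rw [h1]
    rw [← Finset.powerset_univ, Finset.sum_powerset]
    simp
  · intro m _
    exact integrable_finsetSum _ fun t _ => h m t

/-! ### The exterior derivative and the codifferential in coefficients -/

/-- The number of elements of `T` below `r`. -/
def below {d : ℕ} (T : Finset (Fin d)) (r : Fin d) : ℕ := (T.filter (· < r)).card

/-- The alternating sum in the exterior derivative has signs given by positions in a list; this
turns them into data of the set `T` alone. -/
theorem below_orderEmbOfFin {d m : ℕ} (T : Finset (Fin d)) (h : T.card = m) (i : Fin m) :
    below T (T.orderEmbOfFin h i) = i := by
  have : T.filter (· < T.orderEmbOfFin h i) =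
      (Finset.univ.filter (· < i)).map (T.orderEmbOfFin h).toEmbedding := by
    ext x
    simp only [Finset.mem_filter, Finset.mem_map, Finset.mem_univ, true_and,
      RelEmbedding.coe_toEmbedding]
    constructor
    · rintro ⟨hx, hlt⟩
      have hx' : x ∈ Set.range (T.orderEmbOfFin h) := by
        rw [T.range_orderEmbOfFin h]; exact hx
      obtain ⟨y, rfl⟩ := hx'
      exact ⟨y, (T.orderEmbOfFin h).lt_iff_lt.1 hlt, rfl⟩
    · rintro ⟨y, hy, rfl⟩
      exact ⟨T.orderEmbOfFin_mem h y, (T.orderEmbOfFin h).lt_iff_lt.2 hy⟩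
  rw [below, this, Finset.card_map]
  simp [Finset.filter_gt_eq_Iio]

theorem orderEmbOfFin_erase {d m : ℕ} (T : Finset (Fin d)) (h : T.card = m + 1) (i : Fin (m + 1))
    (h' : (T.erase (T.orderEmbOfFin h i)).card = m) (r : Fin m) :
    (T.erase (T.orderEmbOfFin h i)).orderEmbOfFin h' r = T.orderEmbOfFin h (i.succAbove r) := by
  have : (fun r => T.orderEmbOfFin h (i.succAbove r)) =
      (T.erase (T.orderEmbOfFin h i)).orderEmbOfFin h' := by
    apply Finset.orderEmbOfFin_unique
    · intro x
      rw [Finset.mem_erase]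
      refine ⟨fun hx => ?_, T.orderEmbOfFin_mem h _⟩
      exact Fin.succAbove_ne i x ((T.orderEmbOfFin h).injective hx)
    · exact (T.orderEmbOfFin h).strictMono.comp (Fin.strictMono_succAbove i)
  exact (congrFun this r).symm

theorem sum_orderEmbOfFin {d m : ℕ} (T : Finset (Fin d)) (h : T.card = m) (f : Fin d → ℝ) :
    ∑ i : Fin m, f (T.orderEmbOfFin h i) = ∑ r ∈ T, f r := by
  have : T = Finset.univ.map (T.orderEmbOfFin h).toEmbedding := by
    conv_lhs => rw [← indexSet_orderEmbOfFin T h]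
    rfl
  conv_rhs => rw [this, Finset.sum_map]
  rfl

theorem ev_dOn {d : ℕ} (S : Set (Eucl d)) (a : GForm d) (x : Eucl d)
    (hS : UniqueDiffWithinAt ℝ S x) (ha : ∀ m, DifferentiableWithinAt ℝ (a m) S x)
    (T : Finset (Fin d)) :
    ev (fun m => dOn S a m x) stdVec T = ∑ r ∈ T, (-1 : ℝ) ^ below T r *
      fderivWithin ℝ (fun y => ev (fun m => a m y) stdVec (T.erase r)) S x (stdVec r) := by
  -- The empty set is separate because the part of degree 0 of `dOn` is zero by definition; the sum
  -- on the right is then empty.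
  rcases hT : T.card with _ | m
  · rw [Finset.card_eq_zero] at hT
    subst hT
    rw [Finset.sum_empty, ev_stdVec _ _ rfl]
    rfl
  · rw [← ev_eq _ _ _ hT]
    simp only [dOn]
    rw [extDerivWithin_apply (ha m) hS, ← sum_orderEmbOfFin T hT]
    refine Finset.sum_congr rfl fun i _ => ?_
    rw [below_orderEmbOfFin]
    have h' : (T.erase (T.orderEmbOfFin hT i)).card = m := by
      rw [Finset.card_erase_of_mem (T.orderEmbOfFin_mem hT i), hT]; rfl
    have : (fun y => ev (fun m => a m y) stdVec (T.erase (T.orderEmbOfFin hT i))) =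
        fun y => a m y (i.removeNth fun r => stdVec (T.orderEmbOfFin hT r)) := by
      funext y
      rw [← ev_eq _ _ _ h']
      congr 1
      funext r
      rw [orderEmbOfFin_erase]
      rfl
    rw [this, zsmul_eq_mul]
    push_cast
    rfl

/-- The number of inversions between `T` and its complement. -/
def inversions {d : ℕ} (T : Finset (Fin d)) : ℕ := ∑ p ∈ T, below Tᶜ p

theorem shuffleSign_eq {d : ℕ} (T : Finset (Fin d)) : shuffleSign T = (-1) ^ inversions T := by
  rw [shuffleSign, inversions, Finset.card_filter, Finset.sum_product]
  refine congrArg _ (Finset.sum_congr rfl fun p _ => ?_)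
  rw [below, Finset.card_filter]

theorem below_compl_insert {d : ℕ} (T : Finset (Fin d)) (r : Fin d) (hr : r ∉ T) (p : Fin d) :
    below Tᶜ p = below (insert r T)ᶜ p + if r < p then 1 else 0 := by
  have : Tᶜ = insert r (insert r T)ᶜ := by
    ext x
    by_cases h : x = r <;> simp [h, hr]
  conv_lhs => rw [below, this, Finset.filter_insert]
  split_ifs with h
  · rw [Finset.card_insert_of_notMem (by simp), below]
  · rw [below]; rfl

/-- When `r` moves from the complement into `T`, the inversions `(p, r)` with `r < p` disappear and
the inversions `(r, s)` with `s < r` appear. The number of the former is `T.card - below T r`, and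
the equation is arranged to avoid subtraction. -/
theorem inversions_insert {d : ℕ} (T : Finset (Fin d)) (r : Fin d) (hr : r ∉ T) :
    inversions T + below Tᶜ r + below T r = inversions (insert r T) + T.card := by
  have h1 : inversions T = ∑ p ∈ T, below (insert r T)ᶜ p + (T.filter (r < ·)).card := by
    rw [inversions, Finset.card_filter, ← Finset.sum_add_distrib]
    exact Finset.sum_congr rfl fun p _ => below_compl_insert T r hr p
  have h2 : inversions (insert r T) = below Tᶜ r + ∑ p ∈ T, below (insert r T)ᶜ p := by
    rw [inversions, Finset.sum_insert hr, below_compl_insert T r hr r]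
    simp
  have h3 : T.card = (T.filter (r < ·)).card + below T r := by
    rw [below, ← Finset.card_union_of_disjoint]
    · congr 1
      ext x
      have : x ∈ T → r < x ∨ x < r := fun hx => by
        rcases lt_trichotomy r x with h | h | h
        · exact Or.inl h
        · subst h; exact absurd hx hr
        · exact Or.inr h
      simp only [Finset.mem_union, Finset.mem_filter]
      tauto
    · rw [Finset.disjoint_filter]
      intro x _ h h'
      exact absurd h (not_lt.2 h'.le)
  omega

theorem differentiableWithinAt_ev {d q : ℕ} {S : Set (Eucl d)} {a : GForm d} {x : Eucl d}
    (ha : ∀ m, DifferentiableWithinAt ℝ (a m) S x) (v : Fin q → Eucl d) (T : Finset (Fin q)) :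
    DifferentiableWithinAt ℝ (fun y => ev (fun m => a m y) v T) S x :=
  (ha _).continuousAlternatingMap_apply_const _

/-- The signs of the two stars, of `d` and of the prefactor combine by `inversions_insert` into
`-(-1) ^ below T r`. Thus the codifferential is minus a contraction of the derivative, with no stars
left. -/
theorem ev_codOn {d : ℕ} (S : Set (Eucl d)) (a : GForm d) (x : Eucl d)
    (hS : UniqueDiffWithinAt ℝ S x) (ha : ∀ m, DifferentiableWithinAt ℝ (a m) S x)
    (T : Finset (Fin d)) :
    ev (fun m => codOn S a m x) stdVec T = - ∑ r ∈ Tᶜ, (-1 : ℝ) ^ below T r *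
      fderivWithin ℝ (fun y => ev (fun m => a m y) stdVec (insert r T)) S x (stdVec r) := by
  have hstar : ∀ m, DifferentiableWithinAt ℝ (star a m) S x := by
    intro m
    have e : star a m = fun y => ∑ t : Fin m ↪o Fin d,
      (shuffleSign (indexSet t)ᶜ * coeff (a _ y) (complSel t)) • dualForm t := rfl
    rw [e]
    refine DifferentiableWithinAt.fun_sum fun t _ => ?_
    refine DifferentiableWithinAt.smul_const ?_ _
    refine DifferentiableWithinAt.const_mul ?_ _
    exact (ha _).continuousAlternatingMap_apply_const _
  have h1 : ev (fun m => codOn S a m x) stdVec T =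
      (-1) ^ (T.card + 1) * ev (fun m => starInv (dOn S (star a)) m x) stdVec T := rfl
  rw [h1, ev_starInv, ev_dOn S (star a) x hS hstar, Finset.mul_sum, Finset.mul_sum,
    ← Finset.sum_neg_distrib]
  refine Finset.sum_congr rfl fun r hr => ?_
  rw [Finset.mem_compl] at hr
  have h2 : (Tᶜ.erase r) = (insert r T)ᶜ := by
    rw [Finset.compl_insert]
  have h3 : (fun y => ev (fun m => star a m y) stdVec (Tᶜ.erase r)) =
      fun y => shuffleSign (insert r T) * ev (fun m => a m y) stdVec (insert r T) := by
    funext y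
    rw [ev_star, h2, compl_compl]
  rw [h3, fderivWithin_const_mul hS (differentiableWithinAt_ev ha _ _)]
  rw [smul_apply, smul_eq_mul, shuffleSign_eq, shuffleSign_eq]
  have h4 := inversions_insert T r hr
  have h5 : (-1 : ℝ) ^ (T.card + 1) * ((-1) ^ inversions T * ((-1) ^ below Tᶜ r *
      (-1) ^ inversions (insert r T))) = - (-1) ^ below T r := by
    -- The missing factor `(-1) ^ below T r` completes the exponent to the one controlled by
    -- `inversions_insert`; it is removed again by `e2`.
    have e : (-1 : ℝ) ^ (T.card + 1) * ((-1) ^ inversions T * ((-1) ^ below Tᶜ r *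
      (-1) ^ inversions (insert r T))) * (-1) ^ below T r = -1 := by
      rw [← pow_add, ← pow_add, ← pow_add, ← pow_add]
      apply Odd.neg_one_pow
      rw [show T.card + 1 + (inversions T + (below Tᶜ r + inversions (insert r T))) + below T r =
        2 * (T.card + inversions (insert r T)) + 1 by omega]
      exact odd_two_mul_add_one _
    have e2 : ((-1 : ℝ) ^ below T r) * (-1) ^ below T r = 1 := by
      rw [← pow_add, ← two_mul]; exact Even.neg_one_pow (even_two_mul _)
    linear_combination (-1 : ℝ) ^ below T r * e -
      ((-1 : ℝ) ^ (T.card + 1) * ((-1) ^ inversions T * ((-1) ^ below Tᶜ r *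
      (-1) ^ inversions (insert r T)))) * e2
  linear_combination (fderivWithin ℝ (fun y => ev (fun m => a m y) stdVec (insert r T)) S x
    (stdVec r)) * h5

/-- The vector `V` with `⟨V, e_r⟩ = ⟨A, dx_r ∧ B⟩`. -/
def flux {d : ℕ} (A B : (m : ℕ) → Alt d m) : Eucl d :=
  WithLp.toLp 2 fun r => ∑ T : Finset (Fin d) with r ∉ T,
    (-1 : ℝ) ^ below T r * (ev A stdVec (insert r T) * ev B stdVec T)

theorem flux_apply {d : ℕ} (A B : (m : ℕ) → Alt d m) (r : Fin d) :
    flux A B r = ∑ T : Finset (Fin d) with r ∉ T,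
      (-1 : ℝ) ^ below T r * (ev A stdVec (insert r T) * ev B stdVec T) := rfl

/-- The bijection `(T, r) ↔ (T.erase r, r)`. It matches the terms of `d`, which erase an index, with
those of the codifferential, which insert one. -/
theorem sum_erase_insert {d : ℕ} (f : Finset (Fin d) → Fin d → ℝ) :
    ∑ T, ∑ r ∈ T, f T r = ∑ r, ∑ T : Finset (Fin d) with r ∉ T, f (insert r T) r := by
  have : ∀ T : Finset (Fin d), ∑ r ∈ T, f T r = ∑ r, if r ∈ T then f T r else 0 := by
    intro T; simp
  simp_rw [this]
  rw [Finset.sum_comm]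
  refine Finset.sum_congr rfl fun r _ => ?_
  rw [← Finset.sum_filter]
  refine Finset.sum_bij' (fun T _ => T.erase r) (fun T _ => insert r T) ?_ ?_ ?_ ?_ ?_
  · intro T hT; simp
  · intro T hT; simp
  · intro T hT; simp at hT; simp [Finset.insert_erase hT]
  · intro T hT; simp at hT; simp [Finset.erase_insert hT]
  · intro T hT; simp at hT; simp [Finset.insert_erase hT]

theorem below_insert_self {d : ℕ} (T : Finset (Fin d)) (r : Fin d) :
    below (insert r T) r = below T r := by
  rw [below, Finset.filter_insert]; simp [below]

/-- The divergence of a vector field. -/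
def divg {d : ℕ} (V : Eucl d → Eucl d) (x : Eucl d) : ℝ := ∑ r, fderiv ℝ V x (stdVec r) r

theorem differentiableAt_flux {d : ℕ} {a b : GForm d} {x : Eucl d}
    (ha : ∀ m, DifferentiableAt ℝ (a m) x) (hb : ∀ m, DifferentiableAt ℝ (b m) x) :
    DifferentiableAt ℝ (fun y => flux (fun m => a m y) (fun m => b m y)) x := by
  rw [differentiableAt_euclidean]
  intro r
  simp only [flux_apply]
  refine DifferentiableAt.fun_sum fun T _ => ?_
  refine DifferentiableAt.const_mul ?_ _
  exact ((ha _).continuousAlternatingMap_apply_const _).mul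
    ((hb _).continuousAlternatingMap_apply_const _)

/-- Leibniz rule: the derivatives of `b` assemble to ⟨a, db⟩, and those of `a` to -⟨d*a, b⟩, since
`ev_codOn` carries a minus sign. As `S` is a neighbourhood of `x`, the derivatives within `S` are
ordinary ones. -/
theorem divg_flux {d : ℕ} (S : Set (Eucl d)) (a b : GForm d) (x : Eucl d) (hS : S ∈ 𝓝 x)
    (ha : ∀ m, DifferentiableAt ℝ (a m) x) (hb : ∀ m, DifferentiableAt ℝ (b m) x) :
    divg (fun y => flux (fun m => a m y) (fun m => b m y)) x =
      (∑ T, ev (fun m => a m x) stdVec T * ev (fun m => dOn S b m x) stdVec T) -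
      ∑ T, ev (fun m => codOn S a m x) stdVec T * ev (fun m => b m x) stdVec T := by
  have hu : UniqueDiffWithinAt ℝ S x := uniqueDiffWithinAt_of_mem_nhds hS
  have hea : ∀ T, DifferentiableAt ℝ (fun y => ev (fun m => a m y) stdVec T) x :=
    fun T => (ha _).continuousAlternatingMap_apply_const _
  have heb : ∀ T, DifferentiableAt ℝ (fun y => ev (fun m => b m y) stdVec T) x :=
    fun T => (hb _).continuousAlternatingMap_apply_const _
  have h1 : ∀ r, fderiv ℝ (fun y => flux (fun m => a m y) (fun m => b m y)) x (stdVec r) r =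
      ∑ T : Finset (Fin d) with r ∉ T, (-1 : ℝ) ^ below T r *
        (ev (fun m => a m x) stdVec (insert r T) *
          fderiv ℝ (fun y => ev (fun m => b m y) stdVec T) x (stdVec r) +
        ev (fun m => b m x) stdVec T *
          fderiv ℝ (fun y => ev (fun m => a m y) stdVec (insert r T)) x (stdVec r)) := by
    intro r
    have e1 : fderiv ℝ (fun y => flux (fun m => a m y) (fun m => b m y)) x (stdVec r) r =
        fderiv ℝ (fun y => flux (fun m => a m y) (fun m => b m y) r) x (stdVec r) := by
      have := ((EuclideanSpace.proj (𝕜 := ℝ) r).hasFDerivAt.comp x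
        (differentiableAt_flux ha hb).hasFDerivAt).fderiv
      have h2 : fderiv ℝ (fun y => flux (fun m => a m y) (fun m => b m y) r) x = _ := this
      rw [h2]; rfl
    rw [e1]
    simp only [flux_apply]
    rw [fderiv_fun_sum]
    · rw [sum_apply]
      refine Finset.sum_congr rfl fun T _ => ?_
      rw [fderiv_const_mul ((hea _).fun_mul (heb _)), fderiv_fun_mul (hea _) (heb _)]
      simp only [smul_apply, add_apply, smul_eq_mul]
    · intro T _
      exact ((hea _).mul (heb _)).const_mul _
  simp only [divg, h1]
  have h2 : ∀ T, ev (fun m => a m x) stdVec T * ev (fun m => dOn S b m x) stdVec T =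
      ∑ r ∈ T, (-1 : ℝ) ^ below T r * (ev (fun m => a m x) stdVec T *
        fderiv ℝ (fun y => ev (fun m => b m y) stdVec (T.erase r)) x (stdVec r)) := by
    intro T
    rw [ev_dOn S b x hu fun m => (hb m).differentiableWithinAt, Finset.mul_sum]
    refine Finset.sum_congr rfl fun r _ => ?_
    rw [fderivWithin_of_mem_nhds hS]; ring
  have h3 : ∀ T, ev (fun m => codOn S a m x) stdVec T * ev (fun m => b m x) stdVec T =
      - ∑ r, if r ∉ T then (-1 : ℝ) ^ below T r * (ev (fun m => b m x) stdVec T *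
        fderiv ℝ (fun y => ev (fun m => a m y) stdVec (insert r T)) x (stdVec r)) else 0 := by
    intro T
    rw [ev_codOn S a x hu fun m => (ha m).differentiableWithinAt, neg_mul, Finset.sum_mul,
      ← Finset.sum_filter]
    congr 1
    refine Finset.sum_congr (by ext; simp) fun r _ => ?_
    rw [fderivWithin_of_mem_nhds hS]; ring
  simp_rw [h2, h3]
  rw [sum_erase_insert, Finset.sum_neg_distrib, Finset.sum_comm, sub_neg_eq_add,
    ← Finset.sum_add_distrib]
  refine Finset.sum_congr rfl fun r _ => ?_
  rw [← Finset.sum_filter, ← Finset.sum_add_distrib]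
  refine Finset.sum_congr rfl fun T hT => ?_
  rw [Finset.mem_filter] at hT
  rw [below_insert_self, Finset.erase_insert hT.2]
  ring

/-! ### The shuffle product of alternating forms -/

/-- Families of alternating maps, one of each degree. -/
abbrev AltFam (d : ℕ) : Type := (m : ℕ) → Eucl d [⋀^Fin m]→ₗ[ℝ] ℝ

/-- Insertion of a vector in the first argument. -/
def contract {d : ℕ} (v : Eucl d) (B : AltFam d) : AltFam d := fun m => (B (m + 1)).curryLeft v

/-- The grading involution. -/
def grade {d : ℕ} (B : AltFam d) : AltFam d := fun m => (-1 : ℝ) ^ m • B m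

theorem contract_add {d : ℕ} (v : Eucl d) (B B' : AltFam d) :
    contract v (B + B') = contract v B + contract v B' := rfl

theorem contract_smul {d : ℕ} (v : Eucl d) (c : ℝ) (B : AltFam d) :
    contract v (c • B) = c • contract v B := rfl

theorem contract_add_left {d : ℕ} (v w : Eucl d) (B : AltFam d) :
    contract (v + w) B = contract v B + contract w B := by
  funext m; exact (B (m + 1)).curryLeft.map_add v w

theorem contract_smul_left {d : ℕ} (c : ℝ) (v : Eucl d) (B : AltFam d) :
    contract (c • v) B = c • contract v B := by
  funext m; exact (B (m + 1)).curryLeft.map_smul c v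

theorem contract_self {d : ℕ} (v : Eucl d) (B : AltFam d) : contract v (contract v B) = 0 := by
  funext m; exact AlternatingMap.curryLeft_same _ _

theorem grade_add {d : ℕ} (B B' : AltFam d) : grade (B + B') = grade B + grade B' := by
  funext m; exact smul_add _ _ _

theorem grade_smul {d : ℕ} (c : ℝ) (B : AltFam d) : grade (c • B) = c • grade B := by
  funext m; exact smul_comm ((-1 : ℝ) ^ m) c (B m)

theorem contract_grade {d : ℕ} (v : Eucl d) (B : AltFam d) :
    contract v (grade B) = -grade (contract v B) := by
  funext m
  ext w
  simp [contract, grade, pow_succ]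

/-- The value of the wedge product of `B` and `C` on `q` vectors, by expansion along the first. -/
def wedge {d : ℕ} : (q : ℕ) → AltFam d → AltFam d → (Fin q → Eucl d) → ℝ
  | 0, B, C, v => B 0 v * C 0 v
  | q + 1, B, C, v => wedge q (contract (v 0) B) C (Fin.tail v) +
      wedge q (grade B) (contract (v 0) C) (Fin.tail v)

theorem wedge_succ {d q : ℕ} (B C : AltFam d) (v : Fin (q + 1) → Eucl d) :
    wedge (q + 1) B C v = wedge q (contract (v 0) B) C (Fin.tail v) +
      wedge q (grade B) (contract (v 0) C) (Fin.tail v) := rfl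

theorem wedge_add_left {d q : ℕ} (B B' C : AltFam d) (v : Fin q → Eucl d) :
    wedge q (B + B') C v = wedge q B C v + wedge q B' C v := by
  induction q generalizing B B' C with
  | zero => simp [wedge, add_mul]
  | succ q ih => simp only [wedge, contract_add, grade_add, ih]; ring

theorem wedge_smul_left {d q : ℕ} (c : ℝ) (B C : AltFam d) (v : Fin q → Eucl d) :
    wedge q (c • B) C v = c * wedge q B C v := by
  induction q generalizing B C with
  | zero => simp [wedge, mul_assoc]
  | succ q ih => simp only [wedge, contract_smul, grade_smul, ih]; ring

theorem wedge_add_right {d q : ℕ} (B C C' : AltFam d) (v : Fin q → Eucl d) :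
    wedge q B (C + C') v = wedge q B C v + wedge q B C' v := by
  induction q generalizing B C C' with
  | zero => simp [wedge, mul_add]
  | succ q ih => simp only [wedge, contract_add, ih]; ring

theorem wedge_smul_right {d q : ℕ} (c : ℝ) (B C : AltFam d) (v : Fin q → Eucl d) :
    wedge q B (c • C) v = c * wedge q B C v := by
  induction q generalizing B C with
  | zero => simp [wedge]; ring
  | succ q ih => simp only [wedge, contract_smul, ih]; ring

/-- The wedge product as a multilinear map. -/
def wedgeMultilinear {d : ℕ} (q : ℕ) (B C : AltFam d) :
    MultilinearMap ℝ (fun _ : Fin q => Eucl d) ℝ where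
  toFun := wedge q B C
  map_update_add' := by
    intro inst v i x y
    rw [Subsingleton.elim inst (instDecidableEqFin q)]
    induction q generalizing B C with
    | zero => exact i.elim0
    | succ q ih =>
      refine Fin.cases ?_ (fun i => ?_) i
      · simp only [wedge, Function.update_self, contract_add_left, Fin.tail_update_zero,
          wedge_add_left, wedge_add_right]
        ring
      · simp only [wedge, Fin.tail_update_succ, ih]
        rw [Function.update_of_ne (Fin.succ_ne_zero i).symm,
          Function.update_of_ne (Fin.succ_ne_zero i).symm,
          Function.update_of_ne (Fin.succ_ne_zero i).symm]
        ring
  map_update_smul' := by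
    intro inst v i c x
    rw [Subsingleton.elim inst (instDecidableEqFin q)]
    induction q generalizing B C with
    | zero => exact i.elim0
    | succ q ih =>
      refine Fin.cases ?_ (fun i => ?_) i
      · simp only [wedge, Function.update_self, contract_smul_left, Fin.tail_update_zero,
          wedge_smul_left, wedge_smul_right, smul_eq_mul]
        ring
      · simp only [wedge, Fin.tail_update_succ, ih, smul_eq_mul]
        rw [Function.update_of_ne (Fin.succ_ne_zero i).symm,
          Function.update_of_ne (Fin.succ_ne_zero i).symm]
        ring

theorem wedge_zero_left {d q : ℕ} (C : AltFam d) (v : Fin q → Eucl d) : wedge q 0 C v = 0 := by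
  have := wedge_smul_left 0 (0 : AltFam d) C v
  simpa using this

theorem wedge_zero_right {d q : ℕ} (B : AltFam d) (v : Fin q → Eucl d) : wedge q B 0 v = 0 := by
  have := wedge_smul_right 0 B (0 : AltFam d) v
  simpa using this

theorem wedge_neg_left {d q : ℕ} (B C : AltFam d) (v : Fin q → Eucl d) :
    wedge q (-B) C v = - wedge q B C v := by
  rw [← neg_one_smul ℝ B, wedge_smul_left, neg_one_mul]

/-- Two expansions give four terms. Those contracting one factor twice vanish, and the two mixed
ones cancel because contraction anticommutes with `grade`. -/
theorem wedge_cons_cons_self {d q : ℕ} (B C : AltFam d) (v : Fin (q + 2) → Eucl d)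
    (h : v 0 = v 1) : wedge (q + 2) B C v = 0 := by
  have h1 : Fin.tail v 0 = v 0 := h.symm
  simp only [wedge, h1, contract_self, wedge_zero_left, wedge_zero_right, contract_grade,
    wedge_neg_left]
  ring

/-- The wedge product as an alternating map. -/
def wedgeAlt {d : ℕ} (q : ℕ) (B C : AltFam d) : Eucl d [⋀^Fin q]→ₗ[ℝ] ℝ :=
  { wedgeMultilinear q B C with
    map_eq_zero_of_eq' := by
      change ∀ v i j, v i = v j → i ≠ j → wedge q B C v = 0
      induction q generalizing B C with
      | zero => intro v i; exact i.elim0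
      | succ q ih =>
        have key : ∀ (v : Fin (q + 1) → Eucl d) (j : Fin q), v 0 = v j.succ →
            wedge (q + 1) B C v = 0 := by
          intro v j hv
          rcases q with _ | q
          · exact j.elim0
          · by_cases hj : j = 0
            · subst hj; exact wedge_cons_cons_self B C v hv
            -- Equal arguments at the places 0 and `j.succ` are brought to the places 0 and 1 by a
            -- transposition in the tail. The tail may be permuted with a sign, as the wedge of `q +
            -- 1` arguments is alternating by induction.
            · let w : Fin (q + 2) → Eucl d := Fin.cons (v 0) (Fin.tail v ∘ Equiv.swap 0 j)
              have hw : wedge (q + 2) B C w = 0 := by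
                apply wedge_cons_cons_self
                change v 0 = v (Equiv.swap 0 j 0).succ
                rw [Equiv.swap_apply_left, hv]
              have hs : ∀ B C : AltFam d, wedge (q + 1) B C (Fin.tail v ∘ Equiv.swap 0 j) =
                  - wedge (q + 1) B C (Fin.tail v) := by
                intro B C
                let α : Eucl d [⋀^Fin (q + 1)]→ₗ[ℝ] ℝ :=
                  { wedgeMultilinear (q + 1) B C with
                    map_eq_zero_of_eq' := fun v i j hv hij => ih B C v i j hv hij }
                exact α.map_swap (Fin.tail v) (Ne.symm hj)
              have e : wedge (q + 2) B C w = - wedge (q + 2) B C v := by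
                have ht : Fin.tail w = Fin.tail v ∘ Equiv.swap 0 j := Fin.tail_cons _ _
                have h0 : w 0 = v 0 := rfl
                rw [wedge_succ B C w, wedge_succ B C v, ht, h0, hs, hs]
                ring
              linarith
        intro v i j hv hij
        refine Fin.cases ?_ (fun i => ?_) i (motive := fun i => v i = v j → i ≠ j →
          wedge (q + 1) B C v = 0) hv hij
        · intro hv hij
          obtain ⟨j, rfl⟩ := Fin.exists_succ_eq.2 hij.symm
          exact key v j hv
        · intro hv hij
          by_cases hj : j = 0
          · subst hj; exact key v i hv.symm
          · obtain ⟨j, rfl⟩ := Fin.exists_succ_eq.2 hj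
            have hij' : i ≠ j := fun h => hij (by rw [h])
            rw [wedge, ih _ _ (Fin.tail v) i j hv hij', ih _ _ (Fin.tail v) i j hv hij', add_zero] }

theorem wedgeAlt_apply {d : ℕ} (q : ℕ) (B C : AltFam d) (v : Fin q → Eucl d) :
    wedgeAlt q B C v = wedge q B C v := rfl

/-! ### The wedge product as a sum over sets -/

/-- The case distinction `0 ∈ T` corresponds to the two terms of the recursion for `wedge`: the
first vector is fed to one factor or to the other. -/
theorem sum_finset_fin_succ {q : ℕ} (f : Finset (Fin (q + 1)) → ℝ) :
    ∑ T, f T = ∑ T : Finset (Fin q), f (insert 0 (T.map (Fin.succEmb q))) +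
      ∑ T : Finset (Fin q), f (T.map (Fin.succEmb q)) := by
  have h : (Finset.univ : Finset (Fin (q + 1))) =
      insert 0 (Finset.univ.map (Fin.succEmb q)) := by
    ext x
    refine Fin.cases ?_ (fun x => ?_) x <;> simp
  rw [← Finset.powerset_univ, h, Finset.sum_powerset_insert (by simp), add_comm]
  have key : ∀ g : Finset (Fin (q + 1)) → ℝ,
      ∑ t ∈ (Finset.univ.map (Fin.succEmb q)).powerset, g t =
        ∑ T : Finset (Fin q), g (T.map (Fin.succEmb q)) := by
    intro g
    symm
    refine Finset.sum_bij (fun T _ => T.map (Fin.succEmb q)) ?_ ?_ ?_ ?_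
    · intro T _
      rw [Finset.mem_powerset]
      exact Finset.map_subset_map.2 (Finset.subset_univ _)
    · intro T _ T' _ hh; exact Finset.map_injective _ hh
    · intro T hT
      rw [Finset.mem_powerset, Finset.subset_map_iff] at hT
      obtain ⟨u, _, rfl⟩ := hT
      exact ⟨u, Finset.mem_univ _, rfl⟩
    · intro T _; rfl
  rw [key f, key fun t => f (insert 0 t)]

/-- The value of a family of alternating maps on the vectors `v r`, `r ∈ T`. -/
def eva {d q : ℕ} (A : AltFam d) (v : Fin q → Eucl d) (T : Finset (Fin q)) : ℝ :=
  A T.card fun r => v (T.orderEmbOfFin rfl r)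

theorem eva_eq {d q m : ℕ} (A : AltFam d) (v : Fin q → Eucl d) (T : Finset (Fin q))
    (h : T.card = m) : A m (fun r => v (T.orderEmbOfFin h r)) = eva A v T := by
  subst h; rfl

theorem eva_map {d q p : ℕ} (A : AltFam d) (v : Fin p → Eucl d) (e : Fin q ↪o Fin p)
    (T : Finset (Fin q)) : eva A v (T.map e.toEmbedding) = eva A (v ∘ e) T := by
  have h : (T.map e.toEmbedding).card = T.card := Finset.card_map _
  rw [← eva_eq A v _ h, ← eva_eq A _ T rfl]
  congr 1
  funext r
  have : (fun r => e (T.orderEmbOfFin rfl r)) = (T.map e.toEmbedding).orderEmbOfFin h := by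
    apply Finset.orderEmbOfFin_unique
    · intro x
      exact Finset.mem_map_of_mem _ (T.orderEmbOfFin_mem rfl x)
    · exact e.strictMono.comp (T.orderEmbOfFin rfl).strictMono
  rw [← this]; rfl

theorem eva_map_succ {d q : ℕ} (A : AltFam d) (v : Fin (q + 1) → Eucl d) (T : Finset (Fin q)) :
    eva A v (T.map (Fin.succEmb q)) = eva A (Fin.tail v) T :=
  eva_map A v (Fin.succOrderEmb q) T

theorem eva_insert_zero {d q : ℕ} (A : AltFam d) (v : Fin (q + 1) → Eucl d) (T : Finset (Fin q)) :
    eva A v (insert 0 (T.map (Fin.succEmb q))) = eva (contract (v 0) A) (Fin.tail v) T := by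
  have h : (insert 0 (T.map (Fin.succEmb q))).card = T.card + 1 := by
    rw [Finset.card_insert_of_notMem (by simp), Finset.card_map]
  rw [← eva_eq A v _ h, ← eva_eq _ _ T rfl]
  change _ = A (T.card + 1) (Matrix.vecCons _ _)
  congr 1
  have : (Fin.cons 0 fun r => (T.orderEmbOfFin rfl r).succ : Fin (T.card + 1) → Fin (q + 1)) =
      (insert 0 (T.map (Fin.succEmb q))).orderEmbOfFin h := by
    apply Finset.orderEmbOfFin_unique
    · intro x
      refine Fin.cases ?_ (fun x => ?_) x
      · simp
      · simp
    · intro i j hij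
      obtain ⟨j, rfl⟩ := Fin.exists_succ_eq.2 (Fin.ne_zero_of_lt hij)
      refine Fin.cases (fun _ => ?_) (fun i hij => ?_) i hij
      · exact Fin.succ_pos _
      · exact Fin.succ_lt_succ_iff.2
          ((T.orderEmbOfFin rfl).strictMono (Fin.succ_lt_succ_iff.1 hij))
  rw [← this]
  funext r
  refine Fin.cases ?_ (fun x => ?_) r
  · rfl
  · rfl

theorem compl_insert_zero {q : ℕ} (T : Finset (Fin q)) :
    (insert 0 (T.map (Fin.succEmb q)))ᶜ = Tᶜ.map (Fin.succEmb q) := by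
  ext x
  refine Fin.cases ?_ (fun x => ?_) x <;> simp

theorem compl_map_succ {q : ℕ} (T : Finset (Fin q)) :
    (T.map (Fin.succEmb q))ᶜ = insert 0 (Tᶜ.map (Fin.succEmb q)) := by
  rw [← compl_compl (insert 0 _), compl_insert_zero, compl_compl]

theorem below_map {p q : ℕ} (e : Fin q ↪o Fin p) (T : Finset (Fin q)) (r : Fin q) :
    below (T.map e.toEmbedding) (e r) = below T r := by
  rw [below, Finset.filter_map, Finset.card_map, below]
  congr 1
  ext x
  simp

theorem below_zero {q : ℕ} (T : Finset (Fin (q + 1))) : below T 0 = 0 := by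
  simp [below]

theorem inversions_insert_zero {q : ℕ} (T : Finset (Fin q)) :
    inversions (insert 0 (T.map (Fin.succEmb q))) = inversions T := by
  rw [inversions, Finset.sum_insert (by simp), below_zero, compl_insert_zero, Finset.sum_map,
    zero_add, inversions]
  exact Finset.sum_congr rfl fun p _ => below_map (Fin.succOrderEmb q) Tᶜ p

/-- Here 0 lies in the complement and is below every element of the shifted set, hence one
additional inversion per element. This is the sign that `grade` inserts in `wedge`. -/
theorem inversions_map_succ {q : ℕ} (T : Finset (Fin q)) :
    inversions (T.map (Fin.succEmb q)) = inversions T + T.card := by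
  rw [inversions, compl_map_succ, Finset.sum_map, inversions, Finset.card_eq_sum_ones,
    ← Finset.sum_add_distrib]
  refine Finset.sum_congr rfl fun p _ => ?_
  rw [below, Finset.filter_insert, if_pos (show 0 < (Fin.succEmb q) p from Fin.succ_pos p),
    Finset.card_insert_of_notMem fun h => by simpa using (Finset.mem_filter.1 h).1]
  congr 1
  exact below_map (Fin.succOrderEmb q) Tᶜ p

theorem eva_grade {d q : ℕ} (A : AltFam d) (v : Fin q → Eucl d) (T : Finset (Fin q)) :
    eva (grade A) v T = (-1) ^ T.card * eva A v T := rfl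

theorem wedge_eq_sum {d q : ℕ} (B C : AltFam d) (v : Fin q → Eucl d) :
    wedge q B C v = ∑ T : Finset (Fin q), shuffleSign T * (eva B v T * eva C v Tᶜ) := by
  induction q generalizing B C with
  | zero =>
    rw [Fintype.sum_eq_single ∅ (fun T hT => absurd (Subsingleton.elim T ∅) hT)]
    have h : ((∅ : Finset (Fin 0))ᶜ) = ∅ := Subsingleton.elim _ _
    rw [h, shuffleSign_eq, inversions, Finset.sum_empty, pow_zero, one_mul,
      ← eva_eq B v ∅ rfl, ← eva_eq C v ∅ rfl, wedge]
    congr 2 <;> exact Subsingleton.elim _ _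
  | succ q ih =>
    rw [sum_finset_fin_succ, wedge, ih, ih]
    congr 1
    · refine Finset.sum_congr rfl fun T _ => ?_
      rw [eva_insert_zero, compl_insert_zero, eva_map_succ, shuffleSign_eq, shuffleSign_eq,
        inversions_insert_zero]
    · refine Finset.sum_congr rfl fun T _ => ?_
      rw [eva_map_succ, compl_map_succ, eva_insert_zero, shuffleSign_eq, shuffleSign_eq,
        inversions_map_succ, eva_grade, pow_add]
      ring

/-! ### The flux through a hyperplane -/

/-- The determinant of the matrix with the columns `V, v 0, …, v (q-1)`. -/
def bdet {d q : ℕ} (h : d = q + 1) (V : Eucl d) (v : Fin q → Eucl d) : ℝ :=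
  Matrix.det (Matrix.of fun r c : Fin (q + 1) =>
    (Fin.cons V v : Fin (q + 1) → Eucl d) c (Fin.cast h.symm r))

/-- `bdet` as an alternating map of all its arguments. -/
def detAlt (q : ℕ) : Eucl (q + 1) [⋀^Fin (q + 1)]→ₗ[ℝ] ℝ :=
  (Matrix.detRowAlternating (R := ℝ) (n := Fin (q + 1))).compLinearMap
    (WithLp.linearEquiv 2 ℝ (Fin (q + 1) → ℝ)).toLinearMap

theorem bdet_eq {q : ℕ} (V : Eucl (q + 1)) (v : Fin q → Eucl (q + 1)) :
    bdet rfl V v = detAlt q (Fin.cons V v) := by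
  rw [bdet, ← Matrix.det_transpose]
  rfl

theorem exists_eq_succAbove {q : ℕ} (t : Fin q ↪o Fin (q + 1)) :
    ∃ r : Fin (q + 1), t = Fin.succAboveOrderEmb r := by
  have h : (indexSet t)ᶜ.card = 1 := by
    rw [Finset.card_compl, card_indexSet]; simp
  obtain ⟨r, hr⟩ := Finset.card_eq_one.1 h
  refine ⟨r, indexSet_injective ?_⟩
  rw [← compl_inj_iff, hr]
  ext x
  simp only [indexSet, Finset.mem_compl, Finset.mem_singleton, Finset.mem_map, Finset.mem_univ,
    true_and, RelEmbedding.coe_toEmbedding, Fin.succAboveOrderEmb_apply, not_exists]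
  constructor
  · rintro rfl y; exact Fin.succAbove_ne _ y
  · intro hx; by_contra hne
    obtain ⟨y, hy⟩ := Fin.exists_succAbove_eq hne
    exact hx y hy

/-- Expansion along the first column: deleting a row other than `r` leaves the row `r`, in which all
the remaining standard vectors vanish. -/
theorem bdet_succAbove {q : ℕ} (V : Eucl (q + 1)) (r : Fin (q + 1)) :
    bdet rfl V (fun c => stdVec (r.succAbove c)) = (-1) ^ (r : ℕ) * V r := by
  rw [bdet, Matrix.det_succ_column_zero, Finset.sum_eq_single r]
  · have : (Matrix.submatrix (Matrix.of fun r' c : Fin (q + 1) =>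
        (Fin.cons V (fun c => stdVec (r.succAbove c)) : Fin (q + 1) → Eucl (q + 1)) c
          (Fin.cast rfl r')) r.succAbove Fin.succ) = 1 := by
      ext i j
      simp [stdVec, Matrix.one_apply]
    rw [this, Matrix.det_one]
    simp
  · intro i _ hi
    obtain ⟨j, rfl⟩ := Fin.exists_succAbove_eq hi.symm
    rw [Matrix.det_eq_zero_of_row_eq_zero j, mul_zero]
    intro c
    simp [stdVec]
  · simp

/-- The flux of `flux A B` through the hyperplane spanned by `v` is `B ∧ ⋆A`. -/
theorem bdet_flux {q : ℕ} (a : GForm (q + 1)) (B : (m : ℕ) → Alt (q + 1) m) (x : Eucl (q + 1))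
    (v : Fin q → Eucl (q + 1)) :
    bdet rfl (flux (fun m => a m x) B) v =
      ∑ T : Finset (Fin q), shuffleSign T * (ev B v T * ev (fun m => star a m x) v Tᶜ) := by
  let Bf : AltFam (q + 1) := fun m => (B m).toAlternatingMap
  let Cf : AltFam (q + 1) := fun m => (star a m x).toAlternatingMap
  -- Both sides are alternating in `v`, so standard vectors suffice, and a selection of `q` among `q
  -- + 1` indices omits exactly one index `r`. The terms are then matched through subsets not
  -- containing `r`.
  have h : (detAlt q).curryLeft (flux (fun m => a m x) B) = wedgeAlt q Bf Cf := by
    apply alternatingMap_ext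
    intro t
    obtain ⟨r, rfl⟩ := exists_eq_succAbove t
    have h1 : (detAlt q).curryLeft (flux (fun m => a m x) B)
        (fun c => stdVec (Fin.succAboveOrderEmb r c)) =
        bdet rfl (flux (fun m => a m x) B) (fun c => stdVec (r.succAbove c)) := by
      rw [bdet_eq]; rfl
    rw [h1, bdet_succAbove, wedgeAlt_apply, wedge_eq_sum, flux_apply, Finset.mul_sum]
    symm
    refine Finset.sum_bij (fun T _ => T.map (Fin.succAboveEmb r)) ?_ ?_ ?_ ?_
    · intro T _; simp
    · intro T _ T' _ hh; exact Finset.map_injective _ hh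
    · intro T hT
      have : T ⊆ Finset.univ.map (Fin.succAboveEmb r) := by
        intro x hx
        have hxr : x ≠ r := by rintro rfl; simp at hT; exact hT hx
        obtain ⟨y, rfl⟩ := Fin.exists_succAbove_eq hxr
        simp
      rw [Finset.subset_map_iff] at this
      obtain ⟨u, _, rfl⟩ := this
      exact ⟨u, Finset.mem_univ _, rfl⟩
    · intro t _
      set T := t.map (Fin.succAboveEmb r) with hT
      have hrT : r ∉ T := by simp [hT]
      have hc : tᶜ.map (Fin.succAboveEmb r) = (insert r T)ᶜ := by
        ext x
        by_cases hx : x = r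
        · simp [hx]
        · obtain ⟨y, rfl⟩ := Fin.exists_succAbove_eq hx
          simp [hT]
      have e1 : eva Bf (fun c => stdVec (Fin.succAboveOrderEmb r c)) t = ev B stdVec T :=
        (eva_map Bf stdVec (Fin.succAboveOrderEmb r) t).symm
      have e2 : eva Cf (fun c => stdVec (Fin.succAboveOrderEmb r c)) tᶜ =
          shuffleSign (insert r T) * ev (fun m => a m x) stdVec (insert r T) := by
        rw [← compl_compl (insert r T), ← ev_star, ← hc]
        exact (eva_map Cf stdVec (Fin.succAboveOrderEmb r) tᶜ).symm
      have e3 : inversions t + below Tᶜ r = inversions (insert r T) := by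
        have h2 : inversions (insert r T) = below Tᶜ r + ∑ p ∈ T, below (insert r T)ᶜ p := by
          rw [inversions, Finset.sum_insert hrT, below_compl_insert T r hrT r]
          simp
        rw [h2, ← hc, hT, Finset.sum_map, add_comm, inversions]
        congr 1
        exact Finset.sum_congr rfl fun p _ => (below_map (Fin.succAboveOrderEmb r) tᶜ p).symm
      -- This splits the sign `(-1) ^ r` of the cofactor into the sign in `flux` and the change of
      -- inversions in `e3`.
      have e4 : below T r + below Tᶜ r = r := by
        rw [below, below, ← Finset.card_union_of_disjoint, ← Finset.filter_union,
          Finset.union_compl]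
        · simp [Finset.filter_gt_eq_Iio]
        · exact Finset.disjoint_filter_filter disjoint_compl_right
      rw [e1, e2, shuffleSign_eq, shuffleSign_eq, ← e3]
      have e5 : ((-1 : ℝ) ^ inversions t) * (-1) ^ inversions t = 1 := by
        rw [← pow_add, ← two_mul]; exact Even.neg_one_pow (even_two_mul _)
      have e6 : ((-1 : ℝ) ^ below T r) * (-1) ^ below T r = 1 := by
        rw [← pow_add, ← two_mul]; exact Even.neg_one_pow (even_two_mul _)
      rw [← e4, pow_add, pow_add]
      linear_combination (-1) ^ below Tᶜ r * ev (fun m => a m x) stdVec (insert r T) *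
        ev B stdVec T * (e5 - e6)
  have h2 := DFunLike.congr_fun h v
  rw [wedgeAlt_apply, wedge_eq_sum] at h2
  rw [bdet_eq]
  exact h2

/-! ### Local defining functions of domains with smooth boundary -/

/-- `ρ` is a local defining function of `X` at `x`. -/
def Defines {d : ℕ} (X : Set (Eucl d)) (ρ : Eucl d → ℝ) (x : Eucl d) : Prop :=
  ContDiff ℝ ∞ ρ ∧ fderiv ℝ ρ x ≠ 0 ∧ ∀ᶠ y in 𝓝 x, y ∈ X ↔ ρ y < 0

theorem HasSmoothBoundary.exists_defines {d : ℕ} {X : Set (Eucl d)} (hX : HasSmoothBoundary X)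
    {x : Eucl d} (hx : x ∈ frontier X) : ∃ ρ, Defines X ρ x := by
  obtain ⟨U, hU, ρ, h1, h2, h3⟩ := hX x hx
  exact ⟨ρ, h1, h2, Filter.mem_of_superset hU h3⟩

theorem Defines.hasFDerivAt {d : ℕ} {X : Set (Eucl d)} {ρ : Eucl d → ℝ} {x : Eucl d}
    (h : Defines X ρ x) (y : Eucl d) : HasFDerivAt ρ (fderiv ℝ ρ y) y :=
  (h.1.differentiable (by simp) y).hasFDerivAt

theorem Defines.eventually {d : ℕ} {X : Set (Eucl d)} {ρ : Eucl d → ℝ} {x : Eucl d}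
    (h : Defines X ρ x) : ∀ᶠ y in 𝓝 x, Defines X ρ y := by
  have hc : Continuous (fderiv ℝ ρ) := h.1.continuous_fderiv (by simp)
  filter_upwards [h.2.2.eventually_nhds, hc.continuousAt.eventually_ne h.2.1] with y h1 h2
  exact ⟨h.1, h2, h1⟩

/-- A frontier point is outside the open set `X`, so ρ is not negative there, and it is a limit of
points of `X`, so ρ is not positive. -/
theorem Defines.eq_zero {d : ℕ} {X : Set (Eucl d)} {ρ : Eucl d → ℝ} {x : Eucl d}
    (hX : IsOpen X) (h : Defines X ρ x) (hx : x ∈ frontier X) : ρ x = 0 := by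
  have h1 : x ∉ X := by
    rw [hX.frontier_eq] at hx; exact hx.2
  have h2 : ¬ ρ x < 0 := fun hc => h1 (h.2.2.self_of_nhds.2 hc)
  have h3 : ρ x ≤ 0 := by
    have hcl : x ∈ closure X := frontier_subset_closure hx
    have hf := mem_closure_iff_frequently.1 hcl
    refine le_of_tendsto_of_frequently (h.1.continuous.tendsto x) ?_
    refine (hf.and_eventually h.2.2).mono ?_
    rintro y ⟨hy, hyy⟩
    exact (hyy.1 hy).le
  linarith

theorem tendsto_add_smul {d : ℕ} (x v : Eucl d) :
    Filter.Tendsto (fun t : ℝ => x + t • v) (𝓝[>] 0) (𝓝 x) := by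
  have : Continuous fun t : ℝ => x + t • v := by fun_prop
  have h := this.tendsto 0
  simp only [zero_smul, add_zero] at h
  exact h.mono_left nhdsWithin_le_nhds

theorem Defines.eventually_slope {d : ℕ} {X : Set (Eucl d)} {ρ : Eucl d → ℝ} {x v : Eucl d}
    (h : Defines X ρ x) (h0 : ρ x = 0) (hv : 0 < fderiv ℝ ρ x v) :
    ∀ᶠ t : ℝ in 𝓝[>] 0, 0 < ρ (x + t • v) := by
  have hl : HasDerivAt (fun t : ℝ => ρ (x + t • v)) (fderiv ℝ ρ x v) 0 := by
    have h1 : HasDerivAt (fun t : ℝ => x + t • v) v 0 := by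
      simpa using ((hasDerivAt_id (0 : ℝ)).smul_const v).const_add x
    have h2 : HasFDerivAt ρ (fderiv ℝ ρ x) (x + (0 : ℝ) • v) := by
      simpa using h.hasFDerivAt x
    exact h2.comp_hasDerivAt (0 : ℝ) h1
  have hs := (hasDerivAt_iff_tendsto_slope.1 hl).eventually (lt_mem_nhds hv)
  have hs' : ∀ᶠ t : ℝ in 𝓝[>] 0, 0 < slope (fun t : ℝ => ρ (x + t • v)) 0 t :=
    hs.filter_mono (nhdsWithin_mono _ fun (t : ℝ) (ht : 0 < t) => ht.ne')
  filter_upwards [hs', self_mem_nhdsWithin] with t ht htpos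
  rw [slope_def_field] at ht
  simp only [zero_smul, add_zero, h0, sub_zero] at ht
  exact (div_pos_iff_of_pos_right htpos).1 ht

theorem Defines.eventually_notMem {d : ℕ} {X : Set (Eucl d)} {ρ : Eucl d → ℝ} {x v : Eucl d}
    (h : Defines X ρ x) (h0 : ρ x = 0) (hv : 0 < fderiv ℝ ρ x v) :
    ∀ᶠ t : ℝ in 𝓝[>] 0, x + t • v ∉ X := by
  filter_upwards [h.eventually_slope h0 hv, (tendsto_add_smul x v).eventually h.2.2] with t h1 h2
  rw [h2]; exact not_lt.2 h1.le

theorem Defines.eventually_mem {d : ℕ} {X : Set (Eucl d)} {ρ : Eucl d → ℝ} {x v : Eucl d}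
    (h : Defines X ρ x) (h0 : ρ x = 0) (hv : fderiv ℝ ρ x v < 0) :
    ∀ᶠ t : ℝ in 𝓝[>] 0, x + t • v ∈ X := by
  have hl : HasDerivAt (fun t : ℝ => ρ (x + t • v)) (fderiv ℝ ρ x v) 0 := by
    have h1 : HasDerivAt (fun t : ℝ => x + t • v) v 0 := by
      simpa using ((hasDerivAt_id (0 : ℝ)).smul_const v).const_add x
    have h2 : HasFDerivAt ρ (fderiv ℝ ρ x) (x + (0 : ℝ) • v) := by
      simpa using h.hasFDerivAt x
    exact h2.comp_hasDerivAt (0 : ℝ) h1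
  have hs := (hasDerivAt_iff_tendsto_slope.1 hl).eventually (gt_mem_nhds hv)
  have hs' : ∀ᶠ t : ℝ in 𝓝[>] 0, slope (fun t : ℝ => ρ (x + t • v)) 0 t < 0 :=
    hs.filter_mono (nhdsWithin_mono _ fun (t : ℝ) (ht : 0 < t) => ht.ne')
  filter_upwards [hs', self_mem_nhdsWithin, (tendsto_add_smul x v).eventually h.2.2]
    with t ht htpos h2
  rw [slope_def_field] at ht
  simp only [zero_smul, add_zero, h0, sub_zero] at ht
  rw [h2]
  exact neg_of_div_neg_left ht (le_of_lt htpos)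

theorem Defines.exists_neg {d : ℕ} {X : Set (Eucl d)} {ρ : Eucl d → ℝ} {x : Eucl d}
    (h : Defines X ρ x) : ∃ v, fderiv ℝ ρ x v < 0 := by
  by_contra! hc
  apply h.2.1
  ext v
  have h1 := hc v
  have h2 := hc (-v)
  rw [map_neg] at h2
  simpa using le_antisymm (by linarith) h1

theorem Defines.mem_frontier {d : ℕ} {X : Set (Eucl d)} {ρ : Eucl d → ℝ} {x : Eucl d}
    (hX : IsOpen X) (h : Defines X ρ x) (h0 : ρ x = 0) : x ∈ frontier X := by
  rw [hX.frontier_eq]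
  refine ⟨?_, fun hx => ?_⟩
  · obtain ⟨v, hv⟩ := h.exists_neg
    exact mem_closure_of_tendsto (tendsto_add_smul x v) (h.eventually_mem h0 hv)
  · exact absurd h0 (h.2.2.self_of_nhds.1 hx).ne

/-- At a frontier point every direction with dρ < 0 enters `X`, hence belongs to the tangent cone.
These directions form a nonempty open set, which spans the whole space. -/
theorem uniqueDiffOn_closure {d : ℕ} {X : Set (Eucl d)} (hX : IsOpen X)
    (hs : HasSmoothBoundary X) : UniqueDiffOn ℝ (closure X) := by
  intro x hx
  rw [uniqueDiffWithinAt_closure]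
  by_cases hxX : x ∈ X
  · exact hX.uniqueDiffWithinAt hxX
  · have hfr : x ∈ frontier X := by rw [hX.frontier_eq]; exact ⟨hx, hxX⟩
    obtain ⟨ρ, h⟩ := hs.exists_defines hfr
    have h0 := h.eq_zero hX hfr
    refine ⟨?_, hx⟩
    have hsub : {v | fderiv ℝ ρ x v < 0} ⊆
        (Submodule.span ℝ (tangentConeAt ℝ X x) : Set (Eucl d)) := by
      intro v hv
      apply Submodule.subset_span
      refine mem_tangentConeAt_of_add_smul_mem (l := 𝓝[>] (0 : ℝ)) (c := fun t => t) ?_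
        (h.eventually_mem h0 hv)
      exact tendsto_nhdsWithin_of_tendsto_nhds_of_eventually_within _
        (Filter.tendsto_id.mono_left nhdsWithin_le_nhds)
        (Filter.mem_of_superset self_mem_nhdsWithin fun t ht => (ne_of_gt ht : t ≠ 0))
    have hopen : IsOpen {v | fderiv ℝ ρ x v < 0} :=
      isOpen_lt (fderiv ℝ ρ x).continuous continuous_const
    have htop : Submodule.span ℝ (tangentConeAt ℝ X x) = ⊤ := by
      apply Submodule.eq_top_of_nonempty_interior'
      obtain ⟨v, hv⟩ := h.exists_neg
      exact ⟨v, interior_maximal hsub hopen hv⟩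
    rw [htop]
    simp

/-! ### Graph charts of the boundary -/

/-- The linear map inserting a coordinate at the place `r`. -/
def ins {q : ℕ} (r : Fin (q + 1)) : ((Fin q → ℝ) × ℝ) →L[ℝ] Eucl (q + 1) :=
  LinearMap.toContinuousLinearMap
    { toFun := fun p => WithLp.toLp 2 (r.insertNth p.2 p.1 : Fin (q + 1) → ℝ)
      map_add' := fun p p' => by
        ext i
        refine Fin.succAboveCases r ?_ (fun i => ?_) i <;> simp
      map_smul' := fun c p => by
        ext i
        refine Fin.succAboveCases r ?_ (fun i => ?_) i <;> simp }

/-- The linear map removing the coordinate `r`. -/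
def rem {q : ℕ} (r : Fin (q + 1)) : Eucl (q + 1) →L[ℝ] (Fin q → ℝ) :=
  ContinuousLinearMap.pi fun s => EuclideanSpace.proj (r.succAbove s)

@[simp] theorem rem_apply {q : ℕ} (r : Fin (q + 1)) (x : Eucl (q + 1)) (s : Fin q) :
    rem r x s = x (r.succAbove s) := rfl

@[simp] theorem ins_apply_self {q : ℕ} (r : Fin (q + 1)) (p : (Fin q → ℝ) × ℝ) :
    ins r p r = p.2 := by
  simp [ins]

@[simp] theorem ins_apply_succAbove {q : ℕ} (r : Fin (q + 1)) (p : (Fin q → ℝ) × ℝ) (s : Fin q) :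
    ins r p (r.succAbove s) = p.1 s := by
  simp [ins]

@[simp] theorem rem_ins {q : ℕ} (r : Fin (q + 1)) (p : (Fin q → ℝ) × ℝ) : rem r (ins r p) = p.1 := by
  ext s; simp

@[simp] theorem ins_rem {q : ℕ} (r : Fin (q + 1)) (x : Eucl (q + 1)) : ins r (rem r x, x r) = x := by
  ext i
  refine Fin.succAboveCases r ?_ (fun i => ?_) i <;> simp

theorem ins_zero_one {q : ℕ} (r : Fin (q + 1)) : ins r (0, 1) = stdVec r := by
  ext i
  refine Fin.succAboveCases r ?_ (fun i => ?_) i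
  · simp [stdVec]
  · simp [stdVec]

/-- A description of `X` near `p` as one side of the graph of a function `g` of all but the
`r`-th coordinate. -/
structure GraphChart {q : ℕ} (X : Set (Eucl (q + 1))) (p : Eucl (q + 1)) where
  ρ : Eucl (q + 1) → ℝ
  r : Fin (q + 1)
  σ : ℝ
  g : (Fin q → ℝ) → ℝ
  lo : Fin q → ℝ
  hi : Fin q → ℝ
  h : ℝ
  abs_σ : |σ| = 1
  h_pos : 0 < h
  base_lo : ∀ s, lo s < rem r p s
  base_hi : ∀ s, rem r p s < hi s
  base : p r = g (rem r p)
  g_smooth : ∀ x ∈ Set.Icc lo hi, ContDiffAt ℝ 2 g x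
  graph : ∀ x ∈ Set.Icc lo hi, ρ (ins r (x, g x)) = 0
  defines : ∀ x, rem r x ∈ Set.Icc lo hi → |x r - g (rem r x)| ≤ h → Defines X ρ x
  slope : ∀ x, rem r x ∈ Set.Icc lo hi → |x r - g (rem r x)| ≤ h → 0 < σ * fderiv ℝ ρ x (stdVec r)
  mem_iff : ∀ x, rem r x ∈ Set.Icc lo hi → |x r - g (rem r x)| ≤ h →
    (x ∈ X ↔ σ * (x r - g (rem r x)) < 0)

/-- Some partial derivative of ρ is nonzero at `p`, and the implicit function theorem solves ρ = 0
for that coordinate. With σ the sign of this derivative, σρ increases along vertical lines and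
vanishes on the graph, so membership in `X` can be read off from the height over the graph. -/
theorem Defines.exists_graphChart {q : ℕ} {X : Set (Eucl (q + 1))} {p : Eucl (q + 1)}
    {ρ : Eucl (q + 1) → ℝ} (hρ : Defines X ρ p) (h0 : ρ p = 0) :
    ∃ G : GraphChart X p, G.ρ = ρ := by
  obtain ⟨r, hr⟩ : ∃ r, fderiv ℝ ρ p (stdVec r) ≠ 0 := by
    by_contra! hc
    apply hρ.2.1
    apply ContinuousLinearMap.coe_injective
    apply (EuclideanSpace.basisFun (Fin (q + 1)) ℝ).toBasis.ext
    intro r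
    simpa [stdVec] using hc r
  obtain ⟨σ, hσ, hσr⟩ : ∃ σ : ℝ, |σ| = 1 ∧ 0 < σ * fderiv ℝ ρ p (stdVec r) := by
    rcases lt_or_gt_of_ne hr with h | h
    · exact ⟨-1, by simp, by linarith⟩
    · exact ⟨1, by simp, by linarith⟩
  let f : (Fin q → ℝ) × ℝ → ℝ := fun z => ρ (ins r z)
  let u : (Fin q → ℝ) × ℝ := (rem r p, p r)
  have hu : ins r u = p := ins_rem r p
  -- Second order regularity is needed for `g`: the straightened field contains the derivative of
  -- `g` and is itself differentiated.
  have hf : ContDiffAt ℝ 2 f u :=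
    ((contDiff_infty.1 hρ.1 2).comp (ins r).contDiff).contDiffAt
  have hf' : fderiv ℝ f u = (fderiv ℝ ρ p).comp (ins r) := by
    have := (hρ.hasFDerivAt (ins r u)).comp u (ins r).hasFDerivAt
    rw [hu] at this
    exact this.fderiv
  have hinv : (fderiv ℝ f u ∘L .inr ℝ (Fin q → ℝ) ℝ).IsInvertible := by
    refine ⟨ContinuousLinearEquiv.unitsEquivAut ℝ (Units.mk0 _ hr), ?_⟩
    ext
    simp [hf', ins_zero_one]
  let g := hf.implicitFunction (by simp) hinv
  have hg : g (rem r p) = p r := hf.implicitFunction_apply_self (by simp) hinv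
  have hgs : ContDiffAt ℝ 2 g (rem r p) := hf.contDiffAt_implicitFunction (by simp) hinv
  have hg0 : ∀ᶠ x in 𝓝 (rem r p), ρ (ins r (x, g x)) = 0 := by
    filter_upwards [hf.eventually_apply_implicitFunction (by simp) hinv] with x hx
    have : f u = 0 := by simp only [f]; rw [hu, h0]
    rw [this] at hx; exact hx
  have hcd : Continuous (fderiv ℝ ρ) := hρ.1.continuous_fderiv (by simp)
  have hslope : ∀ᶠ x in 𝓝 p, 0 < σ * fderiv ℝ ρ x (stdVec r) := by
    have : Continuous fun x => σ * fderiv ℝ ρ x (stdVec r) := by fun_prop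
    exact this.continuousAt.eventually (lt_mem_nhds hσr)
  obtain ⟨ε, hε, hN⟩ := Metric.eventually_nhds_iff_ball.1 (hρ.eventually.and hslope)
  have hK : ContinuousAt (fun z : (Fin q → ℝ) × ℝ => ins r (z.1, g z.1 + z.2)) (rem r p, 0) := by
    apply (ins r).continuous.continuousAt.comp
    refine continuousAt_fst.prodMk (ContinuousAt.add ?_ continuousAt_snd)
    exact ContinuousAt.comp (f := fun z : (Fin q → ℝ) × ℝ => z.1) hgs.continuousAt continuousAt_fst
  have hK0 : ins r (rem r p, g (rem r p) + 0) = p := by rw [hg, add_zero, ins_rem]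
  have hev1 : ∀ᶠ z : (Fin q → ℝ) × ℝ in 𝓝 (rem r p, 0),
      ins r (z.1, g z.1 + z.2) ∈ Metric.ball p ε := by
    apply hK.eventually
    apply Metric.isOpen_ball.mem_nhds
    simp only [hK0]
    exact Metric.mem_ball_self hε
  have hev2 : ∀ᶠ z : (Fin q → ℝ) × ℝ in 𝓝 (rem r p, 0),
      ContDiffAt ℝ 2 g z.1 ∧ ρ (ins r (z.1, g z.1)) = 0 :=
    (continuousAt_fst (p := ((rem r p, 0) : (Fin q → ℝ) × ℝ))).eventually
      ((hgs.eventually (by simp)).and hg0)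
  -- Points at height `t` over the graph stay in the ball of radius ε if `(x, t)` is within δ of the
  -- centre. The closed box uses `δ / 2` as half-width and as height so that it fits into this open
  -- ball of the maximum metric.
  obtain ⟨δ, hδ, hB⟩ := Metric.eventually_nhds_iff_ball.1 (hev1.and hev2)
  have hball : ∀ x ∈ Set.Icc (fun s => rem r p s - δ / 2) (fun s => rem r p s + δ / 2), ∀ t : ℝ,
      |t| ≤ δ / 2 → (x, t) ∈ Metric.ball ((rem r p, 0) : (Fin q → ℝ) × ℝ) δ := by
    intro x hx t ht
    rw [Metric.mem_ball, Prod.dist_eq]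
    apply max_lt
    · refine lt_of_le_of_lt ((dist_pi_le_iff (by positivity : 0 ≤ δ / 2)).2 fun s => ?_)
        (half_lt_self hδ)
      have h1 := hx.1 s
      have h2 := hx.2 s
      simp only at h1 h2
      rw [Real.dist_eq, abs_le]
      constructor <;> linarith
    · simp only [Real.dist_eq, sub_zero]
      linarith
  have hin : ∀ x, rem r x ∈ Set.Icc (fun s => rem r p s - δ / 2) (fun s => rem r p s + δ / 2) →
      |x r - g (rem r x)| ≤ δ / 2 → x ∈ Metric.ball p ε ∧
        ins r (rem r x, g (rem r x)) ∈ Metric.ball p ε ∧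
        ρ (ins r (rem r x, g (rem r x))) = 0 := by
    intro x hx ht
    have h1 := (hB _ (hball _ hx _ ht)).1
    have h2 := hB _ (hball _ hx 0 (by rw [abs_zero]; positivity))
    simp only [add_sub_cancel, ins_rem, add_zero] at h1 h2
    exact ⟨h1, h2.1, h2.2.2⟩
  refine ⟨{ ρ := ρ, r := r, σ := σ, g := g, lo := fun s => rem r p s - δ / 2,
            hi := fun s => rem r p s + δ / 2, h := δ / 2, abs_σ := hσ, h_pos := by positivity,
            base_lo := fun s => by linarith, base_hi := fun s => by linarith,
            base := hg.symm,
            g_smooth := fun x hx => (hB _ (hball x hx 0 (by rw [abs_zero]; positivity))).2.1,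
            graph := fun x hx => (hB _ (hball x hx 0 (by rw [abs_zero]; positivity))).2.2,
            defines := fun x hx ht => (hN _ (hin x hx ht).1).1
            slope := fun x hx ht => (hN _ (hin x hx ht).1).2
            mem_iff := ?_ }, rfl⟩
  intro x hx ht
  obtain ⟨h1, h2, h3⟩ := hin x hx ht
  rw [(hN _ h1).1.2.2.self_of_nhds]
  -- The heights over the base point of `x` that stay in the ball form a convex set, on which σρ is
  -- strictly monotone. It contains `x r` and the height of the graph, so the two can be compared
  -- through ρ.
  let D : Set ℝ := {y | ins r (rem r x, y) ∈ Metric.ball p ε}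
  have hDc : Convex ℝ D := by
    intro y hy z hz a b ha hb hab
    have hcv := (convex_ball p ε) hy hz ha hb hab
    have e : a • ins r (rem r x, y) + b • ins r (rem r x, z) =
        ins r (rem r x, a • y + b • z) := by
      rw [← map_smul, ← map_smul, ← map_add, Prod.smul_mk, Prod.smul_mk, Prod.mk_add_mk,
        ← add_smul, hab, one_smul]
    rw [e] at hcv
    exact hcv
  have hder : ∀ y, HasDerivAt (fun y => σ * ρ (ins r (rem r x, y)))
      (σ * fderiv ℝ ρ (ins r (rem r x, y)) (stdVec r)) y := by
    intro y
    have e1 : HasDerivAt (fun y : ℝ => (rem r x, y)) ((0 : Fin q → ℝ), (1 : ℝ)) y :=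
      (hasDerivAt_const y _).prodMk (hasDerivAt_id y)
    have e2 := (hρ.hasFDerivAt _).comp_hasDerivAt y ((ins r).hasFDerivAt.comp_hasDerivAt y e1)
    rw [ins_zero_one] at e2
    exact e2.const_mul σ
  have hmono : StrictMonoOn (fun y => σ * ρ (ins r (rem r x, y))) D := by
    apply strictMonoOn_of_deriv_pos hDc
    · exact fun y _ => (hder y).continuousAt.continuousWithinAt
    · intro y hy
      rw [(hder y).deriv]
      have hyD : y ∈ D := interior_subset hy
      exact (hN _ hyD).2
  have hxD : x r ∈ D := by
    simp only [D, Set.mem_ofPred_eq, ins_rem]; exact h1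
  have hgD : g (rem r x) ∈ D := h2
  have e1 := hmono.lt_iff_lt hxD hgD
  have e2 := hmono.lt_iff_lt hgD hxD
  simp only [ins_rem, h3, mul_zero] at e1 e2
  rcases eq_or_eq_neg_of_abs_eq hσ with h | h
  · rw [h] at e1 ⊢
    rw [one_mul] at e1 ⊢
    rw [e1, sub_neg]
  · rw [h] at e2 ⊢
    rw [neg_one_mul, neg_pos] at e2
    rw [e2, neg_one_mul, neg_lt_zero, sub_pos]

namespace GraphChart

variable {q : ℕ} {X : Set (Eucl (q + 1))} {p : Eucl (q + 1)} (G : GraphChart X p)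

/-- The point of the graph over `x`. -/
def pt (x : Fin q → ℝ) : Eucl (q + 1) := ins G.r (x, G.g x)

theorem rem_pt (x : Fin q → ℝ) : rem G.r (G.pt x) = x := by simp [pt]

theorem pt_r (x : Fin q → ℝ) : G.pt x G.r = G.g x := by simp [pt]

theorem defines_pt {x : Fin q → ℝ} (hx : x ∈ Set.Icc G.lo G.hi) : Defines X G.ρ (G.pt x) := by
  apply G.defines
  · rwa [rem_pt]
  · rw [rem_pt, pt_r, sub_self, abs_zero]; exact G.h_pos.le

theorem slope_pt {x : Fin q → ℝ} (hx : x ∈ Set.Icc G.lo G.hi) :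
    0 < G.σ * fderiv ℝ G.ρ (G.pt x) (stdVec G.r) := by
  apply G.slope
  · rwa [rem_pt]
  · rw [rem_pt, pt_r, sub_self, abs_zero]; exact G.h_pos.le

theorem pt_mem_frontier (hX : IsOpen X) {x : Fin q → ℝ} (hx : x ∈ Set.Icc G.lo G.hi) :
    G.pt x ∈ frontier X :=
  (G.defines_pt hx).mem_frontier hX (G.graph x hx)

theorem base_mem : rem G.r p ∈ Set.Icc G.lo G.hi :=
  ⟨fun s => (G.base_lo s).le, fun s => (G.base_hi s).le⟩

theorem pt_base : G.pt (rem G.r p) = p := by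
  rw [pt, ← G.base, ins_rem]

theorem hasFDerivAt_pt {x : Fin q → ℝ} (hx : x ∈ Set.Icc G.lo G.hi) :
    HasFDerivAt G.pt ((ins G.r).comp ((ContinuousLinearMap.id ℝ _).prod (fderiv ℝ G.g x))) x := by
  have h1 := ((G.g_smooth x hx).differentiableAt (by simp)).hasFDerivAt
  exact (ins G.r).hasFDerivAt.comp x ((hasFDerivAt_id x).prodMk h1)

/-- The graph has the tangent space `ker dρ`. -/
theorem fderiv_ρ_pt {x : Fin q → ℝ} (hx : x ∈ Set.pi Set.univ fun s => Set.Ioo (G.lo s) (G.hi s))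
    (v : Fin q → ℝ) : fderiv ℝ G.ρ (G.pt x) (ins G.r (v, fderiv ℝ G.g x v)) = 0 := by
  have hx' : x ∈ Set.Icc G.lo G.hi :=
    ⟨fun s => (hx s trivial).1.le, fun s => (hx s trivial).2.le⟩
  have h1 := ((G.defines_pt hx').hasFDerivAt (G.pt x)).comp x (G.hasFDerivAt_pt hx')
  have h2 : (G.ρ ∘ G.pt) =ᶠ[𝓝 x] fun _ => 0 := by
    have : (Set.pi Set.univ fun s => Set.Ioo (G.lo s) (G.hi s)) ∈ 𝓝 x :=
      (isOpen_set_pi Set.finite_univ fun s _ => isOpen_Ioo).mem_nhds hx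
    filter_upwards [this] with y hy
    exact G.graph y ⟨fun s => (hy s trivial).1.le, fun s => (hy s trivial).2.le⟩
  have h3 := (h1.congr_of_eventuallyEq h2.symm).unique (hasFDerivAt_const (0 : ℝ) x)
  exact DFunLike.congr_fun h3 v

/-- A vector in `ker dρ` is determined by its coordinates in the graph chart. -/
theorem eq_of_ker {x : Fin q → ℝ} (hx : x ∈ Set.pi Set.univ fun s => Set.Ioo (G.lo s) (G.hi s))
    {v : Eucl (q + 1)} (hv : fderiv ℝ G.ρ (G.pt x) v = 0) :
    v = ins G.r (rem G.r v, fderiv ℝ G.g x (rem G.r v)) := by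
  have hx' : x ∈ Set.Icc G.lo G.hi :=
    ⟨fun s => (hx s trivial).1.le, fun s => (hx s trivial).2.le⟩
  have h1 := G.fderiv_ρ_pt hx (rem G.r v)
  have h2 : v = ins G.r (rem G.r v, fderiv ℝ G.g x (rem G.r v)) +
      (v G.r - fderiv ℝ G.g x (rem G.r v)) • stdVec G.r := by
    rw [← ins_zero_one, ← map_smul, ← map_add]
    conv_lhs => rw [← ins_rem G.r v]
    simp
  have h3 : (v G.r - fderiv ℝ G.g x (rem G.r v)) * fderiv ℝ G.ρ (G.pt x) (stdVec G.r) = 0 := by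
    rw [h2, map_add, h1, zero_add, map_smul] at hv
    exact hv
  have h4 : fderiv ℝ G.ρ (G.pt x) (stdVec G.r) ≠ 0 := by
    intro h
    have := G.slope_pt hx'
    rw [h, mul_zero] at this
    exact lt_irrefl _ this
  rw [(mul_eq_zero_iff_right h4).1 h3, zero_smul, add_zero] at h2
  exact h2

end GraphChart

/-- The kernel of the differential of a defining function is tangent to the boundary. -/
theorem Defines.mem_tangentConeAt {q : ℕ} {X : Set (Eucl (q + 1))} (hX : IsOpen X)
    {p : Eucl (q + 1)} {ρ : Eucl (q + 1) → ℝ} (hρ : Defines X ρ p) (h0 : ρ p = 0)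
    {v : Eucl (q + 1)} (hv : fderiv ℝ ρ p v = 0) : v ∈ tangentConeAt ℝ (frontier X) p := by
  obtain ⟨G, rfl⟩ := hρ.exists_graphChart h0
  have hb : rem G.r p ∈ Set.pi Set.univ fun s => Set.Ioo (G.lo s) (G.hi s) :=
    fun s _ => ⟨G.base_lo s, G.base_hi s⟩
  have hv' : fderiv ℝ G.ρ (G.pt (rem G.r p)) v = 0 := by rw [G.pt_base]; exact hv
  have h1 := G.eq_of_ker hb hv'
  have h2 := (G.hasFDerivAt_pt G.base_mem).hasFDerivWithinAt
    (s := Set.pi Set.univ fun s => Set.Ioo (G.lo s) (G.hi s))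
  -- The graph map sends an open set, whose tangent cone is everything, into the frontier; so the
  -- range of its derivative is tangent to the frontier.
  have h3 := HasFDerivWithinAt.mapsTo_tangent_cone h2
  have hopen : IsOpen (Set.pi Set.univ fun s => Set.Ioo (G.lo s) (G.hi s)) :=
    isOpen_set_pi Set.finite_univ fun s _ => isOpen_Ioo
  rw [tangentConeAt_of_mem_nhds (hopen.mem_nhds hb), G.pt_base] at h3
  have h4 := h3 (Set.mem_univ (rem G.r v))
  have h5 : (ins G.r).comp ((ContinuousLinearMap.id ℝ _).prod (fderiv ℝ G.g (rem G.r p)))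
      (rem G.r v) = v := by
    conv_rhs => rw [h1]
    rfl
  rw [h5] at h4
  refine tangentConeAt_mono ?_ h4
  rintro _ ⟨x, hx, rfl⟩
  exact G.pt_mem_frontier hX ⟨fun s => (hx s trivial).1.le, fun s => (hx s trivial).2.le⟩

namespace GraphChart

variable {q : ℕ} {X : Set (Eucl (q + 1))} {p : Eucl (q + 1)} (G : GraphChart X p)

/-! ### The divergence theorem in a graph chart -/

/-- The open domain of the function `g`. -/
def base' : Set (Fin q → ℝ) := Set.pi Set.univ fun s => Set.Ioo (G.lo s) (G.hi s)

theorem isOpen_base' : IsOpen G.base' := isOpen_set_pi Set.finite_univ fun _ _ => isOpen_Ioo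

theorem base'_subset : G.base' ⊆ Set.Icc G.lo G.hi :=
  fun _ hx => ⟨fun s => (hx s trivial).1.le, fun s => (hx s trivial).2.le⟩

/-- The open neighbourhood of `p` in which the chart describes `X`. -/
def tube : Set (Eucl (q + 1)) := {x | rem G.r x ∈ G.base' ∧ |x G.r - G.g (rem G.r x)| < G.h}

theorem continuousAt_g {x : Fin q → ℝ} (hx : x ∈ Set.Icc G.lo G.hi) : ContinuousAt G.g x :=
  (G.g_smooth x hx).continuousAt

theorem isOpen_tube : IsOpen G.tube := by
  rw [isOpen_iff_mem_nhds]
  rintro x ⟨h1, h2⟩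
  have e1 : ∀ᶠ y in 𝓝 x, rem G.r y ∈ G.base' :=
    (rem G.r).continuous.continuousAt.eventually (G.isOpen_base'.mem_nhds h1)
  have e2 : ContinuousAt (fun y : Eucl (q + 1) => |y G.r - G.g (rem G.r y)|) x := by
    refine ContinuousAt.abs (ContinuousAt.sub ?_ ?_)
    · exact (EuclideanSpace.proj (𝕜 := ℝ) G.r).continuous.continuousAt
    · exact ContinuousAt.comp (f := rem G.r) (G.continuousAt_g (G.base'_subset h1))
        (rem G.r).continuous.continuousAt
  filter_upwards [e1, e2.eventually (gt_mem_nhds h2)] with y h3 h4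
  exact ⟨h3, h4⟩

theorem mem_tube : p ∈ G.tube := by
  refine ⟨fun s _ => ⟨G.base_lo s, G.base_hi s⟩, ?_⟩
  rw [← G.base, sub_self, abs_zero]
  exact G.h_pos

theorem σ_mul_self : G.σ * G.σ = 1 := by
  rw [← abs_mul_abs_self, G.abs_σ, one_mul]

/-- The map straightening the boundary. -/
def shear (x : Eucl (q + 1)) : Eucl (q + 1) :=
  ins G.r (rem G.r x, G.g (rem G.r x) + G.σ * x G.r)

/-- The derivative of `shear`. -/
def shearDeriv (x : Eucl (q + 1)) : Eucl (q + 1) →L[ℝ] Eucl (q + 1) :=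
  (ins G.r).comp ((rem G.r).prod ((fderiv ℝ G.g (rem G.r x)).comp (rem G.r) +
    G.σ • EuclideanSpace.proj G.r))

theorem rem_shear (x : Eucl (q + 1)) : rem G.r (G.shear x) = rem G.r x := by simp [shear]

theorem shear_r (x : Eucl (q + 1)) : G.shear x G.r = G.g (rem G.r x) + G.σ * x G.r := by
  simp [shear]

theorem shearDeriv_apply (x v : Eucl (q + 1)) : G.shearDeriv x v =
    ins G.r (rem G.r v, fderiv ℝ G.g (rem G.r x) (rem G.r v) + G.σ * v G.r) := rfl

theorem hasFDerivAt_shear {x : Eucl (q + 1)} (hx : rem G.r x ∈ Set.Icc G.lo G.hi) :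
    HasFDerivAt G.shear (G.shearDeriv x) x := by
  have h1 := ((G.g_smooth _ hx).differentiableAt (by simp)).hasFDerivAt
  have h2 : HasFDerivAt (fun x => G.g (rem G.r x)) _ x := h1.comp x (rem G.r).hasFDerivAt
  have h3 : HasFDerivAt (fun x : Eucl (q + 1) => G.σ * x G.r)
      (G.σ • EuclideanSpace.proj (𝕜 := ℝ) G.r) x :=
    (EuclideanSpace.proj (𝕜 := ℝ) G.r).hasFDerivAt.const_mul G.σ
  exact (ins G.r).hasFDerivAt.comp x ((rem G.r).hasFDerivAt.prodMk (h2.add h3))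

theorem rem_stdVec_self (r : Fin (q + 1)) : rem r (stdVec r) = 0 := by
  ext s; simp [stdVec]

theorem rem_single_self (r : Fin (q + 1)) : rem r (EuclideanSpace.single r 1) = 0 :=
  rem_stdVec_self r

/-- The column `r` of the derivative is σ times a standard vector, and deleting its row and column
leaves the identity. Hence the change of variables has Jacobian of absolute value one. -/
theorem det_shearDeriv (x : Eucl (q + 1)) : (G.shearDeriv x).det = G.σ := by
  rw [ContinuousLinearMap.det,
    ← LinearMap.det_toMatrix (EuclideanSpace.basisFun (Fin (q + 1)) ℝ).toBasis,
    Matrix.det_succ_column _ G.r, Finset.sum_eq_single G.r]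
  · have : (LinearMap.toMatrix (EuclideanSpace.basisFun (Fin (q + 1)) ℝ).toBasis
        (EuclideanSpace.basisFun (Fin (q + 1)) ℝ).toBasis (G.shearDeriv x).toLinearMap).submatrix
        G.r.succAbove G.r.succAbove = 1 := by
      ext i j
      simp [LinearMap.toMatrix_apply, shearDeriv_apply, Matrix.one_apply]
    rw [this, Matrix.det_one, ← two_mul, Even.neg_one_pow (even_two_mul _)]
    simp [LinearMap.toMatrix_apply, shearDeriv_apply, rem_single_self]
  · intro i _ hi
    obtain ⟨s, rfl⟩ := Fin.exists_succAbove_eq hi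
    simp [LinearMap.toMatrix_apply, shearDeriv_apply]
  · simp

/-- The box that is mapped to the part of the tube in `X`. -/
def box : Set (Eucl (q + 1)) := {x | rem G.r x ∈ G.base' ∧ x G.r ∈ Set.Ioo (-G.h) 0}

theorem abs_σ_mul (t : ℝ) : |G.σ * t| = |t| := by rw [abs_mul, G.abs_σ, one_mul]

theorem injective_shear : Function.Injective G.shear := by
  intro x y hxy
  have h1 : rem G.r x = rem G.r y := by rw [← rem_shear, hxy, rem_shear]
  have h2 := congrArg (fun z : Eucl (q + 1) => z G.r) hxy
  simp only [shear_r, h1, add_right_inj] at h2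
  have h3 : x G.r = y G.r := by
    have := congrArg (G.σ * ·) h2
    simpa [← mul_assoc, G.σ_mul_self] using this
  rw [← ins_rem G.r x, ← ins_rem G.r y, h1, h3]

/-- The inverse of `shear` takes `σ * (y r - g)` as its last coordinate; being negative is then the
same as lying in `X`, and being greater than `-h` keeps the point in the tube. -/
theorem image_box : G.shear '' G.box = G.tube ∩ X := by
  ext y
  constructor
  · rintro ⟨x, ⟨h1, h2⟩, rfl⟩
    have e : G.shear x G.r - G.g (rem G.r (G.shear x)) = G.σ * x G.r := by
      rw [rem_shear, shear_r]; ring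
    have e2 : |G.shear x G.r - G.g (rem G.r (G.shear x))| < G.h := by
      rw [e, G.abs_σ_mul, abs_lt]; exact ⟨h2.1, h2.2.trans G.h_pos⟩
    refine ⟨⟨by rwa [rem_shear], e2⟩, ?_⟩
    rw [G.mem_iff _ (by rw [rem_shear]; exact G.base'_subset h1) e2.le, e, ← mul_assoc,
      G.σ_mul_self, one_mul]
    exact h2.2
  · rintro ⟨⟨h1, h2⟩, h3⟩
    rw [G.mem_iff y (G.base'_subset h1) h2.le] at h3
    refine ⟨ins G.r (rem G.r y, G.σ * (y G.r - G.g (rem G.r y))), ⟨?_, ?_, ?_⟩, ?_⟩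
    · rw [rem_ins]; exact h1
    · rw [ins_apply_self]
      rw [← G.abs_σ_mul] at h2
      exact (abs_lt.1 h2).1
    · rw [ins_apply_self]; exact h3
    · rw [shear, rem_ins, ins_apply_self, ← mul_assoc, G.σ_mul_self, one_mul, add_sub_cancel,
        ins_rem]

theorem isOpen_box : IsOpen G.box := by
  have h2 : Continuous fun x : Eucl (q + 1) => x G.r :=
    (EuclideanSpace.proj (𝕜 := ℝ) G.r).continuous
  exact (G.isOpen_base'.preimage (rem G.r).continuous).inter (isOpen_Ioo.preimage h2)

theorem integral_shear (f : Eucl (q + 1) → ℝ) :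
    ∫ x in G.tube ∩ X, f x = ∫ x in G.box, f (G.shear x) := by
  rw [← G.image_box, integral_image_eq_integral_abs_det_fderiv_smul volume
    G.isOpen_box.measurableSet (f' := G.shearDeriv)
    (fun x hx => (G.hasFDerivAt_shear (G.base'_subset hx.1)).hasFDerivWithinAt)
    G.injective_shear.injOn]
  simp [G.det_shearDeriv, G.abs_σ]

theorem shear_mem_closure (hX : IsOpen X) {x : Eucl (q + 1)} (h1 : rem G.r x ∈ Set.Icc G.lo G.hi)
    (h2 : x G.r ∈ Set.Icc (-G.h) 0) : G.shear x ∈ closure X := by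
  rcases h2.2.lt_or_eq with h | h
  · apply subset_closure
    have e : G.shear x G.r - G.g (rem G.r (G.shear x)) = G.σ * x G.r := by
      rw [rem_shear, shear_r]; ring
    have e2 : |G.shear x G.r - G.g (rem G.r (G.shear x))| ≤ G.h := by
      rw [e, G.abs_σ_mul, abs_le]; exact ⟨h2.1, h2.2.trans G.h_pos.le⟩
    rw [G.mem_iff _ (by rw [rem_shear]; exact h1) e2, e, ← mul_assoc, G.σ_mul_self, one_mul]
    exact h
  · have : G.shear x = G.pt (rem G.r x) := by
      rw [shear, h, mul_zero, add_zero, pt]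
    rw [this]
    exact frontier_subset_closure (G.pt_mem_frontier hX h1)

/-- The vector field in the straightened coordinates. -/
def pulled (V : Eucl (q + 1) → Eucl (q + 1)) (x : Eucl (q + 1)) : Eucl (q + 1) :=
  ins G.r (rem G.r (V (G.shear x)), G.σ * (V (G.shear x) G.r -
    fderiv ℝ G.g (rem G.r x) (rem G.r (V (G.shear x)))))

/-- `pulled V` is the inverse of the derivative of `shear`, applied to `V ∘ shear`, and `shear` has
constant Jacobian determinant. The second derivatives of `g` drop out because the component `r` is
differentiated only in the direction `r`, along which `g` does not vary; the first-order terms in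
`g` cancel. -/
theorem divg_pulled {V : Eucl (q + 1) → Eucl (q + 1)} {x : Eucl (q + 1)}
    (hx : rem G.r x ∈ Set.Icc G.lo G.hi) (hV : DifferentiableAt ℝ V (G.shear x)) :
    DifferentiableAt ℝ (G.pulled V) x ∧ divg (G.pulled V) x = divg V (G.shear x) := by
  set L := (fderiv ℝ V (G.shear x)).comp (G.shearDeriv x) with hL
  have h1 : HasFDerivAt (fun x => V (G.shear x)) L x :=
    hV.hasFDerivAt.comp x (G.hasFDerivAt_shear hx)
  have h2 : HasFDerivAt (fun x => rem G.r (V (G.shear x))) ((rem G.r).comp L) x :=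
    (rem G.r).hasFDerivAt.comp x h1
  have h3 : HasFDerivAt (fun x => V (G.shear x) G.r) ((EuclideanSpace.proj G.r).comp L) x :=
    (EuclideanSpace.proj (𝕜 := ℝ) G.r).hasFDerivAt.comp x h1
  have hg : DifferentiableAt ℝ (fderiv ℝ G.g) (rem G.r x) :=
    ((G.g_smooth _ hx).fderiv_right (m := 1) (by norm_num)).differentiableAt (by simp)
  have h4 : HasFDerivAt (fun x => fderiv ℝ G.g (rem G.r x))
      ((fderiv ℝ (fderiv ℝ G.g) (rem G.r x)).comp (rem G.r)) x :=
    hg.hasFDerivAt.comp x (rem G.r).hasFDerivAt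
  have h5 := h4.clm_apply h2
  have h6 := (ins G.r).hasFDerivAt.comp x (h2.prodMk ((h3.sub h5).const_mul G.σ))
  have h7 : HasFDerivAt (G.pulled V) _ x := h6
  refine ⟨h7.differentiableAt, ?_⟩
  rw [divg, divg, h7.fderiv, Fin.sum_univ_succAbove _ G.r, Fin.sum_univ_succAbove _ G.r]
  have e0 : ∀ v, L v = fderiv ℝ V (G.shear x) (G.shearDeriv x v) := fun v => rfl
  set M := fderiv ℝ V (G.shear x) with hM
  have e1 : G.shearDeriv x (stdVec G.r) = G.σ • stdVec G.r := by
    rw [shearDeriv_apply, rem_stdVec_self, map_zero, zero_add, ← ins_zero_one, ← map_smul]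
    simp
  have e2 : ∀ s, rem G.r (stdVec (G.r.succAbove s)) = Pi.single s 1 := by
    intro s; ext t; simp [stdVec, Pi.single_apply]
  have e3 : ∀ s, G.shearDeriv x (stdVec (G.r.succAbove s)) = stdVec (G.r.succAbove s) +
      fderiv ℝ G.g (rem G.r x) (Pi.single s 1) • stdVec G.r := by
    intro s
    rw [shearDeriv_apply, e2]
    ext i
    refine Fin.succAboveCases G.r ?_ (fun i => ?_) i
    · simp [stdVec]
    · simp [stdVec, Pi.single_apply]
  have e4 : ∀ w : Fin q → ℝ, fderiv ℝ G.g (rem G.r x) w =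
      ∑ s, fderiv ℝ G.g (rem G.r x) (Pi.single s 1) * w s := by
    intro w
    conv_lhs => rw [← Finset.univ_sum_single w, map_sum]
    refine Finset.sum_congr rfl fun s _ => ?_
    rw [← mul_one (w s), ← smul_eq_mul (w s) (1 : ℝ), Pi.single_smul, map_smul]
    simp [mul_comm]
  have e5 : L (stdVec G.r) = G.σ • M (stdVec G.r) := by rw [e0, e1, map_smul]
  have e6 : ∀ s, L (stdVec (G.r.succAbove s)) = M (stdVec (G.r.succAbove s)) +
      fderiv ℝ G.g (rem G.r x) (Pi.single s 1) • M (stdVec G.r) := by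
    intro s; rw [e0, e3, map_add, map_smul]
  have e7 : ∀ v, ((ins G.r).comp (((rem G.r).comp L).prod (G.σ • ((EuclideanSpace.proj G.r).comp L -
      ((fderiv ℝ G.g (rem G.r x)).comp ((rem G.r).comp L) +
        ((fderiv ℝ (fderiv ℝ G.g) (rem G.r x)).comp (rem G.r)).flip
          (rem G.r (V (G.shear x)))))))) v =
      ins G.r (rem G.r (L v), G.σ * (L v G.r - (fderiv ℝ G.g (rem G.r x) (rem G.r (L v)) +
        fderiv ℝ (fderiv ℝ G.g) (rem G.r x) (rem G.r v) (rem G.r (V (G.shear x)))))) :=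
    fun v => rfl
  rw [e7, rem_stdVec_self, map_zero, ins_apply_self, zero_apply, add_zero, e4,
    e5]
  simp only [e7, ins_apply_succAbove, rem_apply, e6, PiLp.smul_apply, PiLp.add_apply, smul_eq_mul]
  rw [mul_sub, ← mul_assoc, G.σ_mul_self, one_mul, Finset.sum_add_distrib, Finset.mul_sum]
  have e8 : ∀ s, G.σ * (fderiv ℝ G.g (rem G.r x) (Pi.single s 1) *
      (G.σ * M (stdVec G.r) (G.r.succAbove s))) =
      fderiv ℝ G.g (rem G.r x) (Pi.single s 1) * M (stdVec G.r) (G.r.succAbove s) := by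
    intro s
    linear_combination (fderiv ℝ G.g (rem G.r x) (Pi.single s 1) *
      M (stdVec G.r) (G.r.succAbove s)) * G.σ_mul_self
  simp only [e8]
  ring

theorem pulled_eq_zero {V : Eucl (q + 1) → Eucl (q + 1)} {x : Eucl (q + 1)}
    (h : V (G.shear x) = 0) : G.pulled V x = 0 := by
  have : ((0 : Fin q → ℝ), (0 : ℝ)) = 0 := rfl
  simp [pulled, h, this]

/-- The vector `V` is a tangent vector of the graph plus a multiple of `stdVec r`, and dρ kills the
former. So the component normal to the straightened boundary is the quotient of dρ(V) by |∂_r ρ|. -/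
theorem pulled_r {V : Eucl (q + 1) → Eucl (q + 1)} {x : Fin q → ℝ} (hx : x ∈ G.base') :
    G.pulled V (ins G.r (x, 0)) G.r =
      fderiv ℝ G.ρ (G.pt x) (V (G.pt x)) / |fderiv ℝ G.ρ (G.pt x) (stdVec G.r)| := by
  have h1 : G.shear (ins G.r (x, 0)) = G.pt x := by simp [shear, pt]
  have h2 : G.pulled V (ins G.r (x, 0)) G.r = G.σ * (V (G.pt x) G.r -
      fderiv ℝ G.g x (rem G.r (V (G.pt x)))) := by
    rw [pulled, ins_apply_self, h1, rem_ins]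
  set v := V (G.pt x)
  have h3 := G.fderiv_ρ_pt hx (rem G.r v)
  have h4 : v = ins G.r (rem G.r v, fderiv ℝ G.g x (rem G.r v)) +
      (v G.r - fderiv ℝ G.g x (rem G.r v)) • stdVec G.r := by
    rw [← ins_zero_one, ← map_smul, ← map_add]
    conv_lhs => rw [← ins_rem G.r v]
    simp
  have h5 : fderiv ℝ G.ρ (G.pt x) v = (v G.r - fderiv ℝ G.g x (rem G.r v)) *
      fderiv ℝ G.ρ (G.pt x) (stdVec G.r) := by
    conv_lhs => rw [h4]
    rw [map_add, h3, zero_add, map_smul, smul_eq_mul]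
  have h6 := G.slope_pt (G.base'_subset hx)
  have h7 : |fderiv ℝ G.ρ (G.pt x) (stdVec G.r)| =
      G.σ * fderiv ℝ G.ρ (G.pt x) (stdVec G.r) := by
    rw [← G.abs_σ_mul, abs_of_pos h6]
  rw [h2, h7, h5, eq_div_iff h6.ne']
  linear_combination (v G.r - fderiv ℝ G.g x (rem G.r v)) *
      fderiv ℝ G.ρ (G.pt x) (stdVec G.r) * G.σ_mul_self

theorem setIntegral_divg_eq_tube (hX : IsOpen X) {V : Eucl (q + 1) → Eucl (q + 1)}
    {Z : Set (Eucl (q + 1))} (hZ : IsClosed Z) (hZt : Z ⊆ G.tube) (hVZ : ∀ x, x ∉ Z → V x = 0) :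
    ∫ x in X, divg V x = ∫ x in G.tube ∩ X, divg V x := by
  apply setIntegral_eq_of_subset_of_forall_sdiff_eq_zero hX.measurableSet Set.inter_subset_right
  rintro x ⟨hx, hxt⟩
  have hxZ : x ∉ Z := fun h => hxt ⟨hZt h, hx⟩
  have h1 : V =ᶠ[𝓝 x] fun _ => 0 := by
    filter_upwards [hZ.isOpen_compl.mem_nhds hxZ] with y hy
    exact hVZ y hy
  rw [divg, h1.fderiv_eq]
  simp

/-- The divergence theorem for vector fields supported in a graph chart. -/
theorem integral_divg (hX : IsOpen X) (hu : UniqueDiffOn ℝ (closure X))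
    {V : Eucl (q + 1) → Eucl (q + 1)} (hV : ContDiffOn ℝ 1 V (closure X))
    {Z : Set (Eucl (q + 1))} (hZ : IsClosed Z) (hZt : Z ⊆ G.tube) (hVZ : ∀ x, x ∉ Z → V x = 0) :
    ∫ x in X, divg V x = ∫ x in G.base', fderiv ℝ G.ρ (G.pt x) (V (G.pt x)) /
      |fderiv ℝ G.ρ (G.pt x) (stdVec G.r)| := by
  rw [G.setIntegral_divg_eq_tube hX hZ hZt hVZ, G.integral_shear]
  -- The corners of the straightened box: the base box with the interval from `-h` to 0 inserted at
  -- the place `r`. The face at 0 corresponds to the graph.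
  let a : Fin (q + 1) → ℝ := G.r.insertNth (-G.h) G.lo
  let b : Fin (q + 1) → ℝ := G.r.insertNth 0 G.hi
  have hmemIcc : ∀ z : Fin (q + 1) → ℝ, z ∈ Set.Icc a b →
      rem G.r (WithLp.toLp 2 z) ∈ Set.Icc G.lo G.hi ∧
      (WithLp.toLp 2 z : Eucl (q + 1)) G.r ∈ Set.Icc (-G.h) 0 := by
    intro z hz
    refine ⟨⟨fun s => ?_, fun s => ?_⟩, ?_, ?_⟩
    · simpa [a] using hz.1 (G.r.succAbove s)
    · simpa [b] using hz.2 (G.r.succAbove s)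
    · simpa [a] using hz.1 G.r
    · simpa [b] using hz.2 G.r
  have hmemIoo : ∀ z : Fin (q + 1) → ℝ, (z ∈ Set.pi Set.univ fun i => Set.Ioo (a i) (b i)) ↔
      WithLp.toLp 2 z ∈ G.box := by
    intro z
    constructor
    · intro hz
      refine ⟨fun s _ => ?_, ?_⟩
      · simpa [a, b] using hz (G.r.succAbove s) trivial
      · simpa [a, b] using hz G.r trivial
    · rintro ⟨h1, h2⟩ i -
      refine Fin.succAboveCases G.r ?_ (fun s => ?_) i
      · simpa [a, b] using h2
      · simpa [a, b] using h1 s trivial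
  have hab : a ≤ b := by
    intro i
    refine Fin.succAboveCases G.r ?_ (fun s => ?_) i
    · simpa [a, b] using G.h_pos.le
    · simpa [a, b] using ((G.base_lo s).trans (G.base_hi s)).le
  let e : Eucl (q + 1) ≃L[ℝ] (Fin (q + 1) → ℝ) := PiLp.continuousLinearEquiv 2 ℝ fun _ => ℝ
  let f : (Fin (q + 1) → ℝ) → Fin (q + 1) → ℝ := fun z => e (G.pulled V (e.symm z))
  let f' : (Fin (q + 1) → ℝ) → (Fin (q + 1) → ℝ) →L[ℝ] (Fin (q + 1) → ℝ) := fun z =>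
    (e : Eucl (q + 1) →L[ℝ] (Fin (q + 1) → ℝ)).comp ((fderiv ℝ (G.pulled V) (e.symm z)).comp
      (e.symm : (Fin (q + 1) → ℝ) →L[ℝ] Eucl (q + 1)))
  have hsum : ∀ z, ∑ i, f' z (Pi.single i 1) i = divg (G.pulled V) (e.symm z) := fun z => rfl
  have hdiff : ∀ x ∈ G.box, DifferentiableAt ℝ V (G.shear x) := by
    intro x hx
    have : G.shear x ∈ X := (G.image_box ▸ Set.mem_image_of_mem _ hx : G.shear x ∈ G.tube ∩ X).2
    exact (hV.differentiableOn (by simp)).differentiableAt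
      (Filter.mem_of_superset (hX.mem_nhds this) subset_closure)
  have hdivg : ∀ z ∈ Set.pi Set.univ fun i => Set.Ioo (a i) (b i),
      ∑ i, f' z (Pi.single i 1) i = divg V (G.shear (e.symm z)) := by
    intro z hz
    have hz' := (hmemIoo z).1 hz
    rw [hsum]
    exact (G.divg_pulled (G.base'_subset hz'.1) (hdiff _ hz')).2
  have hshear : ContinuousOn (fun z => G.shear (e.symm z)) (Set.Icc a b) := by
    intro z hz
    exact ((G.hasFDerivAt_shear (hmemIcc z hz).1).continuousAt.comp
      e.symm.continuous.continuousAt).continuousWithinAt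
  have hmaps : Set.MapsTo (fun z => G.shear (e.symm z)) (Set.Icc a b) (closure X) :=
    fun z hz => G.shear_mem_closure hX (hmemIcc z hz).1 (hmemIcc z hz).2
  -- Computed with the derivative within the closure, the divergence is continuous up to the
  -- boundary. This makes the integrand integrable, although `V` need not be differentiable at
  -- frontier points.
  let dv : Eucl (q + 1) → ℝ := fun y => ∑ r, fderivWithin ℝ V (closure X) y (stdVec r) r
  have hdv : ContinuousOn dv (closure X) := by
    have h1 := hV.continuousOn_fderivWithin hu le_rfl
    refine continuousOn_finsetSum _ fun r _ => ?_
    exact (EuclideanSpace.proj (𝕜 := ℝ) r).continuous.comp_continuousOn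
      (h1.clm_apply continuousOn_const)
  have hdvX : ∀ y ∈ X, dv y = divg V y := by
    intro y hy
    simp only [dv, divg, fderivWithin_of_mem_nhds
      (Filter.mem_of_superset (hX.mem_nhds hy) subset_closure)]
  have hae : (Set.pi Set.univ fun i => Set.Ioo (a i) (b i)) =ᵐ[volume] Set.Icc a b := by
    rw [volume_pi]; exact Measure.univ_pi_Ioo_ae_eq_Icc
  have hpiopen : MeasurableSet (Set.pi Set.univ fun i => Set.Ioo (a i) (b i)) :=
    (isOpen_set_pi Set.finite_univ fun i _ => isOpen_Ioo).measurableSet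
  have hHi : IntegrableOn (fun z => ∑ i, f' z (Pi.single i 1) i) (Set.Icc a b) := by
    refine IntegrableOn.congr_set_ae ?_ hae.symm
    have h1 : IntegrableOn (fun z => dv (G.shear (e.symm z))) (Set.Icc a b) :=
      (hdv.comp hshear hmaps).integrableOn_compact isCompact_Icc
    refine (h1.congr_set_ae hae).congr_fun ?_ hpiopen
    intro z hz
    have hz' := (hmemIoo z).1 hz
    change dv (G.shear (e.symm z)) = ∑ i, f' z (Pi.single i 1) i
    rw [hdivg z hz, hdvX]
    exact (G.image_box ▸ Set.mem_image_of_mem _ hz' : G.shear (e.symm z) ∈ G.tube ∩ X).2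
  have hHc : ContinuousOn f (Set.Icc a b) := by
    have h1 : ContinuousOn (fun z => V (G.shear (e.symm z))) (Set.Icc a b) :=
      hV.continuousOn.comp hshear hmaps
    have h2 : ContinuousOn (fun z => fderiv ℝ G.g (rem G.r (e.symm z))) (Set.Icc a b) := by
      intro z hz
      have : ContinuousAt (fderiv ℝ G.g) (rem G.r (e.symm z)) :=
        ((G.g_smooth _ (hmemIcc z hz).1).fderiv_right (m := 1) (by norm_num)).continuousAt
      exact (ContinuousAt.comp (f := fun z => rem G.r (e.symm z)) this
        ((rem G.r).continuous.comp e.symm.continuous).continuousAt).continuousWithinAt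
    have h3 := (rem G.r).continuous.comp_continuousOn h1
    have h4 := (EuclideanSpace.proj (𝕜 := ℝ) G.r).continuous.comp_continuousOn h1
    refine e.continuous.comp_continuousOn ((ins G.r).continuous.comp_continuousOn ?_)
    exact h3.prodMk (continuousOn_const.mul (h4.sub (h2.clm_apply h3)))
  have key := integral_divergence_of_hasFDerivAt_off_countable a b hab f f' ∅
    Set.countable_empty hHc (fun z hz => by
      have hz' := (hmemIoo z).1 hz.1
      have h1 := (G.divg_pulled (G.base'_subset hz'.1) (hdiff _ hz')).1.hasFDerivAt
      exact e.hasFDerivAt.comp z (HasFDerivAt.comp (f := e.symm) z h1 e.symm.hasFDerivAt)) hHi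
  have hlhs : ∫ x in G.box, divg V (G.shear x) =
      ∫ z in Set.Icc a b, ∑ i, f' z (Pi.single i 1) i := by
    rw [← setIntegral_congr_set hae, setIntegral_congr_fun hpiopen hdivg]
    have h1 := (PiLp.volume_preserving_toLp (Fin (q + 1))).setIntegral_preimage_emb
      (MeasurableEquiv.toLp 2 (Fin (q + 1) → ℝ)).measurableEmbedding
      (fun x => divg V (G.shear x)) G.box
    rw [← h1]
    have h2 : (WithLp.toLp 2 ⁻¹' G.box) = Set.pi Set.univ fun i => Set.Ioo (a i) (b i) := by
      ext z; exact (hmemIoo z).symm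
    rw [h2]
    rfl
  -- A point mapped outside the tube is mapped outside `Z`, where `V` vanishes. The lateral faces
  -- and the face at height `-h` are of this kind, so only the face on the graph contributes.
  have hzero : ∀ z : Fin (q + 1) → ℝ, G.shear (e.symm z) ∉ G.tube → f z = 0 := by
    intro z hz
    have : V (G.shear (e.symm z)) = 0 := hVZ _ fun h => hz (hZt h)
    simp only [f]
    rw [G.pulled_eq_zero this, map_zero]
  rw [hlhs, key, Finset.sum_eq_single G.r]
  · have hback : ∀ x, f (G.r.insertNth (a G.r) x) G.r = 0 := by
      intro x
      rw [hzero]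
      · rfl
      · rintro ⟨-, h⟩
        have e1 : (e.symm (G.r.insertNth (a G.r) x : Fin (q + 1) → ℝ)) G.r = -G.h := by
          change (G.r.insertNth (a G.r) x : Fin (q + 1) → ℝ) G.r = -G.h
          simp [a]
        rw [rem_shear, shear_r, add_sub_cancel_left, G.abs_σ_mul, e1, abs_neg,
          abs_of_pos G.h_pos] at h
        exact lt_irrefl _ h
    have hbase : (fun s => G.lo s) = a ∘ G.r.succAbove ∧ (fun s => G.hi s) = b ∘ G.r.succAbove := by
      constructor <;> funext s <;> simp [a, b]
    simp only [hback, integral_zero, sub_zero]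
    have hae' : G.base' =ᵐ[volume] Set.Icc (a ∘ G.r.succAbove) (b ∘ G.r.succAbove) := by
      rw [volume_pi, ← hbase.1, ← hbase.2]
      exact Measure.univ_pi_Ioo_ae_eq_Icc
    rw [← setIntegral_congr_set hae']
    refine setIntegral_congr_fun G.isOpen_base'.measurableSet fun x hx => ?_
    rw [← G.pulled_r hx]
    simp only [f, b, Fin.insertNth_apply_same]
    rfl
  · intro i _ hi
    obtain ⟨s, rfl⟩ := Fin.exists_succAbove_eq hi
    have hface : ∀ (c : ℝ) (x : Fin q → ℝ), c ∉ Set.Ioo (G.lo s) (G.hi s) →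
        f ((G.r.succAbove s).insertNth c x) (G.r.succAbove s) = 0 := by
      intro c x hc
      rw [hzero]
      · rfl
      · rintro ⟨h, -⟩
        rw [rem_shear] at h
        have h1 := h s trivial
        have e1 : rem G.r (e.symm ((G.r.succAbove s).insertNth c x : Fin (q + 1) → ℝ)) s = c := by
          change ((G.r.succAbove s).insertNth c x : Fin (q + 1) → ℝ) (G.r.succAbove s) = c
          simp
        rw [e1] at h1
        exact hc h1
    have hf1 : ∀ x, f ((G.r.succAbove s).insertNth (b (G.r.succAbove s)) x)
        (G.r.succAbove s) = 0 := fun x => hface _ x (by simp [b])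
    have hf2 : ∀ x, f ((G.r.succAbove s).insertNth (a (G.r.succAbove s)) x)
        (G.r.succAbove s) = 0 := fun x => hface _ x (by simp [a])
    simp only [hf1, hf2, integral_zero, sub_zero]
  · simp

end GraphChart

/-! ### Immersed pieces of the boundary -/

theorem bdet_smul_add {d q : ℕ} (h : d = q + 1) (c : ℝ) (V W : Eucl d) (v : Fin q → Eucl d) :
    bdet h (c • V + W) v = c * bdet h V v + bdet h W v := by
  subst h
  have e : ∀ V, bdet rfl V v = (detAlt q).curryLeft V v := fun V => bdet_eq V v
  simp only [e, map_add, map_smul]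
  rfl

theorem bdet_zero {d q : ℕ} (h : d = q + 1) (v : Fin q → Eucl d) : bdet h 0 v = 0 := by
  have := bdet_smul_add h 1 0 0 v
  rw [smul_zero, add_zero] at this
  linarith

theorem bdet_smul {d q : ℕ} (h : d = q + 1) (c : ℝ) (V : Eucl d) (v : Fin q → Eucl d) :
    bdet h (c • V) v = c * bdet h V v := by
  have := bdet_smul_add h c V 0 v
  rwa [add_zero, bdet_zero, add_zero] at this

theorem bdet_sum {d q : ℕ} (h : d = q + 1) {ι : Type*} (s : Finset ι) (V : ι → Eucl d)
    (v : Fin q → Eucl d) : bdet h (∑ i ∈ s, V i) v = ∑ i ∈ s, bdet h (V i) v := by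
  classical
  induction s using Finset.induction_on with
  | empty => simp [bdet_zero]
  | insert i s hi ih =>
    rw [Finset.sum_insert hi, Finset.sum_insert hi, ← ih]
    have := bdet_smul_add h 1 (V i) (∑ i ∈ s, V i) v
    rwa [one_smul, one_mul] at this

theorem bdet_self {d q : ℕ} (h : d = q + 1) (v : Fin q → Eucl d) (c : Fin q) :
    bdet h (v c) v = 0 := by
  subst h
  rw [bdet_eq]
  exact (detAlt q).map_eq_zero_of_eq _ (i := 0) (j := c.succ) rfl (Fin.succ_ne_zero c).symm

theorem eucl_eq_sum {d : ℕ} (w : Eucl d) : w = ∑ c, w c • stdVec c := by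
  conv_lhs => rw [← (EuclideanSpace.basisFun (Fin d) ℝ).sum_repr w]
  simp [stdVec]

theorem bdet_range {d q : ℕ} (h : d = q + 1) (T : Eucl q →L[ℝ] Eucl d) (w : Eucl q) :
    bdet h (T w) (fun c => T (stdVec c)) = 0 := by
  conv_lhs => rw [eucl_eq_sum w, map_sum]
  rw [bdet_sum]
  refine Finset.sum_eq_zero fun c _ => ?_
  rw [map_smul, bdet_smul, bdet_self h (fun c => T (stdVec c)) c, mul_zero]

/-- The minor is the Jacobian determinant of an immersed piece after projection along the coordinate
`r`; this links the determinant with the change of variables to the base of a graph chart. -/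
theorem abs_bdet_stdVec {q : ℕ} (r : Fin (q + 1)) (v : Fin q → Eucl (q + 1)) :
    |bdet rfl (stdVec r) v| = |Matrix.det (Matrix.of fun s c => v c (r.succAbove s))| := by
  rw [bdet, Matrix.det_succ_column_zero, Finset.sum_eq_single r]
  · have : ((Matrix.of fun r' c : Fin (q + 1) => (Fin.cons (stdVec r) v : Fin (q + 1) →
        Eucl (q + 1)) c (Fin.cast rfl r')).submatrix r.succAbove Fin.succ) =
        Matrix.of fun s c => v c (r.succAbove s) := by
      ext i j; rfl
    rw [this]
    simp [abs_mul, stdVec]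
  · intro i _ hi
    simp [stdVec, hi]
  · simp

/-- A linear functional vanishing on the range of an injective map from codimension one. -/
theorem ker_eq_range {q : ℕ} {T : Eucl q →L[ℝ] Eucl (q + 1)} (hT : Function.Injective T)
    {l : Eucl (q + 1) →L[ℝ] ℝ} (hl : l ≠ 0) (h : ∀ w, l (T w) = 0) {v : Eucl (q + 1)}
    (hv : l v = 0) : ∃ w, T w = v := by
  have h1 : LinearMap.range T.toLinearMap ≤ LinearMap.ker l.toLinearMap := by
    rintro _ ⟨w, rfl⟩; exact h w
  have h2 : Module.finrank ℝ (LinearMap.range T.toLinearMap) = q := by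
    rw [LinearMap.finrank_range_of_inj hT]; simp
  have hl' : l.toLinearMap ≠ 0 := fun hc => hl (by ext x; exact DFunLike.congr_fun hc x)
  have h3 : Module.finrank ℝ (LinearMap.ker l.toLinearMap) + 1 = q + 1 := by
    rw [Module.Dual.finrank_ker_add_one_of_ne_zero hl']; simp
  have h4 := Submodule.eq_of_le_of_finrank_eq h1 (by omega)
  have h5 : v ∈ LinearMap.ker l.toLinearMap := hv
  rw [← h4] at h5
  exact h5

/-- The function ρ vanishes on the frontier near the point, so its composition with φ is locally
zero, and the chain rule applies. -/
theorem Defines.fderiv_comp_eq_zero {d q : ℕ} {X : Set (Eucl d)} (hX : IsOpen X)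
    {φ : Eucl q → Eucl d} {x : Eucl q} {ρ : Eucl d → ℝ} (hρ : Defines X ρ (φ x))
    (hφ : DifferentiableAt ℝ φ x) (hm : ∀ᶠ y in 𝓝 x, φ y ∈ frontier X) (w : Eucl q) :
    fderiv ℝ ρ (φ x) (fderiv ℝ φ x w) = 0 := by
  have h1 := (hρ.hasFDerivAt (φ x)).comp x hφ.hasFDerivAt
  have h2 : (ρ ∘ φ) =ᶠ[𝓝 x] fun _ => 0 := by
    filter_upwards [hm, hφ.continuousAt.eventually hρ.eventually] with y hy hy'
    exact Defines.eq_zero (x := φ y) hX hy' hy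
  have h3 := (h1.congr_of_eventuallyEq h2.symm).unique (hasFDerivAt_const (0 : ℝ) x)
  exact DFunLike.congr_fun h3 w

/-- The boundary of `X`, up to a part `B`, as the disjoint union of injectively immersed pieces,
those of codimension one with a sign comparing the orientations. -/
structure BoundaryPieces {d : ℕ} (X B : Set (Eucl d)) where
  J : Type
  [fintypeJ : Fintype J]
  q : J → ℕ
  U : (j : J) → Set (Eucl (q j))
  φ : (j : J) → Eucl (q j) → Eucl d
  sgn : J → ℝ
  isOpen_U : ∀ j, IsOpen (U j)
  contDiffOn : ∀ j, ContDiffOn ℝ 1 (φ j) (U j)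
  injOn : ∀ j, Set.InjOn (φ j) (U j)
  immersion : ∀ j, ∀ x ∈ U j, Function.Injective (fderiv ℝ (φ j) x)
  mapsTo : ∀ j, ∀ x ∈ U j, φ j x ∈ frontier X
  disjoint : ∀ i j, i ≠ j → Disjoint (φ i '' U i) (φ j '' U j)
  cover : frontier X ⊆ B ∪ ⋃ j, φ j '' U j
  abs_sgn : ∀ j, |sgn j| = 1
  orient : ∀ j (h : d = q j + 1), ∀ x ∈ U j, ∀ ρ, Defines X ρ (φ j x) → ∀ ν,
    0 < fderiv ℝ ρ (φ j x) ν → 0 < sgn j * bdet h ν fun c => fderiv ℝ (φ j) x (stdVec c)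

attribute [instance] BoundaryPieces.fintypeJ

/-! ### The flux through a graph, split among the boundary pieces -/

namespace GraphChart

variable {q : ℕ} {X : Set (Eucl (q + 1))} {p : Eucl (q + 1)} (G : GraphChart X p)

/-- The density of the flux of `V` through the graph. -/
def fluxDensity (V : Eucl (q + 1) → Eucl (q + 1)) (x : Fin q → ℝ) : ℝ :=
  fderiv ℝ G.ρ (G.pt x) (V (G.pt x)) / |fderiv ℝ G.ρ (G.pt x) (stdVec G.r)|

theorem pt_mem_tube {x : Fin q → ℝ} (hx : x ∈ G.base') : G.pt x ∈ G.tube := by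
  refine ⟨by rwa [rem_pt], ?_⟩
  rw [rem_pt, pt_r, sub_self, abs_zero]; exact G.h_pos

/-- A frontier point is not in `X` but is a limit of points of `X`; by `mem_iff` its signed height
over the graph satisfies both inequalities, hence is zero. -/
theorem eq_pt_of_mem_frontier (hX : IsOpen X) {x : Eucl (q + 1)} (hx : x ∈ frontier X)
    (hxt : x ∈ G.tube) : x = G.pt (rem G.r x) := by
  rw [hX.frontier_eq] at hx
  have h1 : 0 ≤ G.σ * (x G.r - G.g (rem G.r x)) := by
    by_contra! hc
    exact hx.2 ((G.mem_iff x (G.base'_subset hxt.1) hxt.2.le).2 hc)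
  have h2 : G.σ * (x G.r - G.g (rem G.r x)) ≤ 0 := by
    have hc : ContinuousAt (fun y : Eucl (q + 1) => G.σ * (y G.r - G.g (rem G.r y))) x := by
      refine continuousAt_const.mul (ContinuousAt.sub ?_ ?_)
      · exact (EuclideanSpace.proj (𝕜 := ℝ) G.r).continuous.continuousAt
      · exact ContinuousAt.comp (f := rem G.r) (G.continuousAt_g (G.base'_subset hxt.1))
          (rem G.r).continuous.continuousAt
    refine le_of_tendsto_of_frequently hc ?_
    refine ((mem_closure_iff_frequently.1 hx.1).and_eventually
      (G.isOpen_tube.mem_nhds hxt)).mono ?_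
    rintro y ⟨hy, hyt⟩
    exact ((G.mem_iff y (G.base'_subset hyt.1) hyt.2.le).1 hy).le
  have h3 : x G.r = G.g (rem G.r x) := by
    have h4 := congrArg (G.σ * ·) (le_antisymm h2 h1)
    simp only [← mul_assoc, G.σ_mul_self, one_mul, mul_zero] at h4
    linarith
  rw [pt, ← h3, ins_rem]

variable {B : Set (Eucl (q + 1))} (P : BoundaryPieces X B)

/-- The part of the graph in the piece `j`. -/
def slice (j : P.J) : Set (Fin q → ℝ) :=
  (fun x => rem G.r (P.φ j x)) '' (P.U j ∩ P.φ j ⁻¹' G.tube)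

theorem isOpen_slice_domain (j : P.J) : IsOpen (P.U j ∩ P.φ j ⁻¹' G.tube) :=
  (P.contDiffOn j).continuousOn.isOpen_inter_preimage (P.isOpen_U j) G.isOpen_tube

theorem slice_subset (j : P.J) : G.slice P j ⊆ G.base' := by
  rintro _ ⟨x, ⟨_, hx⟩, rfl⟩; exact hx.1

theorem mem_slice (hX : IsOpen X) (j : P.J) {x : Fin q → ℝ} (hx : x ∈ G.base') :
    x ∈ G.slice P j ↔ G.pt x ∈ P.φ j '' P.U j := by
  constructor
  · rintro ⟨y, ⟨hy, hyt⟩, rfl⟩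
    exact ⟨y, hy, G.eq_pt_of_mem_frontier hX (P.mapsTo j y hy) hyt⟩
  · rintro ⟨y, hy, hyx⟩
    refine ⟨y, ⟨hy, ?_⟩, ?_⟩
    · change P.φ j y ∈ G.tube
      rw [hyx]; exact G.pt_mem_tube hx
    · simp only [hyx, G.rem_pt]

theorem slice_injOn (hX : IsOpen X) (j : P.J) :
    Set.InjOn (fun x => rem G.r (P.φ j x)) (P.U j ∩ P.φ j ⁻¹' G.tube) := by
  rintro x ⟨hx, hxt⟩ y ⟨hy, hyt⟩ hxy
  apply P.injOn j hx hy
  have h1 := G.eq_pt_of_mem_frontier hX (P.mapsTo j x hx) hxt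
  have h2 := G.eq_pt_of_mem_frontier hX (P.mapsTo j y hy) hyt
  have hxy' : rem G.r (P.φ j x) = rem G.r (P.φ j y) := hxy
  rw [h1, h2, hxy']

/-- The image of a measurable set under an injective continuous map is measurable (Lusin–Souslin),
also when the piece has higher codimension. -/
theorem measurableSet_slice (hX : IsOpen X) (j : P.J) : MeasurableSet (G.slice P j) := by
  apply (G.isOpen_slice_domain P j).measurableSet.image_of_continuousOn_injOn
  · exact (rem G.r).continuous.comp_continuousOn
      ((P.contDiffOn j).continuousOn.mono Set.inter_subset_left)
  · exact G.slice_injOn P hX j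

/-- By disjointness at most one indicator is nonzero. A graph point in no piece belongs to `B`,
where the field is tangent and the density vanishes. -/
theorem fluxDensity_eq_sum (hX : IsOpen X) {V : Eucl (q + 1) → Eucl (q + 1)}
    (hB : ∀ x ∈ frontier X ∩ B, ∀ ρ, Defines X ρ x → fderiv ℝ ρ x (V x) = 0)
    {x : Fin q → ℝ} (hx : x ∈ G.base') :
    G.fluxDensity V x = ∑ j, (G.slice P j).indicator (G.fluxDensity V) x := by
  classical
  have hfr := G.pt_mem_frontier hX (G.base'_subset hx)
  by_cases h : ∃ j, x ∈ G.slice P j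
  · obtain ⟨j, hj⟩ := h
    rw [Finset.sum_eq_single j]
    · rw [Set.indicator_of_mem hj]
    · intro i _ hij
      apply Set.indicator_of_notMem
      intro hi
      rw [G.mem_slice P hX _ hx] at hi hj
      exact Set.disjoint_left.1 (P.disjoint i j hij) hi hj
    · simp
  · push Not at h
    rw [Finset.sum_eq_zero fun j _ => Set.indicator_of_notMem (h j) _]
    have hxB : G.pt x ∈ B := by
      rcases P.cover hfr with hb | hb
      · exact hb
      · rw [Set.mem_iUnion] at hb
        obtain ⟨j, hj⟩ := hb
        exact absurd ((G.mem_slice P hX j hx).2 hj) (h j)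
    rw [fluxDensity, hB _ ⟨hfr, hxB⟩ _ (G.defines_pt (G.base'_subset hx)), zero_div]

theorem continuousOn_fluxDensity (hX : IsOpen X) {V : Eucl (q + 1) → Eucl (q + 1)}
    (hV : ContinuousOn V (closure X)) : ContinuousOn (G.fluxDensity V) (Set.Icc G.lo G.hi) := by
  have h0 : ContinuousOn G.pt (Set.Icc G.lo G.hi) :=
    fun x hx => (G.hasFDerivAt_pt hx).continuousAt.continuousWithinAt
  have h1 : ContinuousOn (fun x => V (G.pt x)) (Set.Icc G.lo G.hi) :=
    hV.comp h0 fun x hx => frontier_subset_closure (G.pt_mem_frontier hX hx)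
  have hρ : ContDiff ℝ ∞ G.ρ := (G.defines_pt G.base_mem).1
  have h2 : ContinuousOn (fun x => fderiv ℝ G.ρ (G.pt x)) (Set.Icc G.lo G.hi) :=
    (hρ.continuous_fderiv (by simp)).comp_continuousOn h0
  refine (h2.clm_apply h1).div (h2.clm_apply continuousOn_const).abs fun x hx => ?_
  have h3 := G.slope_pt hx
  rw [abs_ne_zero]
  intro h4
  rw [h4, mul_zero] at h3
  exact lt_irrefl _ h3

theorem integrableOn_fluxDensity (hX : IsOpen X) {V : Eucl (q + 1) → Eucl (q + 1)}
    (hV : ContinuousOn V (closure X)) : IntegrableOn (G.fluxDensity V) G.base' :=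
  ((G.continuousOn_fluxDensity hX hV).integrableOn_compact isCompact_Icc).mono_set G.base'_subset

theorem integral_fluxDensity (hX : IsOpen X) {V : Eucl (q + 1) → Eucl (q + 1)}
    (hV : ContinuousOn V (closure X))
    (hB : ∀ x ∈ frontier X ∩ B, ∀ ρ, Defines X ρ x → fderiv ℝ ρ x (V x) = 0) :
    ∫ x in G.base', G.fluxDensity V x = ∑ j, ∫ x in G.slice P j, G.fluxDensity V x := by
  rw [setIntegral_congr_fun G.isOpen_base'.measurableSet
    (fun x hx => G.fluxDensity_eq_sum P hX hB hx), integral_finsetSum]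
  · refine Finset.sum_congr rfl fun j _ => ?_
    rw [setIntegral_indicator (G.measurableSet_slice P hX j),
      Set.inter_eq_self_of_subset_right (G.slice_subset P j)]
  · intro j _
    exact (G.integrableOn_fluxDensity hX hV).indicator (G.measurableSet_slice P hX j)

/-- Pieces of codimension at least two are null sets. -/
theorem volume_slice (hX : IsOpen X) (j : P.J) (hj : q + 1 ≠ P.q j + 1) :
    volume (G.slice P j) = 0 := by
  rcases (P.U j ∩ P.φ j ⁻¹' G.tube).eq_empty_or_nonempty with he | ⟨x, hx, hxt⟩
  · simp [slice, he]
  have hfr : ∀ᶠ y in 𝓝 x, P.φ j y ∈ frontier X := by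
    filter_upwards [(P.isOpen_U j).mem_nhds hx] with y hy
    exact P.mapsTo j y hy
  have hcd : ∀ y ∈ P.U j, ContDiffAt ℝ 1 (P.φ j) y := fun y hy =>
    (P.contDiffOn j).contDiffAt ((P.isOpen_U j).mem_nhds hy)
  have hρ : Defines X G.ρ (P.φ j x) := G.defines _ (G.base'_subset hxt.1) hxt.2.le
  have hker := hρ.fderiv_comp_eq_zero hX ((hcd x hx).differentiableAt (by simp)) hfr
  -- The injective derivative of the piece has its range in the `q`-dimensional kernel of dρ, so its
  -- dimension is at most `q`; equality is excluded by `hj`.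
  have hlt : P.q j < q := by
    have h1 : LinearMap.range (fderiv ℝ (P.φ j) x).toLinearMap ≤
        LinearMap.ker (fderiv ℝ G.ρ (P.φ j x)).toLinearMap := by
      rintro _ ⟨w, rfl⟩; exact hker w
    have h2 : Module.finrank ℝ (LinearMap.range (fderiv ℝ (P.φ j) x).toLinearMap) = P.q j := by
      rw [LinearMap.finrank_range_of_inj (P.immersion j x hx)]; simp
    have hl' : (fderiv ℝ G.ρ (P.φ j x)).toLinearMap ≠ 0 :=
      fun hc => hρ.2.1 (by ext x; exact DFunLike.congr_fun hc x)
    have h3 : Module.finrank ℝ (LinearMap.ker (fderiv ℝ G.ρ (P.φ j x)).toLinearMap) + 1 =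
        q + 1 := by
      rw [Module.Dual.finrank_ker_add_one_of_ne_zero hl']; simp
    have h4 := Submodule.finrank_mono h1
    omega
  -- A C¹ map is locally Lipschitz and does not raise the Hausdorff dimension, so the slice has
  -- dimension less than `q` and Lebesgue measure zero.
  have hdim : dimH (G.slice P j) < (q : NNReal) := by
    have h1 : dimH (G.slice P j) ≤ dimH (P.U j ∩ P.φ j ⁻¹' G.tube) := by
      apply dimH_image_le_of_locally_lipschitzOn
      rintro y ⟨hy, -⟩
      have : ContDiffAt ℝ 1 (fun x => rem G.r (P.φ j x)) y :=
        (rem G.r).contDiff.contDiffAt.comp y (hcd y hy)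
      obtain ⟨K, t, ht, hL⟩ := this.exists_lipschitzOnWith
      exact ⟨K, t, nhdsWithin_le_nhds ht, hL⟩
    have h2 : dimH (P.U j ∩ P.φ j ⁻¹' G.tube) ≤ P.q j := by
      refine (dimH_mono (Set.subset_univ _)).trans ?_
      rw [Real.dimH_univ_eq_finrank]; simp
    refine (h1.trans h2).trans_lt ?_
    exact_mod_cast hlt
  have h3 := measure_zero_of_dimH_lt (μ := (volume : Measure (Fin q → ℝ))) (d := (q : NNReal)) ?_ hdim
  · exact h3
  · have := hausdorffMeasure_pi_real (ι := Fin q)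
    rw [Fintype.card_fin] at this
    simp only [NNReal.coe_natCast, this]
    rfl

/-- The change of variables from the graph to an immersed piece of codimension one. -/
theorem integral_image_fluxDensity (hX : IsOpen X) {V : Eucl (q + 1) → Eucl (q + 1)} {q' : ℕ}
    (h : q + 1 = q' + 1) {φ : Eucl q' → Eucl (q + 1)} {U : Set (Eucl q')} (hU : IsOpen U)
    (hφ : ContDiffOn ℝ 1 φ U) (hinj : Set.InjOn (fun x => rem G.r (φ x)) (U ∩ φ ⁻¹' G.tube))
    (himm : ∀ x ∈ U, Function.Injective (fderiv ℝ φ x)) (hmaps : ∀ x ∈ U, φ x ∈ frontier X)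
    {s : ℝ} (hs : |s| = 1)
    (hor : ∀ x ∈ U, ∀ ρ, Defines X ρ (φ x) → ∀ ν, 0 < fderiv ℝ ρ (φ x) ν →
      0 < s * bdet h ν fun c => fderiv ℝ φ x (stdVec c))
    {Z : Set (Eucl (q + 1))} (hZt : Z ⊆ G.tube) (hVZ : ∀ x, x ∉ Z → V x = 0) :
    ∫ x in (fun x => rem G.r (φ x)) '' (U ∩ φ ⁻¹' G.tube), G.fluxDensity V x =
      s * ∫ x in U, bdet h (V (φ x)) fun c => fderiv ℝ φ x (stdVec c) := by
  obtain rfl : q' = q := by omega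
  set A := U ∩ φ ⁻¹' G.tube with hA
  have hAo : IsOpen A := hφ.continuousOn.isOpen_inter_preimage hU G.isOpen_tube
  let e : Eucl q' ≃L[ℝ] (Fin q' → ℝ) := PiLp.continuousLinearEquiv 2 ℝ fun _ => ℝ
  let κ : Eucl q' → Eucl q' := fun x => e.symm (rem G.r (φ x))
  let κ' : Eucl q' → Eucl q' →L[ℝ] Eucl q' := fun x =>
    (e.symm : (Fin q' → ℝ) →L[ℝ] Eucl q').comp ((rem G.r).comp (fderiv ℝ φ x))
  have hd : ∀ x ∈ U, DifferentiableAt ℝ φ x := fun x hx =>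
    (hφ.contDiffAt (hU.mem_nhds hx)).differentiableAt (by simp)
  have hκ' : ∀ x ∈ A, HasFDerivWithinAt κ (κ' x) A x := by
    intro x hx
    have := (e.symm.hasFDerivAt (x := rem G.r (φ x))).comp x
      ((rem G.r).hasFDerivAt.comp x (hd x hx.1).hasFDerivAt)
    exact this.hasFDerivWithinAt
  have hκi : Set.InjOn κ A := fun x hx y hy hxy => hinj hx hy (e.symm.injective hxy)
  have h1 : ∫ x in (fun x => rem G.r (φ x)) '' A, G.fluxDensity V x =
      ∫ x in κ '' A, G.fluxDensity V (e x) := by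
    have h2 := (PiLp.volume_preserving_ofLp (Fin q')).setIntegral_preimage_emb
      (MeasurableEquiv.toLp 2 (Fin q' → ℝ)).symm.measurableEmbedding
      (G.fluxDensity V) ((fun x => rem G.r (φ x)) '' A)
    rw [← h2]
    have h3 : WithLp.ofLp ⁻¹' ((fun x => rem G.r (φ x)) '' A) = κ '' A := by
      ext y
      constructor
      · rintro ⟨x, hx, hxy⟩
        exact ⟨x, hx, by simp only [κ, hxy]; exact e.symm_apply_apply y⟩
      · rintro ⟨x, hx, rfl⟩
        exact ⟨x, hx, rfl⟩
    rw [h3]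
    rfl
  have hpt : ∀ x ∈ A, |(κ' x).det| • G.fluxDensity V (e (κ x)) =
      s * bdet rfl (V (φ x)) fun c => fderiv ℝ φ x (stdVec c) := by
    intro x hx
    have hfr : ∀ᶠ y in 𝓝 x, φ y ∈ frontier X := by
      filter_upwards [hU.mem_nhds hx.1] with y hy
      exact hmaps y hy
    have hφx : G.pt (rem G.r (φ x)) = φ x :=
      (G.eq_pt_of_mem_frontier hX (hmaps x hx.1) hx.2).symm
    have hρ : Defines X G.ρ (φ x) := G.defines _ (G.base'_subset hx.2.1) hx.2.2.le
    have hslope : 0 < G.σ * fderiv ℝ G.ρ (φ x) (stdVec G.r) :=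
      G.slope _ (G.base'_subset hx.2.1) hx.2.2.le
    have hker := hρ.fderiv_comp_eq_zero hX (hd x hx.1) hfr
    have hdet : |(κ' x).det| = |bdet rfl (stdVec G.r) fun c => fderiv ℝ φ x (stdVec c)| := by
      rw [abs_bdet_stdVec, ContinuousLinearMap.det,
        ← LinearMap.det_toMatrix (EuclideanSpace.basisFun (Fin q') ℝ).toBasis]
      congr 2
    have hσ : |fderiv ℝ G.ρ (φ x) (stdVec G.r)| = G.σ * fderiv ℝ G.ρ (φ x) (stdVec G.r) := by
      rw [← G.abs_σ_mul, abs_of_pos hslope]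
    have hne : fderiv ℝ G.ρ (φ x) (stdVec G.r) ≠ 0 := by
      intro h0; rw [h0, mul_zero] at hslope; exact lt_irrefl _ hslope
    -- The number `t` makes `V - t • stdVec r` lie in the kernel of dρ, that is in the range of dφ.
    -- Such a vector changes neither side, so both are `t` times their value at `stdVec r`, where
    -- the absolute value is resolved by the orientation.
    set t := fderiv ℝ G.ρ (φ x) (V (φ x)) / fderiv ℝ G.ρ (φ x) (stdVec G.r) with ht
    have hb1 : 0 < s * (G.σ * bdet rfl (stdVec G.r) fun c => fderiv ℝ φ x (stdVec c)) := by
      rw [← bdet_smul]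
      apply hor x hx.1 _ hρ
      rw [map_smul]
      exact hslope
    have hb2 : |bdet rfl (stdVec G.r) fun c => fderiv ℝ φ x (stdVec c)| =
        s * (G.σ * bdet rfl (stdVec G.r) fun c => fderiv ℝ φ x (stdVec c)) := by
      rw [← abs_of_pos hb1, abs_mul, hs, one_mul, G.abs_σ_mul]
    obtain ⟨w, hw⟩ : ∃ w, fderiv ℝ φ x w = V (φ x) - t • stdVec G.r := by
      apply ker_eq_range (himm x hx.1) hρ.2.1 hker
      rw [map_sub, map_smul, smul_eq_mul, ht, div_mul_cancel₀ _ hne, sub_self]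
    have hb3 : bdet rfl (V (φ x)) (fun c => fderiv ℝ φ x (stdVec c)) =
        t * bdet rfl (stdVec G.r) fun c => fderiv ℝ φ x (stdVec c) := by
      have hV : V (φ x) = t • stdVec G.r + fderiv ℝ φ x w := by rw [hw]; abel
      rw [hV, bdet_smul_add, bdet_range, add_zero]
    have hke : e (κ x) = rem G.r (φ x) := e.apply_symm_apply _
    rw [hdet, hke, fluxDensity, hφx, hb2, hb3, hσ, smul_eq_mul, ht]
    have hσ2 : G.σ ≠ 0 := fun h0 => by rw [h0, zero_mul] at hslope; exact lt_irrefl _ hslope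
    field_simp
  rw [h1, integral_image_eq_integral_abs_det_fderiv_smul volume hAo.measurableSet hκ' hκi,
    setIntegral_congr_fun hAo.measurableSet hpt, integral_const_mul]
  congr 1
  -- The integral over `A` extends to all of `U`: outside the tube the field vanishes.
  symm
  apply setIntegral_eq_of_subset_of_forall_sdiff_eq_zero hU.measurableSet Set.inter_subset_left
  rintro x ⟨hx, hxA⟩
  have : V (φ x) = 0 := hVZ _ fun hxZ => hxA ⟨hx, hZt hxZ⟩
  rw [this, bdet_zero]

end GraphChart

/-- The flux of `V` through the pieces of codimension one. -/
def BoundaryPieces.flux {d : ℕ} {X B : Set (Eucl d)} (P : BoundaryPieces X B)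
    (V : Eucl d → Eucl d) : ℝ :=
  ∑ j, if h : d = P.q j + 1 then
    P.sgn j * ∫ x in P.U j, bdet h (V (P.φ j x)) fun c => fderiv ℝ (P.φ j) x (stdVec c) else 0

/-- The divergence theorem in a graph chart. -/
theorem GraphChart.integral_divg_eq_flux {q : ℕ} {X : Set (Eucl (q + 1))} {p : Eucl (q + 1)}
    (G : GraphChart X p) {B : Set (Eucl (q + 1))} (P : BoundaryPieces X B)
    (hX : IsOpen X) (hu : UniqueDiffOn ℝ (closure X))
    {V : Eucl (q + 1) → Eucl (q + 1)} (hV : ContDiffOn ℝ 1 V (closure X))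
    (hB : ∀ x ∈ frontier X ∩ B, ∀ ρ, Defines X ρ x → fderiv ℝ ρ x (V x) = 0)
    {Z : Set (Eucl (q + 1))} (hZ : IsClosed Z) (hZt : Z ⊆ G.tube) (hVZ : ∀ x, x ∉ Z → V x = 0) :
    ∫ x in X, divg V x = P.flux V := by
  rw [G.integral_divg hX hu hV hZ hZt hVZ]
  refine (G.integral_fluxDensity P hX hV.continuousOn hB).trans (Finset.sum_congr rfl fun j _ => ?_)
  split_ifs with h
  · exact G.integral_image_fluxDensity hX h (P.isOpen_U j) (P.contDiffOn j) (G.slice_injOn P hX j)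
      (P.immersion j) (P.mapsTo j) (P.abs_sgn j) (P.orient j h) hZt hVZ
  · exact setIntegral_measure_zero _ (G.volume_slice P hX j h)

/-! ### The divergence theorem -/

theorem divg_congr {d : ℕ} {V W : Eucl d → Eucl d} {x : Eucl d} (h : V =ᶠ[𝓝 x] W) :
    divg V x = divg W x := by
  rw [divg, divg, h.fderiv_eq]

theorem divg_zero {d : ℕ} (x : Eucl d) : divg (fun _ : Eucl d => (0 : Eucl d)) x = 0 := by
  simp [divg]

theorem divg_sum {d : ℕ} {ι : Type*} (s : Finset ι) {V : ι → Eucl d → Eucl d} {x : Eucl d}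
    (h : ∀ i ∈ s, DifferentiableAt ℝ (V i) x) :
    divg (fun y => ∑ i ∈ s, V i y) x = ∑ i ∈ s, divg (V i) x := by
  simp only [divg]
  rw [Finset.sum_comm]
  refine Finset.sum_congr rfl fun r _ => ?_
  rw [fderiv_fun_sum h, sum_apply]
  simp

theorem divg_eq_sum_fderiv {d : ℕ} {V : Eucl d → Eucl d} {x : Eucl d}
    (h : DifferentiableAt ℝ V x) :
    divg V x = ∑ r, fderiv ℝ (fun y => V y r) x (stdVec r) := by
  refine Finset.sum_congr rfl fun r _ => ?_
  have h1 : HasFDerivAt (fun y => V y r) ((EuclideanSpace.proj (𝕜 := ℝ) r).comp (fderiv ℝ V x)) x :=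
    (EuclideanSpace.proj (𝕜 := ℝ) r).hasFDerivAt.comp x h.hasFDerivAt
  rw [h1.fderiv]
  rfl

theorem isCompact_closure {d : ℕ} {X : Set (Eucl d)} (hb : Bornology.IsBounded X) :
    IsCompact (closure X) :=
  Metric.isCompact_of_isClosed_isBounded isClosed_closure hb.closure

theorem integrableOn_divg {d : ℕ} {X : Set (Eucl d)} (hX : IsOpen X) (hb : Bornology.IsBounded X)
    (hu : UniqueDiffOn ℝ (closure X)) {V : Eucl d → Eucl d} (hV : ContDiffOn ℝ 1 V (closure X)) :
    IntegrableOn (divg V) X := by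
  have hdv : ContinuousOn (fun y => ∑ r, fderivWithin ℝ V (closure X) y (stdVec r) r)
      (closure X) := by
    refine continuousOn_finsetSum _ fun r _ => ?_
    exact (EuclideanSpace.proj (𝕜 := ℝ) r).continuous.comp_continuousOn
      ((hV.continuousOn_fderivWithin hu le_rfl).clm_apply continuousOn_const)
  refine ((hdv.integrableOn_compact (isCompact_closure hb)).mono_set subset_closure).congr_fun
    (fun y hy => ?_) hX.measurableSet
  simp only [divg, fderivWithin_of_mem_nhds
    (Filter.mem_of_superset (hX.mem_nhds hy) subset_closure)]

/-- A field supported in a compact subset of `X` is C¹ on the whole space with compact support, and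
the integral of each of its partial derivatives vanishes. -/
theorem integral_divg_of_subset {d : ℕ} {X : Set (Eucl d)} (hX : IsOpen X)
    (hb : Bornology.IsBounded X) {V : Eucl d → Eucl d} (hV : ContDiffOn ℝ 1 V (closure X))
    {Z : Set (Eucl d)} (hZ : IsClosed Z) (hZX : Z ⊆ X) (hVZ : ∀ x, x ∉ Z → V x = 0) :
    ∫ x in X, divg V x = 0 := by
  have hZc : IsCompact Z := Metric.isCompact_of_isClosed_isBounded hZ (hb.subset hZX)
  have hVd : ContDiff ℝ 1 V := by
    rw [contDiff_iff_contDiffAt]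
    intro x
    by_cases hx : x ∈ Z
    · exact hV.contDiffAt (Filter.mem_of_superset (hX.mem_nhds (hZX hx)) subset_closure)
    · refine (contDiffAt_const (c := (0 : Eucl d))).congr_of_eventuallyEq ?_
      filter_upwards [hZ.isOpen_compl.mem_nhds hx] with y hy
      exact hVZ y hy
  have hVs : HasCompactSupport V := HasCompactSupport.intro hZc hVZ
  have h0 : ∀ x, x ∉ X → divg V x = 0 := by
    intro x hx
    rw [← divg_zero x]
    apply divg_congr
    filter_upwards [hZ.isOpen_compl.mem_nhds fun h => hx (hZX h)] with y hy
    exact hVZ y hy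
  rw [setIntegral_eq_integral_of_forall_compl_eq_zero h0]
  simp only [divg_eq_sum_fderiv (hVd.differentiable (by simp) _)]
  have hr : ∀ r : Fin d, ContDiff ℝ 1 fun y => V y r := fun r =>
    (EuclideanSpace.proj (𝕜 := ℝ) r).contDiff.comp hVd
  have hs : ∀ r : Fin d, HasCompactSupport fun y => V y r := fun r =>
    hVs.comp_left (g := fun v : Eucl d => v r) rfl
  have hi : ∀ r : Fin d, Integrable fun x => fderiv ℝ (fun y => V y r) x (stdVec r) := by
    intro r
    refine Continuous.integrable_of_hasCompactSupport
      (((hr r).continuous_fderiv (by simp)).clm_apply continuous_const) ?_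
    exact ((hs r).fderiv ℝ).comp_left (g := fun L : Eucl d →L[ℝ] ℝ => L (stdVec r)) rfl
  rw [integral_finsetSum _ fun r _ => hi r]
  refine Finset.sum_eq_zero fun r _ => ?_
  -- Integration by parts against the constant function 1, whose derivative is zero.
  have := integral_mul_fderiv_eq_neg_fderiv_mul_of_integrable (μ := (volume : Measure (Eucl d)))
    (f := fun _ => (1 : ℝ)) (g := fun y => V y r) (v := stdVec r) (by simp)
    (by simpa using hi r)
    (by simpa using (hr r).continuous.integrable_of_hasCompactSupport (hs r))
    (fun x _ => differentiableAt_const _) (fun x _ => (hr r).differentiable (by simp) x)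
  simpa using this

/-- In dimension zero every differential is zero, so a domain with smooth boundary has no frontier
points and the case is vacuous. -/
theorem not_defines_zero {X : Set (Eucl 0)} {ρ : Eucl 0 → ℝ} {x : Eucl 0} : ¬ Defines X ρ x := by
  intro h
  apply h.2.1
  ext v
  rw [Subsingleton.elim v 0, map_zero, map_zero]

variable {d : ℕ} {X B : Set (Eucl d)}

theorem BoundaryPieces.flux_eq_zero (P : BoundaryPieces X B) {V : Eucl d → Eucl d}
    (hV : ∀ x ∈ frontier X, V x = 0) : P.flux V = 0 := by
  refine Finset.sum_eq_zero fun j _ => ?_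
  split_ifs with h
  · rw [setIntegral_congr_fun (g := fun _ => (0 : ℝ)) (P.isOpen_U j).measurableSet fun x hx => by
      rw [hV _ (P.mapsTo j x hx), bdet_zero]]
    simp
  · rfl

theorem BoundaryPieces.flux_sum (P : BoundaryPieces X B) {ι : Type*} (s : Finset ι)
    {V : ι → Eucl d → Eucl d}
    (hi : ∀ i ∈ s, ∀ j (h : d = P.q j + 1), IntegrableOn
      (fun x => bdet h (V i (P.φ j x)) fun c => fderiv ℝ (P.φ j) x (stdVec c)) (P.U j)) :
    P.flux (fun x => ∑ i ∈ s, V i x) = ∑ i ∈ s, P.flux (V i) := by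
  simp only [flux]
  rw [Finset.sum_comm]
  refine Finset.sum_congr rfl fun j _ => ?_
  split_ifs with h
  · simp only [bdet_sum]
    rw [integral_finsetSum _ fun i his => hi i his j h, Finset.mul_sum]
  · simp

theorem BoundaryPieces.flux_congr (P : BoundaryPieces X B) {V W : Eucl d → Eucl d}
    (hV : ∀ x ∈ frontier X, V x = W x) : P.flux V = P.flux W := by
  refine Finset.sum_congr rfl fun j _ => ?_
  split_ifs with h
  · rw [setIntegral_congr_fun (P.isOpen_U j).measurableSet fun x hx => by
      rw [hV _ (P.mapsTo j x hx)]]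
  · rfl

/-- Each point has a neighbourhood such that the divergence theorem holds for fields supported
therein. -/
theorem exists_nhds_integral_divg (P : BoundaryPieces X B) (hX : IsOpen X)
    (hb : Bornology.IsBounded X) (hs : HasSmoothBoundary X) {x : Eucl d} (hx : x ∈ closure X) :
    ∃ N, IsOpen N ∧ x ∈ N ∧ ∀ V : Eucl d → Eucl d, ContDiffOn ℝ 1 V (closure X) →
      (∀ x ∈ frontier X ∩ B, ∀ ρ, Defines X ρ x → fderiv ℝ ρ x (V x) = 0) →
      ∀ Z, IsClosed Z → Z ⊆ N → (∀ x, x ∉ Z → V x = 0) → ∫ x in X, divg V x = P.flux V := by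
  by_cases hxX : x ∈ X
  · refine ⟨X, hX, hxX, fun V hV _ Z hZ hZX hVZ => ?_⟩
    rw [integral_divg_of_subset hX hb hV hZ hZX hVZ, P.flux_eq_zero]
    intro y hy
    rw [hX.frontier_eq] at hy
    exact hVZ y fun h => hy.2 (hZX h)
  · have hfr : x ∈ frontier X := by rw [hX.frontier_eq]; exact ⟨hx, hxX⟩
    obtain ⟨ρ, hρ⟩ := hs.exists_defines hfr
    cases d with
    | zero => exact (not_defines_zero hρ).elim
    | succ q =>
      obtain ⟨G, rfl⟩ := hρ.exists_graphChart (hρ.eq_zero hX hfr)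
      exact ⟨G.tube, G.isOpen_tube, G.mem_tube, fun V hV hB Z hZ hZt hVZ =>
        G.integral_divg_eq_flux P hX (uniqueDiffOn_closure hX hs) hV hB hZ hZt hVZ⟩

/-- The divergence theorem. -/
theorem integral_divg_eq_flux (P : BoundaryPieces X B) (hX : IsOpen X)
    (hb : Bornology.IsBounded X) (hs : HasSmoothBoundary X) {V : Eucl d → Eucl d}
    (hV : ContDiffOn ℝ 1 V (closure X))
    (hB : ∀ x ∈ frontier X ∩ B, ∀ ρ, Defines X ρ x → fderiv ℝ ρ x (V x) = 0)
    (hi : ∀ j (h : d = P.q j + 1), IntegrableOn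
      (fun x => bdet h (V (P.φ j x)) fun c => fderiv ℝ (P.φ j) x (stdVec c)) (P.U j)) :
    ∫ x in X, divg V x = P.flux V := by
  choose! N hN1 hN2 hN3 using fun x (hx : x ∈ closure X) =>
    exists_nhds_integral_divg P hX hb hs hx
  obtain ⟨t, ht⟩ := (isCompact_closure hb).elim_finite_subcover (fun x : closure X => N x)
    (fun x => hN1 x x.2) fun x hx => Set.mem_iUnion.2 ⟨⟨x, hx⟩, hN2 x hx⟩
  -- The closure is compact, so finitely many of the good neighbourhoods cover it; a subordinate
  -- partition of unity reduces the theorem to fields supported in one of them.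
  obtain ⟨f, hf⟩ := SmoothPartitionOfUnity.exists_isSubordinate (modelWithCornersSelf ℝ (Eucl d))
    (isClosed_closure (s := X)) (fun x : t => N x.1) (fun x => hN1 _ x.1.2) (by
      intro x hx
      obtain ⟨y, hy⟩ := Set.mem_iUnion.1 (ht hx)
      obtain ⟨hyt, hy⟩ := Set.mem_iUnion.1 hy
      exact Set.mem_iUnion.2 ⟨⟨y, hyt⟩, hy⟩)
  have hfs : ∀ i, ContDiff ℝ ∞ (f i) := fun i => (f i).contMDiff.contDiff
  have h1 : ∀ x ∈ closure X, ∑ i, f i x = 1 := by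
    intro x hx
    rw [← f.sum_eq_one hx, finsum_eq_sum_of_fintype]
  let W : t → Eucl d → Eucl d := fun i x => f i x • V x
  have hW : ∀ i, ContDiffOn ℝ 1 (W i) (closure X) := fun i =>
    (((hfs i).of_le (by norm_cast)).contDiffOn).smul hV
  have hsum : ∀ x ∈ closure X, ∑ i, W i x = V x := by
    intro x hx
    rw [← Finset.sum_smul, h1 x hx, one_smul]
  have hloc : ∀ i, ∫ x in X, divg (W i) x = P.flux (W i) := by
    intro i
    refine hN3 i.1 i.1.2 (W i) (hW i) ?_ (tsupport (f i)) (isClosed_tsupport _) (hf i) ?_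
    -- Tangency on `B` is a pointwise linear condition and survives multiplication by a function.
    · intro x hx ρ hρ
      rw [map_smul, hB x hx ρ hρ, smul_zero]
    · intro x hx
      simp only [W]
      rw [image_eq_zero_of_notMem_tsupport hx, zero_smul]
  have hint : ∀ i ∈ Finset.univ, ∀ j (h : d = P.q j + 1), IntegrableOn
      (fun x => bdet h (W i (P.φ j x)) fun c => fderiv ℝ (P.φ j) x (stdVec c)) (P.U j) := by
    intro i _ j h
    simp only [W, bdet_smul]
    refine (hi j h).bdd_mul (c := 1) ?_ ?_
    · exact ((hfs i).continuous.comp_continuousOn (P.contDiffOn j).continuousOn).aestronglyMeasurable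
        (P.isOpen_U j).measurableSet
    · refine Filter.Eventually.of_forall fun x => ?_
      rw [Real.norm_eq_abs, abs_of_nonneg (f.nonneg _ _)]
      exact f.le_one _ _
  have h2 : ∀ x ∈ X, divg V x = ∑ i, divg (W i) x := by
    intro x hx
    rw [← divg_sum]
    · apply divg_congr
      filter_upwards [hX.mem_nhds hx] with y hy
      exact (hsum y (subset_closure hy)).symm
    · intro i _
      exact ((hW i).contDiffAt (Filter.mem_of_superset (hX.mem_nhds hx)
        subset_closure)).differentiableAt (by simp)
  rw [setIntegral_congr_fun hX.measurableSet h2, integral_finsetSum _ fun i _ =>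
    integrableOn_divg hX hb (uniqueDiffOn_closure hX hs) (hW i), Finset.sum_congr rfl fun i _ =>
    hloc i, ← P.flux_sum _ hint]
  exact P.flux_congr fun x hx => hsum x (frontier_subset_closure hx)

/-! ### Regularity of forms -/

theorem contDiff_coeff {d m : ℕ} (t : Fin m ↪o Fin d) :
    ContDiff ℝ ∞ fun α : Alt d m => coeff α t :=
  (ContinuousAlternatingMap.apply ℝ (Eucl d) ℝ fun r => stdVec (t r)).contDiff

theorem contDiffOn_coeff {d e m : ℕ} {k : WithTop ℕ∞} (hk : k ≤ ∞) {S : Set (Eucl e)}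
    {A : Eucl e → Alt d m} (hA : ContDiffOn ℝ k A S) (t : Fin m ↪o Fin d) :
    ContDiffOn ℝ k (fun x => coeff (A x) t) S :=
  ((contDiff_coeff t).of_le hk).comp_contDiffOn hA

theorem contDiffOn_of_coeff {d e m : ℕ} {k : WithTop ℕ∞} {S : Set (Eucl e)} {A : Eucl e → Alt d m}
    (hA : ∀ t, ContDiffOn ℝ k (fun x => coeff (A x) t) S) : ContDiffOn ℝ k A S := by
  have e : A = fun x => ∑ t, coeff (A x) t • dualForm t := by
    ext1 x; rw [sum_coeff_dualForm]
  rw [e]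
  exact ContDiffOn.sum fun t _ => (hA t).smul contDiffOn_const

theorem contDiffOn_ev {d e : ℕ} {k : WithTop ℕ∞} (hk : k ≤ ∞) {S : Set (Eucl e)}
    {A : (m : ℕ) → Eucl e → Alt d m} (hA : ∀ m, ContDiffOn ℝ k (A m) S) (T : Finset (Fin d)) :
    ContDiffOn ℝ k (fun x => ev (fun m => A m x) stdVec T) S := by
  simp only [ev_stdVec _ T rfl]
  exact contDiffOn_coeff hk (hA _) _

theorem contDiffOn_star {d : ℕ} {k : WithTop ℕ∞} (hk : k ≤ ∞) {S : Set (Eucl d)} {a : GForm d}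
    (ha : ∀ m, ContDiffOn ℝ k (a m) S) (m : ℕ) : ContDiffOn ℝ k (star a m) S :=
  ContDiffOn.sum fun _ _ => (contDiffOn_const.mul (contDiffOn_coeff hk (ha _) _)).smul
    contDiffOn_const

theorem contDiffOn_starInv {d : ℕ} {k : WithTop ℕ∞} (hk : k ≤ ∞) {S : Set (Eucl d)} {a : GForm d}
    (ha : ∀ m, ContDiffOn ℝ k (a m) S) (m : ℕ) : ContDiffOn ℝ k (starInv a m) S :=
  ContDiffOn.sum fun _ _ => (contDiffOn_const.mul (contDiffOn_coeff hk (ha _) _)).smul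
    contDiffOn_const

theorem contDiffOn_dOn {d : ℕ} {S : Set (Eucl d)} (hS : UniqueDiffOn ℝ S) {a : GForm d}
    (ha : ∀ m, ContDiffOn ℝ ∞ (a m) S) (m : ℕ) : ContDiffOn ℝ ∞ (dOn S a m) S := by
  cases m with
  | zero => exact contDiffOn_const
  | succ m =>
    exact (ContinuousAlternatingMap.alternatizeUncurryFinCLM ℝ (Eucl d) ℝ).contDiff.comp_contDiffOn
      (ContDiffOn.fderivWithin (m := ∞) (ha m) hS le_rfl)

theorem contDiffOn_codOn {d : ℕ} {S : Set (Eucl d)} (hS : UniqueDiffOn ℝ S) {a : GForm d}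
    (ha : ∀ m, ContDiffOn ℝ ∞ (a m) S) (m : ℕ) : ContDiffOn ℝ ∞ (codOn S a m) S :=
  (contDiffOn_starInv le_rfl (contDiffOn_dOn hS (contDiffOn_star le_rfl ha)) m).const_smul _

/-- A form with smooth coefficients, applied to smooth vector fields, is smooth. -/
theorem contDiffOn_apply {d e m : ℕ} {k : WithTop ℕ∞} (hk : k ≤ ∞) {S : Set (Eucl e)}
    {A : Eucl e → Alt d m} (hA : ContDiffOn ℝ k A S) {v : Fin m → Eucl e → Eucl d}
    (hv : ∀ r, ContDiffOn ℝ k (v r) S) : ContDiffOn ℝ k (fun x => A x fun r => v r x) S := by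
  have e : (fun x => A x fun r => v r x) = fun x => ∑ t, coeff (A x) t *
      ∑ σ : Equiv.Perm (Fin m), ((Equiv.Perm.sign σ : ℤ) : ℝ) * ∏ i, v (σ i) x (t i) := by
    ext1 x
    conv_lhs => rw [← sum_coeff_dualForm (A x)]
    simp only [ContinuousAlternatingMap.sum_apply, ContinuousAlternatingMap.smul_apply,
      dualForm_apply, Matrix.det_apply, Matrix.of_apply, smul_eq_mul, Units.smul_def, zsmul_eq_mul]
  rw [e]
  refine ContDiffOn.sum fun t _ => (contDiffOn_coeff hk hA t).mul
    (ContDiffOn.sum fun σ _ => contDiffOn_const.mul (contDiffOn_prod fun i _ => ?_))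
  exact (EuclideanSpace.proj (𝕜 := ℝ) (t i)).contDiff.comp_contDiffOn (hv (σ i))

theorem contDiffOn_pullback {d e m : ℕ} {k : WithTop ℕ∞} (hk : k ≤ ∞) {S : Set (Eucl e)}
    {A : Eucl e → Alt d m} (hA : ContDiffOn ℝ k A S) {L : Eucl e → Eucl e →L[ℝ] Eucl d}
    (hL : ContDiffOn ℝ k L S) :
    ContDiffOn ℝ k (fun x => (A x).compContinuousLinearMap (L x)) S := by
  refine contDiffOn_of_coeff fun t => ?_
  exact contDiffOn_apply hk hA fun r => hL.clm_apply contDiffOn_const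

theorem contDiffOn_flux {d : ℕ} {k : WithTop ℕ∞} (hk : k ≤ ∞) {S : Set (Eucl d)} {a b : GForm d}
    (ha : ∀ m, ContDiffOn ℝ k (a m) S) (hb : ∀ m, ContDiffOn ℝ k (b m) S) :
    ContDiffOn ℝ k (fun x => flux (fun m => a m x) (fun m => b m x)) S := by
  rw [contDiffOn_euclidean]
  intro r
  simp only [flux_apply]
  exact ContDiffOn.sum fun T _ => contDiffOn_const.mul
    ((contDiffOn_ev hk ha _).mul (contDiffOn_ev hk hb _))

theorem integrableOn_coeff_mul {d : ℕ} {S : Set (Eucl d)} (hS : Bornology.IsBounded S)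
    {m : ℕ} {α β : Eucl d → Alt d m} (hα : ContinuousOn α (closure S))
    (hβ : ContinuousOn β (closure S)) (t : Fin m ↪o Fin d) :
    IntegrableOn (fun x => coeff (α x) t * coeff (β x) t) S :=
  ((((contDiff_coeff t).continuous.comp_continuousOn hα).mul
    ((contDiff_coeff t).continuous.comp_continuousOn hβ)).integrableOn_compact
      (isCompact_closure hS)).mono_set subset_closure

theorem memLp_of_continuousOn {d m : ℕ} {S : Set (Eucl d)} (hS : Bornology.IsBounded S)
    (ho : IsOpen S) {α : Eucl d → Alt d m} (hα : ContinuousOn α (closure S)) :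
    MemLp α 2 (volume.restrict S) := by
  obtain ⟨C, hC⟩ := (isCompact_closure hS).exists_bound_of_continuousOn hα
  have : IsFiniteMeasure (volume.restrict S) := ⟨by
    rw [Measure.restrict_apply_univ]; exact hS.measure_lt_top⟩
  refine MemLp.of_bound ((hα.mono subset_closure).aestronglyMeasurable ho.measurableSet) C ?_
  filter_upwards [ae_restrict_mem ho.measurableSet] with x hx
  exact hC x (subset_closure hx)

/-! ### Orientations -/

/-- Applying `l` to a linear relation between the columns isolates the coefficient of ν, which must
vanish; injectivity of `T` then kills the other coefficients. -/
theorem bdet_ne_zero {d q : ℕ} (h : d = q + 1) {T : Eucl q →L[ℝ] Eucl d}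
    (hT : Function.Injective T) {l : Eucl d →L[ℝ] ℝ} (hl : ∀ w, l (T w) = 0) {ν : Eucl d}
    (hν : l ν ≠ 0) : bdet h ν (fun c => T (stdVec c)) ≠ 0 := by
  subst h
  intro h0
  obtain ⟨v, hv, hv0⟩ := Matrix.exists_mulVec_eq_zero_iff.2 h0
  have h1 : v 0 • ν + T (WithLp.toLp 2 fun c : Fin q => v c.succ) = 0 := by
    ext r
    have := congrFun hv0 r
    rw [eucl_eq_sum (WithLp.toLp 2 fun c : Fin q => v c.succ), map_sum]
    simp only [Matrix.mulVec, dotProduct, Fin.sum_univ_succ, Matrix.of_apply, Fin.cons_zero,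
      Fin.cons_succ, Fin.cast_refl, id] at this
    simp only [PiLp.add_apply, PiLp.smul_apply, smul_eq_mul, map_smul, WithLp.ofLp_sum,
      Finset.sum_apply, PiLp.zero_apply]
    refine Eq.trans ?_ this
    rw [mul_comm]
    congr 1
    exact Finset.sum_congr rfl fun c _ => mul_comm _ _
  have h2 : v 0 = 0 := by
    have := congrArg l h1
    rw [map_add, hl, map_smul, map_zero, add_zero, smul_eq_mul] at this
    exact (mul_eq_zero.1 this).resolve_right hν
  rw [h2, zero_smul, zero_add] at h1
  have h3 := hT (h1.trans (map_zero T).symm)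
  apply hv
  ext i
  refine Fin.cases h2 (fun c => ?_) i
  exact congrArg (fun w : Eucl q => w c) h3

/-- The vectors `ν'` and `(l ν' / l ν) • ν` differ by an element of the kernel of `l`, which is the
range of `T` and does not affect the determinant. -/
theorem bdet_mul {d q : ℕ} (h : d = q + 1) {T : Eucl q →L[ℝ] Eucl d}
    (hT : Function.Injective T) {l : Eucl d →L[ℝ] ℝ} (hl : ∀ w, l (T w) = 0) {ν : Eucl d}
    (hν : l ν ≠ 0) (ν' : Eucl d) : bdet h ν' (fun c => T (stdVec c)) =
      l ν' / l ν * bdet h ν (fun c => T (stdVec c)) := by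
  subst h
  have hl0 : l ≠ 0 := by rintro rfl; exact hν rfl
  obtain ⟨w, hw⟩ := ker_eq_range hT hl0 hl (v := ν' - (l ν' / l ν) • ν) (by
    rw [map_sub, map_smul, smul_eq_mul, div_mul_cancel₀ _ hν, sub_self])
  have e : ν' = (l ν' / l ν) • ν + T w := by rw [hw]; abel
  conv_lhs => rw [e]
  rw [bdet_smul_add, bdet_range, add_zero]

/-! ### Green's formula on a single domain -/

/-- The kernel of a nonzero functional is the image of an injective linear map. -/
theorem exists_range_eq_ker {q : ℕ} {l : Eucl (q + 1) →L[ℝ] ℝ} (hl : l ≠ 0) :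
    ∃ T : Eucl q →L[ℝ] Eucl (q + 1), Function.Injective T ∧ ∀ w, l (T w) = 0 := by
  have h1 : Module.finrank ℝ (LinearMap.range l.toLinearMap) = 1 := by
    rw [LinearMap.range_eq_top.2, finrank_top, Module.finrank_self]
    exact LinearMap.surjective fun h => hl (ContinuousLinearMap.coe_injective h)
  have h2 := LinearMap.finrank_range_add_finrank_ker l.toLinearMap
  rw [h1, finrank_euclideanSpace_fin] at h2
  have h3 : Module.finrank ℝ (Eucl q) = Module.finrank ℝ (LinearMap.ker l.toLinearMap) := by
    rw [finrank_euclideanSpace_fin]; omega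
  let e := LinearEquiv.ofFinrankEq _ _ h3
  refine ⟨LinearMap.toContinuousLinearMap ((LinearMap.ker l.toLinearMap).subtype ∘ₗ e), ?_, ?_⟩
  · exact (Submodule.injective_subtype _).comp e.injective
  · intro w
    exact (e w).2

/-- The flux is tangent to the boundary where the restriction of `b` to the boundary vanishes. -/
theorem Defines.fderiv_flux_eq_zero {d : ℕ} {X : Set (Eucl d)} (hX : IsOpen X) {x : Eucl d}
    (hx : x ∈ frontier X) {ρ : Eucl d → ℝ} (hρ : Defines X ρ x) (a b : GForm d)
    (hb : ∀ (m : ℕ) (v : Fin m → Eucl d),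
      (∀ r, v r ∈ tangentConeAt ℝ (frontier X) x) → b m x v = 0) :
    fderiv ℝ ρ x (flux (fun m => a m x) (fun m => b m x)) = 0 := by
  cases d with
  | zero => exact (not_defines_zero hρ).elim
  | succ q =>
    obtain ⟨T, hT, hlT⟩ := exists_range_eq_ker hρ.2.1
    -- If the flux were transversal, its determinant with a basis of the tangent space would be
    -- nonzero. But `bdet_flux` expresses that determinant through values of `b` on tangent vectors.
    by_contra hne
    refine bdet_ne_zero rfl hT hlT hne ?_
    rw [bdet_flux]
    refine Finset.sum_eq_zero fun S _ => ?_
    rw [ev, hb _ _ fun r => hρ.mem_tangentConeAt hX (hρ.eq_zero hX hx) (hlT _), zero_mul, mul_zero]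

theorem bdet_flux_cast {d q : ℕ} (h : d = q + 1) (a : GForm d) (B : (m : ℕ) → Alt d m)
    (x : Eucl d) (v : Fin q → Eucl d) :
    bdet h (flux (fun m => a m x) B) v =
      ∑ T : Finset (Fin q), shuffleSign T * (ev B v T * ev (fun m => star a m x) v Tᶜ) := by
  subst h
  exact bdet_flux a B x v

/-- The integrated form of `divg_flux`. The condition on `b` over `B` enters only to make the flux
tangent there, as the divergence theorem for the given pieces requires. -/
theorem innerOn_green {d : ℕ} {X B : Set (Eucl d)} (P : BoundaryPieces X B) (hX : IsOpen X)
    (hb : Bornology.IsBounded X) (hs : HasSmoothBoundary X) {a b : GForm d}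
    (ha : ∀ m, ContDiffOn ℝ ∞ (a m) (closure X)) (hb' : ∀ m, ContDiffOn ℝ ∞ (b m) (closure X))
    (hB : ∀ x ∈ frontier X ∩ B, ∀ (m : ℕ) (v : Fin m → Eucl d),
      (∀ r, v r ∈ tangentConeAt ℝ (frontier X) x) → b m x v = 0)
    (hi : ∀ j (h : d = P.q j + 1), IntegrableOn
      (fun x => bdet h (flux (fun m => a m (P.φ j x)) (fun m => b m (P.φ j x)))
        fun c => fderiv ℝ (P.φ j) x (stdVec c)) (P.U j)) :
    innerOn X a (dOn (closure X) b) = innerOn X (codOn (closure X) a) b +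
      P.flux fun x => flux (fun m => a m x) (fun m => b m x) := by
  have hu := uniqueDiffOn_closure hX hs
  have hn : ∀ x ∈ X, closure X ∈ 𝓝 x := fun x hx =>
    Filter.mem_of_superset (hX.mem_nhds hx) subset_closure
  have hdiv := integral_divg_eq_flux P hX hb hs
    ((contDiffOn_flux le_rfl ha hb').of_le (by norm_cast))
    (fun x hx ρ hρ => hρ.fderiv_flux_eq_zero hX hx.1 a b (hB x hx)) hi
  have hda := contDiffOn_codOn hu ha
  have hdb := contDiffOn_dOn hu hb'
  have i1 : ∀ {a b : GForm d}, (∀ m, ContDiffOn ℝ ∞ (a m) (closure X)) →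
      (∀ m, ContDiffOn ℝ ∞ (b m) (closure X)) → IntegrableOn (fun x => ∑ T : Finset (Fin d),
        ev (fun m => a m x) stdVec T * ev (fun m => b m x) stdVec T) X := by
    intro a b ha hb'
    refine integrable_finsetSum _ fun T _ => ?_
    simp only [ev_stdVec _ T rfl]
    exact integrableOn_coeff_mul hb (ha _).continuousOn (hb' _).continuousOn _
  rw [innerOn_eq _ _ _ fun m t => integrableOn_coeff_mul hb (ha m).continuousOn
    (hdb m).continuousOn t, innerOn_eq _ _ _ fun m t => integrableOn_coeff_mul hb
    (hda m).continuousOn (hb' m).continuousOn t, ← hdiv, ← sub_eq_iff_eq_add',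
    ← integral_sub (i1 ha hdb) (i1 hda hb')]
  refine setIntegral_congr_fun hX.measurableSet fun x hx => ?_
  exact (divg_flux (closure X) a b x (hn x hx)
    (fun m => ((ha m).contDiffAt (hn x hx)).differentiableAt (by simp))
    fun m => ((hb' m).contDiffAt (hn x hx)).differentiableAt (by simp)).symm

/-! ### Constancy of the orientation along a boundary piece -/

theorem continuous_bdet {d q : ℕ} (h : d = q + 1) (ν : Eucl d) :
    Continuous fun v : Fin q → Eucl d => bdet h ν v := by
  subst h
  have key : ∀ r c, Continuous fun v : Fin q → Eucl (q + 1) =>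
      (Fin.cons ν v : Fin (q + 1) → Eucl (q + 1)) c r := by
    intro r c
    induction c using Fin.cases with
    | zero => simpa only [Fin.cons_zero] using continuous_const
    | succ c =>
      simp only [Fin.cons_succ]
      exact (EuclideanSpace.proj (𝕜 := ℝ) r).continuous.comp (continuous_apply c)
  exact Continuous.matrix_det (continuous_matrix key)

/-- Otherwise `x + t • ν` would be both inside and outside of `X` for small `t > 0`. So any two
defining functions agree on which side is outward. -/
theorem Defines.not_opposite {d : ℕ} {X : Set (Eucl d)} (hX : IsOpen X) {x ν : Eucl d}
    (hx : x ∈ frontier X) {ρ ρ' : Eucl d → ℝ} (hρ : Defines X ρ x) (hρ' : Defines X ρ' x)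
    (h : 0 < fderiv ℝ ρ x ν) : 0 ≤ fderiv ℝ ρ' x ν := by
  by_contra! hc
  obtain ⟨t, h1, h2⟩ := ((hρ.eventually_notMem (hρ.eq_zero hX hx) h).and
    (hρ'.eventually_mem (hρ'.eq_zero hX hx) hc)).exists
  exact h1 h2

theorem exists_preimage_of_ker {d q : ℕ} (h : d = q + 1) {T : Eucl q →L[ℝ] Eucl d}
    (hT : Function.Injective T) {l : Eucl d →L[ℝ] ℝ} (hl0 : l ≠ 0) (hl : ∀ w, l (T w) = 0)
    {ν : Eucl d} (hν : l ν = 0) : ∃ w, T w = ν := by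
  subst h
  exact ker_eq_range hT hl0 hl hν

section

variable {d q : ℕ} {X : Set (Eucl d)} {U : Set (Eucl q)} {φ : Eucl q → Eucl d}

/-- The sign depends neither on the outward vector nor on the defining function. By `not_opposite`,
ν' is not inward for ρ, and it is not tangent either, since it would then be in the range of dφ and
be killed by dρ'. -/
theorem bdet_mul_pos (h : d = q + 1) (hX : IsOpen X) {x : Eucl q} {ρ ρ' : Eucl d → ℝ}
    (hρ : Defines X ρ (φ x)) (hρ' : Defines X ρ' (φ x)) (hx : φ x ∈ frontier X)
    (hm : ∀ᶠ y in 𝓝 x, φ y ∈ frontier X) (hφ : DifferentiableAt ℝ φ x)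
    (himm : Function.Injective (fderiv ℝ φ x)) {ν ν' : Eucl d} (hν : 0 < fderiv ℝ ρ (φ x) ν)
    (hν' : 0 < fderiv ℝ ρ' (φ x) ν') {s : ℝ}
    (hs : 0 < s * bdet h ν fun c => fderiv ℝ φ x (stdVec c)) :
    0 < s * bdet h ν' fun c => fderiv ℝ φ x (stdVec c) := by
  have hk := hρ.fderiv_comp_eq_zero hX hφ hm
  have hk' := hρ'.fderiv_comp_eq_zero hX hφ hm
  have h1 : 0 < fderiv ℝ ρ (φ x) ν' := by
    refine (hρ'.not_opposite hX hx hρ hν').lt_of_ne fun h0 => ?_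
    obtain ⟨w, rfl⟩ := exists_preimage_of_ker h himm hρ.2.1 hk h0.symm
    rw [hk'] at hν'
    exact lt_irrefl _ hν'
  rw [bdet_mul h himm hk hν.ne' ν', mul_left_comm]
  exact mul_pos (div_pos h1 hν) hs

/-- On a connected piece of the boundary, the orientations are the same or opposite throughout. -/
theorem exists_orient (h : d = q + 1) (hX : IsOpen X) (hs : HasSmoothBoundary X) (hU : IsOpen U)
    (hc : IsPreconnected U) (hφ : ContDiffOn ℝ 1 φ U)
    (himm : ∀ x ∈ U, Function.Injective (fderiv ℝ φ x)) (hm : ∀ x ∈ U, φ x ∈ frontier X) :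
    ∃ s : ℝ, (s = 1 ∨ s = -1) ∧ ∀ x ∈ U, ∀ ρ, Defines X ρ (φ x) → ∀ ν,
      0 < fderiv ℝ ρ (φ x) ν → 0 < s * bdet h ν fun c => fderiv ℝ φ x (stdVec c) := by
  have hd : ∀ x ∈ U, DifferentiableAt ℝ φ x := fun x hx =>
    (hφ.contDiffAt (hU.mem_nhds hx)).differentiableAt (by simp)
  have hm' : ∀ x ∈ U, ∀ᶠ y in 𝓝 x, φ y ∈ frontier X := by
    intro x hx
    filter_upwards [hU.mem_nhds hx] with y hy
    exact hm y hy
  -- The points with orientation sign `s`. Keeping ρ and ν fixed while the point varies shows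
  -- openness; `O 1` and `O (-1)` are disjoint and cover `U`, so connectedness leaves only one of
  -- them.
  let O : ℝ → Set (Eucl q) := fun s => {x | x ∈ U ∧ ∃ ρ ν, Defines X ρ (φ x) ∧
    0 < fderiv ℝ ρ (φ x) ν ∧ 0 < s * bdet h ν fun c => fderiv ℝ φ x (stdVec c)}
  have hO : ∀ s, IsOpen (O s) := by
    intro s
    rw [isOpen_iff_mem_nhds]
    rintro x ⟨hx, ρ, ν, h1, h2, h3⟩
    have c1 : ContinuousAt φ x := (hd x hx).continuousAt
    have c2 : ContinuousAt (fun y => fderiv ℝ ρ (φ y) ν) x :=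
      ((h1.1.continuous_fderiv (by simp)).clm_apply continuous_const).continuousAt.comp c1
    have c3 : ContinuousAt (fun y => s * bdet h ν fun c => fderiv ℝ φ y (stdVec c)) x := by
      refine continuousAt_const.mul (ContinuousAt.comp (g := fun v => bdet h ν v)
        (continuous_bdet h ν).continuousAt (continuousAt_pi.2 fun c => ?_))
      exact ((hφ.continuousOn_fderiv_of_isOpen hU le_rfl).continuousAt (hU.mem_nhds hx)).clm_apply
        continuousAt_const
    filter_upwards [hU.mem_nhds hx, c1.eventually h1.eventually, c2.eventually (lt_mem_nhds h2),
      c3.eventually (lt_mem_nhds h3)] with y k1 k2 k3 k4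
    exact ⟨k1, ρ, ν, k2, k3, k4⟩
  have key : ∀ s x, x ∈ O s → ∀ ρ, Defines X ρ (φ x) → ∀ ν,
      0 < fderiv ℝ ρ (φ x) ν → 0 < s * bdet h ν fun c => fderiv ℝ φ x (stdVec c) := by
    rintro s x ⟨hx, ρ', ν', h1, h2, h3⟩ ρ hρ ν hν
    exact bdet_mul_pos h hX h1 hρ (hm x hx) (hm' x hx) (hd x hx) (himm x hx) h2 hν h3
  have hdisj : Disjoint (O 1) (O (-1)) := by
    rw [Set.disjoint_left]
    rintro x h1 ⟨hx, ρ', ν', k1, k2, k3⟩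
    have := key 1 x h1 ρ' k1 ν' k2
    linarith
  have hcov : U ⊆ O 1 ∪ O (-1) := by
    intro x hx
    obtain ⟨ρ, hρ⟩ := hs.exists_defines (hm x hx)
    obtain ⟨v, hv⟩ := hρ.exists_neg
    have hv' : 0 < fderiv ℝ ρ (φ x) (-v) := by rw [map_neg]; linarith
    have hne := bdet_ne_zero h (himm x hx) (hρ.fderiv_comp_eq_zero hX (hd x hx) (hm' x hx)) hv'.ne'
    rcases lt_or_gt_of_ne hne with h1 | h1
    · exact Or.inr ⟨hx, ρ, -v, hρ, hv', by linarith⟩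
    · exact Or.inl ⟨hx, ρ, -v, hρ, hv', by linarith⟩
  rcases hc.subset_or_subset (hO 1) (hO (-1)) hdisj hcov with h1 | h1
  · exact ⟨1, Or.inl rfl, fun x hx => key 1 x (h1 hx)⟩
  · exact ⟨-1, Or.inr rfl, fun x hx => key (-1) x (h1 hx)⟩

end

/-! ### Coordinate domains of the nodes and their boundary pieces -/

namespace ConformingForest

variable {n : ℕ} (F : ConformingForest n)

theorem closure_mem_nhds {i : F.I} {x : Eucl (F.dim i)} (hx : x ∈ F.X i) :
    closure (F.X i) ∈ 𝓝 x :=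
  Filter.mem_of_superset ((F.isOpen_X i).mem_nhds hx) subset_closure

theorem uniqueDiffOn (i : F.I) : UniqueDiffOn ℝ (closure (F.X i)) :=
  uniqueDiffOn_closure (F.isOpen_X i) (F.smooth_X i)

variable {F} {l j : F.Node}

theorem differentiableAt_φ (h : F.Desc l j) {x : Eucl (F.dim j.1)} (hx : x ∈ F.X j.1) :
    DifferentiableAt ℝ (F.φ l j) x :=
  ((F.contDiffOn_φ l j h).contDiffAt (F.closure_mem_nhds hx)).differentiableAt (by simp)

theorem mapsTo_closure (h : F.Desc l j) :
    Set.MapsTo (F.φ l j) (closure (F.X j.1)) (closure (F.X l.1)) := by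
  have h1 := (F.mapsTo_φ l j h).closure_of_continuousOn (F.contDiffOn_φ l j h).continuousOn
  exact h1.mono_right (closure_minimal frontier_subset_closure isClosed_closure)

theorem fderivWithin_φ {x : Eucl (F.dim j.1)} (hx : x ∈ F.X j.1) :
    fderivWithin ℝ (F.φ l j) (closure (F.X j.1)) x = fderiv ℝ (F.φ l j) x :=
  fderivWithin_of_mem_nhds (F.closure_mem_nhds hx)

theorem contDiffOn_trace (h : F.Desc l j) {a : GForm (F.dim l.1)}
    (ha : ∀ m, ContDiffOn ℝ ∞ (a m) (closure (F.X l.1))) (m : ℕ) :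
    ContDiffOn ℝ ∞ (F.trace l j a m) (closure (F.X j.1)) := by
  refine ContDiffOn.const_smul _ (contDiffOn_pullback le_rfl ?_ ?_)
  · exact (ha m).comp (F.contDiffOn_φ l j h) (mapsTo_closure h)
  · exact ContDiffOn.fderivWithin (m := ∞) (F.contDiffOn_φ l j h) (F.uniqueDiffOn _) le_rfl

theorem inc_eq_or (l j : F.Node) : F.inc l j = 1 ∨ F.inc l j = -1 := by
  classical
  unfold inc
  split_ifs <;> simp

/-- The sign `ε (Ω s_j, ∂_j Ω_l)` compares the orientations at all points. -/
theorem inc_mul_bdet_pos (hd : F.Desc l j) (h : F.dim l.1 = F.dim j.1 + 1)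
    {x : Eucl (F.dim j.1)} (hx : x ∈ F.X j.1) {ρ : Eucl (F.dim l.1) → ℝ}
    (hρ : Defines (F.X l.1) ρ (F.φ l j x)) {ν : Eucl (F.dim l.1)}
    (hν : 0 < fderiv ℝ ρ (F.φ l j x) ν) :
    0 < F.inc l j * bdet h ν fun c => fderiv ℝ (F.φ l j) x (stdVec c) := by
  obtain ⟨s, hs, hor⟩ := exists_orient h (F.isOpen_X l.1) (F.smooth_X l.1) (F.isOpen_X j.1)
    (F.isConnected_X j.1).isPreconnected (((F.contDiffOn_φ l j hd).mono subset_closure).of_le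
      (by norm_cast)) (F.immersion_φ l j hd) (fun x hx => F.mapsTo_φ l j hd hx)
  -- `inc` only asks for one point and one vector; it agrees with the sign `s`, which is the same
  -- everywhere on the connected domain.
  suffices F.inc l j = s by rw [this]; exact hor x hx ρ hρ ν hν
  have hfr := F.mapsTo_φ l j hd hx
  have h0 := hρ.eq_zero (F.isOpen_X l.1) hfr
  rcases hs with rfl | rfl
  · rw [inc, if_pos]
    refine ⟨h, x, hx, ν, ?_, ?_⟩
    · have h1 : fderiv ℝ ρ (F.φ l j x) (-ν) < 0 := by rw [map_neg]; linarith
      filter_upwards [hρ.eventually_mem h0 h1, hρ.eventually_notMem h0 hν] with t h2 h3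
      exact ⟨by rwa [smul_neg, ← sub_eq_add_neg] at h2, h3⟩
    · have := hor x hx ρ hρ ν hν
      rwa [one_mul] at this
  -- A witness for `inc` points outward only in the sense of membership, so dρ'(ν') ≥ 0. A positive
  -- value contradicts the sign -1, and for the value zero ν' is tangent and the determinant
  -- vanishes.
  · rw [inc, if_neg]
    rintro ⟨h', y, hy, ν', h1, h2⟩
    change 0 < bdet h' ν' _ at h2
    have hfr' := F.mapsTo_φ l j hd hy
    obtain ⟨ρ', hρ'⟩ := (F.smooth_X l.1).exists_defines hfr'
    have hm : ∀ᶠ z in 𝓝 y, F.φ l j z ∈ frontier (F.X l.1) := by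
      filter_upwards [(F.isOpen_X j.1).mem_nhds hy] with z hz
      exact F.mapsTo_φ l j hd hz
    have hk := hρ'.fderiv_comp_eq_zero (F.isOpen_X l.1) (differentiableAt_φ hd hy) hm
    have h3 : 0 ≤ fderiv ℝ ρ' (F.φ l j y) ν' := by
      by_contra! hc
      obtain ⟨t, h4, h5⟩ := (h1.and
        (hρ'.eventually_mem (hρ'.eq_zero (F.isOpen_X l.1) hfr') hc)).exists
      exact h4.2 h5
    rcases h3.lt_or_eq with h4 | h4
    · have := hor y hy ρ' hρ' ν' h4
      linarith
    · obtain ⟨w, rfl⟩ := exists_preimage_of_ker h' (F.immersion_φ l j hd y hy) hρ'.2.1 hk h4.symm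
      rw [bdet_range] at h2
      exact lt_irrefl _ h2

/-- The boundary of the coordinate domain of a node, decomposed by its descendants. -/
def pieces (l : F.Node) : BoundaryPieces (F.X l.1) (F.φ₀ l.1 ⁻¹' F.bdD) :=
  open Classical in
  { J := {j : F.Node // F.Desc l j}
    q := fun j => F.dim j.1.1
    U := fun j => F.X j.1.1
    φ := fun j => F.φ l j
    sgn := fun j => F.inc l j
    isOpen_U := fun j => F.isOpen_X _
    contDiffOn := fun j => ((F.contDiffOn_φ l j j.2).mono subset_closure).of_le (by norm_cast)
    injOn := fun j => (F.injOn_φ l j j.2).mono subset_closure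
    immersion := fun j => F.immersion_φ l j j.2
    mapsTo := fun j _ hx => F.mapsTo_φ l j j.2 hx
    disjoint := fun i j hij => F.disjoint_cover l i j i.2 j.2 fun h => hij (Subtype.ext h)
    cover := by
      intro x hx
      by_cases hD : F.φ₀ l.1 x ∈ F.bdD
      · exact Or.inl hD
      · right
        have h1 : x ∈ F.X l.1 ∪ ⋃ j, ⋃ (_ : F.Desc l j), F.φ l j '' F.X j.1 := by
          rw [F.cover]
          exact ⟨frontier_subset_closure hx, hD⟩
        rcases h1 with h1 | h1
        · rw [(F.isOpen_X l.1).frontier_eq] at hx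
          exact (hx.2 h1).elim
        · obtain ⟨j, h1⟩ := Set.mem_iUnion.1 h1
          obtain ⟨hj, h1⟩ := Set.mem_iUnion.1 h1
          exact Set.mem_iUnion.2 ⟨⟨j, hj⟩, h1⟩
    abs_sgn := fun j => by rcases inc_eq_or l j.1 with h | h <;> rw [h] <;> simp
    orient := fun j h x hx ρ hρ ν hν => inc_mul_bdet_pos j.2 h hx hρ hν }

end ConformingForest

namespace ConformingForest

variable {n : ℕ} {F : ConformingForest n} {l j : F.Node}

/-! ### Traces -/

theorem trace_apply {x : Eucl (F.dim j.1)} (hx : x ∈ F.X j.1) (a : GForm (F.dim l.1)) (m : ℕ)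
    (v : Fin m → Eucl (F.dim j.1)) : F.trace l j a m x v =
      (((F.orient j * F.orient l : ℤˣ) : ℤ) : ℝ) *
        a m (F.φ l j x) fun r => fderiv ℝ (F.φ l j) x (v r) := by
  rw [← fderivWithin_φ hx]
  rfl

theorem unit_mul_self (u : ℤˣ) : ((u : ℤ) : ℝ) * ((u : ℤ) : ℝ) = 1 := by
  rw [← Int.cast_mul, ← Units.val_mul, Int.units_mul_self]
  simp

/-- The image of `φ l j` lies on the frontier of `X l`, so the chain rule needs the derivative of `φ
i l` within the closure. -/
theorem fderiv_telescope {i : F.Node} (h1 : F.Desc i l) (h2 : F.Desc l j) {x : Eucl (F.dim j.1)}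
    (hx : x ∈ F.X j.1) (v : Eucl (F.dim j.1)) : fderiv ℝ (F.φ i j) x v =
      fderivWithin ℝ (F.φ i l) (closure (F.X l.1)) (F.φ l j x) (fderiv ℝ (F.φ l j) x v) := by
  have hcl := subset_closure hx
  rw [← fderivWithin_φ hx, ← fderivWithin_φ hx, fderivWithin_congr (F.telescope i l j h1 h2)
    (F.telescope i l j h1 h2 x hcl)]
  have := fderivWithin_comp x (g := F.φ i l) (f := F.φ l j)
    (((F.contDiffOn_φ i l h1).differentiableOn (by simp)) _ (mapsTo_closure h2 hcl))
    (((F.contDiffOn_φ l j h2).differentiableOn (by simp)) _ hcl) (mapsTo_closure h2)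
    (F.uniqueDiffOn _ x hcl)
  exact DFunLike.congr_fun this v

/-- The relation between `a` and `b` is assumed on the open domain only, while the trace on `j`
evaluates `b` at frontier points; continuity bridges the gap. The orientation sign of the
intermediate node occurs twice and cancels. -/
theorem trace_trace {i : F.Node} (h1 : F.Desc i l) (h2 : F.Desc l j) {a : GForm (F.dim i.1)}
    {b : GForm (F.dim l.1)} {m : ℕ} (ha : ContDiffOn ℝ ∞ (a m) (closure (F.X i.1)))
    (hb : ContDiffOn ℝ ∞ (b m) (closure (F.X l.1)))
    (hab : ∀ x ∈ F.X l.1, b m x = F.trace i l a m x) {x : Eucl (F.dim j.1)} (hx : x ∈ F.X j.1) :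
    F.trace l j b m x = F.trace i j a m x := by
  have hc : ContinuousOn (F.trace i l a m) (closure (F.X l.1)) := by
    refine ContDiffOn.continuousOn (𝕜 := ℝ) (n := ∞)
      (ContDiffOn.const_smul _ (contDiffOn_pullback le_rfl ?_ ?_))
    · exact ha.comp (F.contDiffOn_φ i l h1) (mapsTo_closure h1)
    · exact ContDiffOn.fderivWithin (m := ∞) (F.contDiffOn_φ i l h1) (F.uniqueDiffOn _) le_rfl
  have hcl : b m (F.φ l j x) = F.trace i l a m (F.φ l j x) :=
    Set.EqOn.of_subset_closure hab hb.continuousOn hc subset_closure subset_rfl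
      (mapsTo_closure h2 (subset_closure hx))
  ext v
  rw [trace_apply hx, trace_apply hx, hcl]
  change _ * (_ * a m (F.φ i l (F.φ l j x)) fun r => _) = _
  rw [← F.telescope i l j h1 h2 x (subset_closure hx)]
  simp only [fderiv_telescope h1 h2 hx]
  rw [← mul_assoc]
  congr 1
  push_cast [Units.val_mul]
  linear_combination (((F.orient j : ℤ) : ℝ) * ((F.orient i : ℤ) : ℝ)) * unit_mul_self (F.orient l)

theorem tree_rt (i : F.I) : F.tree (F.rt i) = i := F.tree_root i

theorem eq_rt_or (j : F.Node) : j = F.rt (F.tree j) ∨ F.Desc (F.rt (F.tree j)) j := F.desc_root j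

/-- Membership in `CForm` relates branches to roots only; transitivity of traces extends the
relation to every node and its descendants, as Green's formula on a branch requires. -/
theorem CForm.eq_trace {k : ℤ} {b : F.MixedForm} (hb : b ∈ F.CForm k) (hd : F.Desc l j) (m : ℕ)
    {x : Eucl (F.dim j.1)} (hx : x ∈ F.X j.1) : b j m x = F.trace l j (b l) m x := by
  rcases eq_rt_or l with h | h
  · obtain ⟨i, rfl⟩ : ∃ i, l = F.rt i := ⟨_, h⟩
    exact hb.2.2 i j hd m x hx
  · rw [hb.2.2 _ j (F.desc_trans _ _ _ h hd) m x hx]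
    exact (trace_trace h hd (hb.2.1 _ m) (hb.2.1 _ m) (hb.2.2 _ l h m) hx).symm

theorem contDiffOn_cotrace (h : F.Desc l j) {a : GForm (F.dim l.1)}
    (ha : ∀ m, ContDiffOn ℝ ∞ (a m) (closure (F.X l.1))) (m : ℕ) :
    ContDiffOn ℝ ∞ (F.cotrace l j a m) (closure (F.X j.1)) :=
  (contDiffOn_starInv le_rfl (contDiffOn_trace h (contDiffOn_star le_rfl ha)) m).const_smul _

theorem ev_trace {x : Eucl (F.dim j.1)} (hx : x ∈ F.X j.1) (a : GForm (F.dim l.1))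
    (T : Finset (Fin (F.dim j.1))) : ev (fun m => F.trace l j a m x) stdVec T =
      (((F.orient j * F.orient l : ℤˣ) : ℤ) : ℝ) *
        ev (fun m => a m (F.φ l j x)) (fun c => fderiv ℝ (F.φ l j) x (stdVec c)) T :=
  trace_apply hx a _ _

/-! ### Green's formula on a node -/

/-- `bdet_flux` gives Tr b ∧ Tr ⋆a up to orientation signs, and Tr ⋆a is ⋆_∂ Tr* a by definition of
the cotrace. The product of the two traces contains each orientation sign squared. -/
theorem inc_mul_bdet_flux (h : F.dim l.1 = F.dim j.1 + 1) {x : Eucl (F.dim j.1)}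
    (hx : x ∈ F.X j.1) (a b : GForm (F.dim l.1)) :
    F.inc l j * bdet h (flux (fun m => a m (F.φ l j x)) (fun m => b m (F.φ l j x)))
        (fun c => fderiv ℝ (F.φ l j) x (stdVec c)) =
      ∑ T : Finset (Fin (F.dim j.1)), ev (fun m => F.cotrace l j a m x) stdVec T *
        ev (fun m => F.trace l j b m x) stdVec T := by
  rw [bdet_flux_cast, Finset.mul_sum]
  refine Finset.sum_congr rfl fun T _ => ?_
  have h1 : ev (fun m => F.cotrace l j a m x) stdVec T =
      F.inc l j * ev (fun m => starInv (F.trace l j (star a)) m x) stdVec T := rfl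
  rw [h1, ev_starInv, ev_trace hx, ev_trace hx]
  linear_combination -(F.inc l j * shuffleSign T * ev (fun m => b m (F.φ l j x))
    (fun c => fderiv ℝ (F.φ l j) x (stdVec c)) T * ev (fun m => star a m (F.φ l j x))
    (fun c => fderiv ℝ (F.φ l j) x (stdVec c)) Tᶜ) * unit_mul_self (F.orient j * F.orient l)

theorem green {k : ℤ} {a : GForm (F.dim l.1)} {b : F.MixedForm}
    (ha : ∀ m, ContDiffOn ℝ ∞ (a m) (closure (F.X l.1))) (hb : b ∈ F.C0Form k) :
    open Classical in
    innerOn (F.X l.1) a (dOn (closure (F.X l.1)) (b l)) =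
      innerOn (F.X l.1) (codOn (closure (F.X l.1)) a) (b l) +
        ∑ j : F.Node with l ∈ F.J j, innerOn (F.X j.1) (F.cotrace l j a) (b j) := by
  classical
  have hint : ∀ j : F.Node, F.Desc l j → IntegrableOn (fun x => ∑ T : Finset (Fin (F.dim j.1)),
      ev (fun m => F.cotrace l j a m x) stdVec T * ev (fun m => b j m x) stdVec T) (F.X j.1) := by
    intro j hj
    refine integrable_finsetSum _ fun T _ => ?_
    simp only [ev_stdVec _ T rfl]
    exact integrableOn_coeff_mul (F.isBounded_X _) (contDiffOn_cotrace hj ha _).continuousOn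
      (hb.1.2.1 j _).continuousOn _
  have hpt : ∀ j : F.Node, ∀ hj : F.Desc l j, ∀ h : F.dim l.1 = F.dim j.1 + 1, ∀ x ∈ F.X j.1,
      F.inc l j * bdet h (flux (fun m => a m (F.φ l j x)) (fun m => b l m (F.φ l j x)))
        (fun c => fderiv ℝ (F.φ l j) x (stdVec c)) =
      ∑ T : Finset (Fin (F.dim j.1)),
        ev (fun m => F.cotrace l j a m x) stdVec T * ev (fun m => b j m x) stdVec T := by
    intro j hj h x hx
    rw [inc_mul_bdet_flux h hx]
    simp only [CForm.eq_trace hb.1 hj _ hx]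
  have hsq : ∀ j, F.inc l j * F.inc l j = 1 := fun j => by
    rcases inc_eq_or l j with h | h <;> rw [h] <;> norm_num
  rw [innerOn_green (pieces l) (F.isOpen_X _) (F.isBounded_X _) (F.smooth_X _) ha (hb.1.2.1 l)
    (fun x hx m v hv => hb.2 l m x hx.1 hx.2 v hv)]
  · congr 1
    have h1 : ∀ j : F.Node, l ∈ F.J j ↔ F.Desc l j ∧ F.dim l.1 = F.dim j.1 + 1 := fun j => Iff.rfl
    simp only [h1]
    rw [← Finset.filter_filter, Finset.sum_filter,
      Finset.sum_subtype (p := F.Desc l) _ (fun j => by simp)]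
    refine Finset.sum_congr rfl fun j _ => ?_
    change (if h : F.dim l.1 = F.dim j.1.1 + 1 then _ else _) = _
    split_ifs with h
    · rw [← integral_const_mul, innerOn_eq _ _ _ fun m t => integrableOn_coeff_mul
        (F.isBounded_X _) (contDiffOn_cotrace j.2 ha _).continuousOn (hb.1.2.1 _ _).continuousOn t]
      exact setIntegral_congr_fun (F.isOpen_X _).measurableSet fun x hx => hpt j.1 j.2 h x hx
    · rfl
  -- Integrability of the flux: up to the sign `inc`, whose square is 1, it is a pairing of forms
  -- continuous on the compact closure of `X j`.
  · intro j h
    have := ((hint j.1 j.2).const_mul (F.inc l j.1))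
    refine IntegrableOn.congr_fun this (fun x hx => ?_) (F.isOpen_X _).measurableSet
    rw [← hpt j.1 j.2 h x hx, ← mul_assoc, hsq, one_mul]
    rfl

end ConformingForest

/-! ### Bilinearity of the inner product -/

section

variable {d : ℕ} {S : Set (Eucl d)}

theorem innerOn_congr (hS : MeasurableSet S) {a a' b b' : GForm d}
    (ha : ∀ m, ∀ x ∈ S, a m x = a' m x) (hb : ∀ m, ∀ x ∈ S, b m x = b' m x) :
    innerOn S a b = innerOn S a' b' := by
  refine Finset.sum_congr rfl fun m _ => setIntegral_congr_fun hS fun x hx => ?_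
  simp only [ha m x hx, hb m x hx]

theorem innerOn_comm (a b : GForm d) : innerOn S a b = innerOn S b a := by
  simp only [innerOn, mul_comm]

theorem innerOn_add (hS : Bornology.IsBounded S) {a a' b : GForm d}
    (ha : ∀ m, ContinuousOn (a m) (closure S)) (ha' : ∀ m, ContinuousOn (a' m) (closure S))
    (hb : ∀ m, ContinuousOn (b m) (closure S)) :
    innerOn S (fun m x => a m x + a' m x) b = innerOn S a b + innerOn S a' b := by
  simp only [innerOn]
  rw [← Finset.sum_add_distrib]
  refine Finset.sum_congr rfl fun m _ => ?_
  rw [← integral_add]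
  · simp only [coeff_add, add_mul, Finset.sum_add_distrib]
  · exact integrable_finsetSum _ fun t _ => integrableOn_coeff_mul hS (ha m) (hb m) t
  · exact integrable_finsetSum _ fun t _ => integrableOn_coeff_mul hS (ha' m) (hb m) t

theorem innerOn_smul (c : ℝ) (a b : GForm d) :
    innerOn S (fun m x => c • a m x) b = c * innerOn S a b := by
  simp only [innerOn]
  rw [Finset.mul_sum]
  refine Finset.sum_congr rfl fun m _ => ?_
  rw [← integral_const_mul]
  simp only [coeff_smul, mul_assoc, Finset.mul_sum]

theorem innerOn_zero (b : GForm d) : innerOn S (fun _ _ => 0) b = 0 := by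
  simp [innerOn, coeff]

theorem innerOn_sum (hS : Bornology.IsBounded S) {ι : Type*} (s : Finset ι) {a : ι → GForm d}
    {b : GForm d} (ha : ∀ i ∈ s, ∀ m, ContinuousOn (a i m) (closure S))
    (hb : ∀ m, ContinuousOn (b m) (closure S)) :
    innerOn S (fun m x => ∑ i ∈ s, a i m x) b = ∑ i ∈ s, innerOn S (a i) b := by
  classical
  induction s using Finset.induction_on with
  | empty => simpa using innerOn_zero b
  | insert i s hi ih =>
    simp only [Finset.sum_insert hi]
    rw [innerOn_add hS (ha i (Finset.mem_insert_self i s)) ?_ hb,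
      ih fun i his => ha i (Finset.mem_insert_of_mem his)]
    intro m
    exact continuousOn_finsetSum _ fun i his => ha i (Finset.mem_insert_of_mem his) m

/-- The common shape of the coderivative and of the differential: a local part plus a multiple of a
combination of forms on nodes with the same coordinate domain. -/
theorem innerOn_add_smul_sum (hS : Bornology.IsBounded S) {ι : Type*} (s : Finset ι) (c : ℝ)
    (e : ι → ℝ) {a₀ : GForm d} {a : ι → GForm d} {b : GForm d}
    (ha₀ : ∀ m, ContinuousOn (a₀ m) (closure S))
    (ha : ∀ i ∈ s, ∀ m, ContinuousOn (a i m) (closure S))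
    (hb : ∀ m, ContinuousOn (b m) (closure S)) :
    innerOn S (fun m x => a₀ m x + c • ∑ i ∈ s, e i • a i m x) b =
      innerOn S a₀ b + c * ∑ i ∈ s, e i * innerOn S (a i) b := by
  have h1 : ∀ i ∈ s, ∀ m, ContinuousOn (fun x => e i • a i m x) (closure S) :=
    fun i hi m => (ha i hi m).fun_const_smul _
  rw [innerOn_add hS ha₀ (a' := fun m x => c • ∑ i ∈ s, e i • a i m x)
    (fun m => (continuousOn_finsetSum s fun i hi => h1 i hi m).fun_const_smul c) hb,
    innerOn_smul c (fun m x => ∑ i ∈ s, e i • a i m x),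
    innerOn_sum hS s (a := fun i m x => e i • a i m x) h1 hb]
  simp only [innerOn_smul (e _)]

end

/-! ### Degrees -/

section

variable {d : ℕ} {a : GForm d}

theorem card_compl_indexSet {m : ℕ} (t : Fin m ↪o Fin d) : (indexSet t)ᶜ.card + m = d := by
  have := Finset.card_compl_add_card (indexSet t)
  rwa [card_indexSet, Fintype.card_fin] at this

theorem coeff_zero {m : ℕ} (t : Fin m ↪o Fin d) : coeff (0 : Alt d m) t = 0 := rfl

theorem star_eq_zero {m : ℕ} (h : ∀ q, q + m = d → a q = 0) : star a m = 0 := by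
  ext1 x
  refine Finset.sum_eq_zero fun t _ => ?_
  rw [h _ (card_compl_indexSet t), Pi.zero_apply, coeff_zero, mul_zero, zero_smul]

theorem starInv_eq_zero {m : ℕ} (h : ∀ q, q + m = d → a q = 0) : starInv a m = 0 := by
  ext1 x
  refine Finset.sum_eq_zero fun t _ => ?_
  rw [h _ (card_compl_indexSet t), Pi.zero_apply, coeff_zero, mul_zero, zero_smul]

theorem dOn_eq_zero {S : Set (Eucl d)} {m : ℕ} (h : ∀ p, m = p + 1 → a p = 0) :
    dOn S a m = 0 := by
  cases m with
  | zero => rfl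
  | succ p =>
    ext1 x
    change extDerivWithin (a p) S x = 0
    rw [h p rfl, extDerivWithin, Pi.zero_def, fderivWithin_fun_const]
    exact (ContinuousAlternatingMap.alternatizeUncurryFinCLM ℝ (Eucl d) ℝ).map_zero

/-- Following the degree through star, differential and inverse star leaves `m + 1` as the only
degree that contributes to the part of degree `m`. -/
theorem codOn_eq_zero {S : Set (Eucl d)} {m : ℕ} (h : a (m + 1) = 0) : codOn S a m = 0 := by
  have h1 : starInv (dOn S (star a)) m = 0 := by
    refine starInv_eq_zero fun q hq => dOn_eq_zero fun p hp => star_eq_zero fun r hr => ?_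
    obtain rfl : r = m + 1 := by omega
    exact h
  ext1 x
  rw [codOn, h1, Pi.zero_apply, smul_zero]


end

/-! ### Degree and regularity of the explicit coderivative -/

namespace ConformingForest

variable {n : ℕ} {F : ConformingForest n} {l j : F.Node}

theorem trace_eq_zero {a : GForm (F.dim l.1)} {m : ℕ} (h : a m = 0) : F.trace l j a m = 0 := by
  ext x v
  simp [trace, h]

theorem cotrace_eq_zero (hd : F.dim l.1 = F.dim j.1 + 1) {a : GForm (F.dim l.1)} {m : ℕ}
    (h : a (m + 1) = 0) : F.cotrace l j a m = 0 := by
  have h1 : starInv (F.trace l j (star a)) m = 0 := by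
    refine starInv_eq_zero fun q hq => trace_eq_zero (star_eq_zero fun r hr => ?_)
    obtain rfl : r = m + 1 := by omega
    exact h
  ext1 x
  rw [cotrace, h1, Pi.zero_apply, smul_zero]


/-- Interacting nodes lie in trees whose roots differ by one dimension. This offsets the degree drop
from `k` to `k - 1`, so `a_l` enters the coderivative without differentiation or contraction. -/
theorem dim_of_eps_ne_zero {i : F.I} {j l : F.Sheet i} (h : F.eps j l ≠ 0) :
    F.dim (F.tree ⟨i, l⟩) = F.dim (F.tree ⟨i, j⟩) + 1 := by
  classical
  rw [eps] at h
  split_ifs at h with h1 h2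
  · rw [h2]
    exact congrArg (fun i => F.dim i + 1) (congrArg Sigma.fst h1)
  · exact (h rfl).elim
  · obtain ⟨l', hl', -⟩ := Finset.exists_ne_zero_of_sum_ne_zero h
    have hl := (Finset.mem_filter.1 hl').2
    rw [← F.desc_tree _ _ hl.2.1]
    exact hl.1

theorem isForm_explicitCoderiv {k : ℤ} {a : F.MixedForm} (ha : F.IsForm k a) :
    F.IsForm (k - 1) (F.explicitCoderiv k a) := by
  classical
  intro j m hm
  have h1 : codOn (closure (F.X j.1)) (a j) m = 0 :=
    codOn_eq_zero (ha _ _ (by push_cast; omega))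
  ext1 x
  simp only [explicitCoderiv]
  rw [h1, Finset.sum_eq_zero, Finset.sum_eq_zero]
  · simp
  · intro l hl
    have h2 := dim_of_eps_ne_zero (Finset.mem_filter.1 hl).2
    rw [ha ⟨j.1, l⟩ m, Pi.zero_apply, smul_zero]
    change F.dim (F.tree j) = _ at h2
    omega
  · intro l hl
    obtain ⟨h2, h3⟩ := (Finset.mem_filter.1 hl).2
    rw [cotrace_eq_zero h3, Pi.zero_apply]
    refine ha _ _ ?_
    rw [F.desc_tree _ _ h2]
    push_cast
    omega

theorem contDiffOn_explicitCoderiv {k : ℤ} {a : F.MixedForm}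
    (ha : ∀ (j : F.Node) (m : ℕ), ContDiffOn ℝ ∞ (a j m) (closure (F.X j.1))) (j : F.Node) (m : ℕ) :
    ContDiffOn ℝ ∞ (F.explicitCoderiv k a j m) (closure (F.X j.1)) := by
  classical
  refine ((contDiffOn_codOn (F.uniqueDiffOn _) (ha j) m).add (ContDiffOn.sum fun l hl => ?_)).add
    (ContDiffOn.const_smul _ (ContDiffOn.sum fun l _ => (ha ⟨j.1, l⟩ m).const_smul _))
  exact contDiffOn_cotrace (Finset.mem_filter.1 hl).2.1 (ha l) m

theorem explicitCoderiv_mem {k : ℤ} {a : F.MixedForm} (ha : a ∈ F.CForm k) :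
    F.explicitCoderiv k a ∈ F.L2Form (k - 1) :=
  ⟨isForm_explicitCoderiv ha.1, fun j m => memLp_of_continuousOn (F.isBounded_X _) (F.isOpen_X _)
    (contDiffOn_explicitCoderiv ha.2.1 j m).continuousOn⟩

/-! ### The discrete differential -/

theorem notMem_bdD {i : F.I} {x : Eucl (F.dim i)} (hx : x ∈ F.X i) : F.φ₀ i x ∉ F.bdD := by
  intro hD
  have h1 : F.φ₀ i x ∈ F.Y ∪ F.bdN := by
    rw [← F.iUnion_Ω]
    exact Set.mem_iUnion.2 ⟨i, x, hx, rfl⟩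
  rcases h1 with h1 | h1
  · have h2 : F.φ₀ i x ∈ frontier F.Y := by rw [F.frontier_Y]; exact Or.inr hD
    rw [F.isOpen_Y.frontier_eq] at h2
    exact h2.2 h1
  · exact Set.disjoint_left.1 F.disjoint_bd h1 hD

theorem φ₀_injOn (i : F.I) : Set.InjOn (F.φ₀ i) (F.X i) :=
  Set.injOn_iff_injective.2 (F.isEmbedding_φ₀ i).injective

/-- A node that sits on the boundary of the root of its tree sits on the boundary of every sheet
of that root, at the same place. -/
theorem existsUnique_sheet {i : F.I} {j : F.Node} (hj : F.Desc (F.rt i) j) (l' : F.Sheet i) :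
    ∃! l : F.Sheet j.1, F.Desc ⟨i, l'⟩ ⟨j.1, l⟩ ∧
      ∀ x ∈ F.X j.1, F.φ ⟨i, l'⟩ ⟨j.1, l⟩ x = F.φ (F.rt i) j x := by
  classical
  -- At a single point: the image lies on the frontier of the domain shared with `l'`, away from the
  -- Dirichlet part, so some descendant of `l'` covers it. Disjointness of the partition and
  -- injectivity of its coordinate maps identify both the domain and the point of that descendant.
  have hex : ∀ x ∈ F.X j.1, ∃ l : F.Sheet j.1, F.Desc ⟨i, l'⟩ ⟨j.1, l⟩ ∧
      F.φ ⟨i, l'⟩ ⟨j.1, l⟩ x = F.φ (F.rt i) j x := by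
    intro x hx
    have hfr : F.φ (F.rt i) j x ∈ frontier (F.X i) := F.mapsTo_φ _ _ hj hx
    have h0 : F.φ₀ i (F.φ (F.rt i) j x) = F.φ₀ j.1 x := F.telescope₀ _ _ hj x (subset_closure hx)
    have h1 : F.φ (F.rt i) j x ∈ F.X i ∪ ⋃ m, ⋃ (_ : F.Desc ⟨i, l'⟩ m),
        F.φ ⟨i, l'⟩ m '' F.X m.1 := by
      rw [F.cover ⟨i, l'⟩]
      refine ⟨frontier_subset_closure hfr, fun hD => notMem_bdD hx ?_⟩
      rw [← h0]; exact hD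
    rcases h1 with h1 | h1
    · rw [(F.isOpen_X i).frontier_eq] at hfr
      exact (hfr.2 h1).elim
    · obtain ⟨⟨i₂, m⟩, h1⟩ := Set.mem_iUnion.1 h1
      obtain ⟨hm, y, hy, hxy⟩ := Set.mem_iUnion.1 h1
      have h2 : F.φ₀ i₂ y = F.φ₀ j.1 x := by
        rw [← h0, ← hxy]
        exact (F.telescope₀ _ _ hm y (subset_closure hy)).symm
      have h3 : i₂ = j.1 := by
        by_contra hne
        refine Set.disjoint_left.1 (F.disjoint_Ω i₂ j.1 hne) ⟨y, hy, rfl⟩ ?_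
        rw [h2]
        exact ⟨x, hx, rfl⟩
      subst h3
      obtain rfl := φ₀_injOn _ hy hx h2
      exact ⟨m, hm, hxy⟩
  obtain ⟨x₀, hx₀⟩ := (F.isConnected_X j.1).nonempty
  obtain ⟨l, hl, hlx⟩ := hex x₀ hx₀
  have hpre : PreconnectedSpace (F.X j.1) :=
    Subtype.preconnectedSpace (F.isConnected_X j.1).isPreconnected
  -- The sets where a given sheet is the right one are closed, finitely many, disjoint and cover; on
  -- a connected domain one of them is everything.
  let A : F.Sheet j.1 → Set (F.X j.1) := fun l =>
    {x | F.Desc ⟨i, l'⟩ ⟨j.1, l⟩ ∧ F.φ ⟨i, l'⟩ ⟨j.1, l⟩ x = F.φ (F.rt i) j x}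
  have hA : ∀ l, IsClosed (A l) := by
    intro l
    by_cases hl : F.Desc ⟨i, l'⟩ ⟨j.1, l⟩
    · have e : A l = {x : F.X j.1 | F.φ ⟨i, l'⟩ ⟨j.1, l⟩ x = F.φ (F.rt i) j x} := by
        ext x; exact ⟨fun h => h.2, fun h => ⟨hl, h⟩⟩
      rw [e]
      refine isClosed_eq ?_ ?_
      · exact continuousOn_iff_continuous_domRestrict.1
          ((F.contDiffOn_φ _ _ hl).continuousOn.mono subset_closure)
      · exact continuousOn_iff_continuous_domRestrict.1
          ((F.contDiffOn_φ _ _ hj).continuousOn.mono subset_closure)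
    · have e : A l = ∅ := by
        ext x; exact ⟨fun h => hl h.1, fun h => h.elim⟩
      rw [e]; exact isClosed_empty
  have hdis : ∀ l₁ l₂ x, x ∈ A l₁ → x ∈ A l₂ → l₁ = l₂ := by
    rintro l₁ l₂ x ⟨h1, h2⟩ ⟨h3, h4⟩
    by_contra hne
    refine Set.disjoint_left.1 (F.disjoint_cover ⟨i, l'⟩ ⟨j.1, l₁⟩ ⟨j.1, l₂⟩ h1 h3 ?_)
      ⟨x, x.2, h2⟩ ⟨x, x.2, h4⟩
    intro h
    simp only [Sigma.mk.injEq, heq_eq_eq, true_and] at h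
    exact hne h
  have hcompl : (A l)ᶜ = ⋃ l₂ ∈ {l₂ | l₂ ≠ l}, A l₂ := by
    ext x
    simp only [Set.mem_iUnion]
    constructor
    · intro hx
      obtain ⟨l₂, h1, h2⟩ := hex x x.2
      exact ⟨l₂, fun h => hx (h ▸ ⟨h1, h2⟩), h1, h2⟩
    · rintro ⟨l₂, hne, h1⟩ h2
      exact hne (hdis _ _ _ h1 h2)
  have hclopen : IsClopen (A l) := by
    refine ⟨hA l, ?_⟩
    rw [← isClosed_compl_iff, hcompl]
    exact (Set.toFinite _).isClosed_biUnion fun l₂ _ => hA l₂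
  have huniv := hclopen.eq_univ ⟨⟨x₀, hx₀⟩, hl, hlx⟩
  have hall : ∀ x : F.X j.1, x ∈ A l := fun x => by rw [huniv]; trivial
  refine ⟨l, ⟨hl, fun x hx => (hall ⟨x, hx⟩).2⟩, fun l₂ h => ?_⟩
  exact hdis l₂ l ⟨x₀, hx₀⟩ ⟨h.1, h.2 x₀ hx₀⟩ ⟨hl, hlx⟩

theorem rootJump_apply (k : ℤ) (b : F.MixedForm) (i : F.I) (m : ℕ) (x : Eucl (F.dim i))
    (v : Fin m → Eucl (F.dim i)) :
    open Classical in
    F.rootJump k b i m x v =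
      (-1 : ℝ) ^ ((n : ℤ) - k) * ∑ l : F.Sheet i with F.dim (F.tree ⟨i, l⟩) = F.dim i + 1,
        F.inc (F.rt (F.tree ⟨i, l⟩)) ⟨i, l⟩ * b ⟨i, l⟩ m x v := by
  simp only [rootJump, ContinuousAlternatingMap.smul_apply, ContinuousAlternatingMap.sum_apply,
    smul_eq_mul]

/-- At a root this is the definition. At a branch, the trace of each summand `b_{l'}` from the root
is the trace from `l'` on the unique node at the same place, up to sign; by `CForm.eq_trace` it is a
multiple of some `b_l`. Collecting by `l` gives the coefficients `eps`. -/
theorem jump_eq {k : ℤ} {b : F.MixedForm} (hb : b ∈ F.CForm k) (j : F.Node) (m : ℕ)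
    {x : Eucl (F.dim j.1)} (hx : x ∈ F.X j.1) : F.jump k b j m x =
      (-1 : ℝ) ^ ((n : ℤ) - k) • ∑ l : F.Sheet j.1, F.eps j.2 l • b ⟨j.1, l⟩ m x := by
  classical
  by_cases h : j = F.rt (F.tree j)
  · rw [jump, if_pos h, rootJump, Finset.sum_filter]
    congr 1
    refine Finset.sum_congr rfl fun l _ => ?_
    rw [eps, if_pos h]
    split_ifs <;> simp
  · have hd : F.Desc (F.rt (F.tree j)) j := (eq_rt_or j).resolve_left h
    rw [jump, if_neg h]
    have e : ∀ l, F.eps j.2 l = ∑ l' : F.Sheet (F.tree j) with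
        F.dim (F.tree ⟨_, l'⟩) = F.dim (F.tree j) + 1,
        if F.Desc ⟨_, l'⟩ ⟨j.1, l⟩ ∧
          ∀ x ∈ F.X j.1, F.φ ⟨_, l'⟩ ⟨j.1, l⟩ x = F.φ (F.rt (F.tree j)) j x then
        (((F.orient j * F.orient ⟨j.1, l⟩ * F.orient ⟨_, l'⟩ : ℤˣ) : ℤ) : ℝ) *
          F.inc (F.rt (F.tree ⟨_, l'⟩)) ⟨_, l'⟩ else 0 := by
      intro l
      rw [eps, if_neg h, ← Finset.sum_filter, Finset.filter_filter]
      rfl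
    simp only [e, Finset.sum_smul]
    rw [Finset.sum_comm]
    ext v
    refine (trace_apply (l := F.rt (F.tree j)) hx (F.rootJump k b (F.tree j)) m v).trans ?_
    refine (congrArg (_ * ·) (rootJump_apply k b (F.tree j) m _ _)).trans ?_
    simp only [ContinuousAlternatingMap.smul_apply, ContinuousAlternatingMap.sum_apply,
      smul_eq_mul]
    rw [mul_left_comm, Finset.mul_sum]
    congr 1
    refine Finset.sum_congr rfl fun l' _ => ?_
    obtain ⟨l, ⟨h1, h2⟩, h3⟩ := existsUnique_sheet hd l'
    rw [Finset.sum_eq_single l]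
    · rw [if_pos ⟨h1, h2⟩]
      have hf : fderiv ℝ (F.φ ⟨_, l'⟩ ⟨j.1, l⟩) x = fderiv ℝ (F.φ (F.rt (F.tree j)) j) x := by
        apply Filter.EventuallyEq.fderiv_eq
        filter_upwards [(F.isOpen_X j.1).mem_nhds hx] with y hy
        exact h2 y hy
      have hcongr : ∀ (y y' : Eucl (F.dim (F.tree j))) (w w' : Fin m → Eucl (F.dim (F.tree j))),
          y = y' → w = w' → b ⟨F.tree j, l'⟩ m y w = b ⟨F.tree j, l'⟩ m y' w' := by
        rintro y _ w _ rfl rfl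
        rfl
      have hz := (DFunLike.congr_fun (CForm.eq_trace hb h1 m hx) v).trans
        ((trace_apply (l := ⟨F.tree j, l'⟩) (j := ⟨j.1, l⟩) hx _ m v).trans
          (congrArg (_ * ·) (hcongr _ _ _ _ (h2 x hx)
            (funext fun r => DFunLike.congr_fun hf (v r)))))
      rw [hz, show F.orient (F.rt (F.tree j)) = 1 from F.orient_root _]
      generalize b ⟨F.tree j, l'⟩ m (F.φ (F.rt (F.tree j)) j x) (fun r =>
        fderiv ℝ (F.φ (F.rt (F.tree j)) j) x (v r)) = z
      push_cast [Units.val_mul, Units.val_one]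
      have u1 := unit_mul_self (F.orient ⟨j.1, l⟩)
      have u2 := unit_mul_self (F.orient ⟨F.tree j, l'⟩)
      -- The signs of `l` and `l'` enter once through `eps` and once through the trace from `l'` to
      -- `l`.
      have u3 : (((F.orient ⟨j.1, l⟩ : ℤ) : ℝ) * ((F.orient ⟨j.1, l⟩ : ℤ) : ℝ)) *
        (((F.orient ⟨F.tree j, l'⟩ : ℤ) : ℝ) * ((F.orient ⟨F.tree j, l'⟩ : ℤ) : ℝ)) = 1 := by
        rw [u1, u2, one_mul]
      linear_combination (-((F.orient j : ℤ) : ℝ) *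
        F.inc (F.rt (F.tree ⟨F.tree j, l'⟩)) ⟨F.tree j, l'⟩ * z) * u3
    · intro l₂ _ hne
      rw [if_neg fun hc => hne (h3 l₂ hc), zero_mul]
    · simp

/-! ### Summation over the forest -/

theorem innerOn_explicitCoderiv {k : ℤ} {a : F.MixedForm} (ha : a ∈ F.CForm k) {b : F.MixedForm}
    (hb : b ∈ F.CForm (k - 1)) (j : F.Node) :
    open Classical in
    innerOn (F.X j.1) (F.explicitCoderiv k a j) (b j) =
      innerOn (F.X j.1) (codOn (closure (F.X j.1)) (a j)) (b j) +
      ∑ l : F.Node with l ∈ F.J j, innerOn (F.X j.1) (F.cotrace l j (a l)) (b j) +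
      (-1 : ℝ) ^ ((n : ℤ) - k + 1) *
        ∑ l : F.Sheet j.1, F.eps l j.2 * innerOn (F.X j.1) (a ⟨j.1, l⟩) (b j) := by
  classical
  have c1 := fun m => (contDiffOn_codOn (F.uniqueDiffOn j.1) (ha.2.1 j) m).continuousOn
  have c2 : ∀ l ∈ ({l | l ∈ F.J j} : Finset F.Node), ∀ m,
      ContinuousOn (F.cotrace l j (a l) m) (closure (F.X j.1)) := fun l hl m =>
    (contDiffOn_cotrace (Finset.mem_filter.1 hl).2.1 (ha.2.1 l) m).continuousOn
  have cb := fun m => (hb.2.1 j m).continuousOn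
  have hS := F.isBounded_X j.1
  -- Outside `gamma` the coefficient is zero, so the sum may run over all sheets and be exchanged
  -- freely later.
  have e1 : ∀ (m : ℕ) (x : Eucl (F.dim j.1)), 
      (∑ l : F.Sheet j.1 with l ∈ F.gamma j.2, F.eps l j.2 • a ⟨j.1, l⟩ m x : Alt (F.dim j.1) m) =
      ∑ l : F.Sheet j.1, F.eps l j.2 • a ⟨j.1, l⟩ m x := by
    intro m x
    rw [Finset.sum_filter]
    refine Finset.sum_congr rfl fun l _ => ?_
    split_ifs with h
    · rfl
    · have : F.eps l j.2 = 0 := not_not.1 h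
      rw [this, zero_smul]
  have e2 : F.explicitCoderiv k a j = fun m x => (codOn (closure (F.X j.1)) (a j) m x
      + ∑ l : F.Node with l ∈ F.J j, F.cotrace l j (a l) m x)
      + (-1 : ℝ) ^ ((n : ℤ) - k + 1) • ∑ l : F.Sheet j.1, F.eps l j.2 • a ⟨j.1, l⟩ m x := by
    ext1 m; ext1 x
    rw [← e1]
    rfl
  rw [e2, innerOn_add_smul_sum (d := F.dim j.1) hS Finset.univ _ (fun l => F.eps l j.2)
    (a₀ := fun m x => codOn (closure (F.X j.1)) (a j) m x
      + ∑ l : F.Node with l ∈ F.J j, F.cotrace l j (a l) m x) (a := fun l => a ⟨j.1, l⟩)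
    (fun m => (c1 m).add (continuousOn_finsetSum _ fun l hl => c2 l hl m))
    (fun l _ m => (ha.2.1 ⟨j.1, l⟩ m).continuousOn) cb,
    innerOn_add hS c1 (fun m => continuousOn_finsetSum _ fun l hl => c2 l hl m) cb,
    innerOn_sum hS _ c2 cb]

theorem innerOn_extD {k : ℤ} {a : F.MixedForm} (ha : a ∈ F.CForm k) {b : F.MixedForm}
    (hb : b ∈ F.CForm (k - 1)) (j : F.Node) :
    innerOn (F.X j.1) (a j) (F.extD (k - 1) b j) =
      innerOn (F.X j.1) (a j) (dOn (closure (F.X j.1)) (b j)) +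
      (-1 : ℝ) ^ ((n : ℤ) - k + 1) *
        ∑ l : F.Sheet j.1, F.eps j.2 l * innerOn (F.X j.1) (a j) (b ⟨j.1, l⟩) := by
  have hS := F.isBounded_X j.1
  have cb := fun m => (contDiffOn_dOn (F.uniqueDiffOn j.1) (hb.2.1 j) m).continuousOn
  have ca := fun m => (ha.2.1 j m).continuousOn
  have e1 : innerOn (F.X j.1) (F.extD (k - 1) b j) (a j) =
      innerOn (F.X j.1) (fun m x => dOn (closure (F.X j.1)) (b j) m x +
        (-1 : ℝ) ^ ((n : ℤ) - k + 1) • ∑ l : F.Sheet j.1, F.eps j.2 l • b ⟨j.1, l⟩ m x) (a j) := by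
    refine innerOn_congr (F.isOpen_X j.1).measurableSet (fun m x hx => ?_) fun _ _ _ => rfl
    rw [extD, jump_eq hb j m hx, show (n : ℤ) - (k - 1) = (n : ℤ) - k + 1 by ring]
  rw [innerOn_comm, e1, innerOn_add_smul_sum (d := F.dim j.1) hS Finset.univ _ (F.eps j.2)
    (a := fun l => b ⟨j.1, l⟩) cb (fun l _ m => (hb.2.1 ⟨j.1, l⟩ m).continuousOn) ca]
  simp only [innerOn_comm _ (a j)]

/-- After Green's formula on each node, only the order of summation differs: cotraces are summed
over pairs of a node and a descendant, discrete terms over pairs of sheets of one domain, where the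
exchange transposes `eps`. -/
theorem innerF_explicitCoderiv {k : ℤ} {a : F.MixedForm} (ha : a ∈ F.CForm k) {b : F.MixedForm}
    (hb : b ∈ F.C0Form (k - 1)) :
    F.innerF (F.explicitCoderiv k a) b = F.innerF a (F.extD (k - 1) b) := by
  classical
  simp only [innerF, innerOn_explicitCoderiv ha hb.1, innerOn_extD ha hb.1,
    Finset.sum_add_distrib, ← Finset.mul_sum, green (ha.2.1 _) hb]
  congr 1
  · congr 1
    simp only [Finset.sum_filter]
    exact Finset.sum_comm
  · congr 1
    refine (Fintype.sum_sigma _).trans (Eq.trans ?_ (Fintype.sum_sigma _).symm)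
    exact Finset.sum_congr rfl fun i _ => Finset.sum_comm (s := Finset.univ)
      (t := Finset.univ) (f := fun y l : F.Sheet i =>
      F.eps l y * innerOn (F.X i) (a ⟨i, l⟩) (b ⟨i, y⟩))

theorem isCoderiv_explicitCoderiv {k : ℤ} {a : F.MixedForm} (ha : a ∈ F.CForm k) :
    F.IsCoderiv k a (F.explicitCoderiv k a) :=
  ⟨explicitCoderiv_mem ha, fun _ hb => innerF_explicitCoderiv ha hb⟩

end ConformingForest

/-! ### Testing forms on embedded pieces -/

/-- The restriction of Φ to `S` is a measurable embedding. Pushing the measure forward and extending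
`g` by zero off the image turns the claim into the fundamental lemma of the calculus of variations
on the open set `W`. -/
theorem ae_eq_zero_of_integral_comp {d q : ℕ} {S : Set (Eucl q)} (hS : MeasurableSet S)
    {Φ : Eucl q → Eucl d} (hΦ : ContinuousOn Φ S) (hinj : Set.InjOn Φ S) {W : Set (Eucl d)}
    (hW : IsOpen W) (hm : ∀ x ∈ S, Φ x ∈ W) {g : Eucl q → ℝ} (hg : IntegrableOn g S)
    (h : ∀ ψ : Eucl d → ℝ, ContDiff ℝ ∞ ψ → HasCompactSupport ψ → tsupport ψ ⊆ W →
      ∫ x in S, ψ (Φ x) * g x = 0) : ∀ᵐ x ∂volume.restrict S, g x = 0 := by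
  have he : MeasurableEmbedding (S.domRestrict Φ) := hΦ.measurableEmbedding hS hinj
  let ν : Measure S := Measure.comap Subtype.val volume
  let G : Eucl d → ℝ := Function.extend (S.domRestrict Φ) (fun x => g x) 0
  have hG : ∀ x : S, G (S.domRestrict Φ x) = g x := fun x => he.injective.extend_apply _ _ _
  have hGi : Integrable G (ν.map (S.domRestrict Φ)) := by
    rw [he.integrable_map_iff]
    have e : G ∘ S.domRestrict Φ = g ∘ Subtype.val := funext hG
    rw [e]
    exact (integrableOn_iff_comap_subtypeVal hS).1 hg
  have key := hW.ae_eq_zero_of_integral_contDiff_smul_eq_zero (hGi.locallyIntegrable.locallyIntegrableOn W)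
    (by
      intro ψ h1 h2 h3
      rw [he.integral_map]
      simp only [hG, smul_eq_mul]
      refine (integral_subtype_comap hS fun x => ψ (Φ x) * g x).trans (h ψ h1 h2 h3))
  rw [he.ae_map_iff] at key
  rw [ae_restrict_iff_subtype hS]
  filter_upwards [key] with x hx
  rw [← hG]
  exact hx (hm x x.2)

/-- Pullback of forms along an injective linear map is surjective. -/
theorem exists_comp_eq {d q m : ℕ} {T : Eucl q →L[ℝ] Eucl d} (hT : Function.Injective T)
    (α : Alt q m) : ∃ η : Alt d m, η.compContinuousLinearMap T = α := by
  obtain ⟨R, hR⟩ := LinearMap.exists_leftInverse_of_injective T.toLinearMap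
    (LinearMap.ker_eq_bot.2 hT)
  refine ⟨α.compContinuousLinearMap (LinearMap.toContinuousLinearMap R), ?_⟩
  ext v
  simp only [ContinuousAlternatingMap.compContinuousLinearMap_apply]
  congr 1
  ext1 i
  exact DFunLike.congr_fun hR (v i)

theorem integrableOn_coeff_mul_of_memLp {d m : ℕ} {S : Set (Eucl d)} (hS : Bornology.IsBounded S)
    (ho : IsOpen S) {α β : Eucl d → Alt d m} (hα : MemLp α 2 (volume.restrict S))
    (hβ : ContinuousOn β (closure S)) (t : Fin m ↪o Fin d) :
    IntegrableOn (fun x => coeff (α x) t * coeff (β x) t) S := by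
  have hL : ∀ γ : Eucl d → Alt d m, MemLp γ 2 (volume.restrict S) →
      MemLp (fun x => coeff (γ x) t) 2 (volume.restrict S) := fun γ hγ =>
    (ContinuousAlternatingMap.apply ℝ (Eucl d) ℝ fun r => stdVec (t r)).comp_memLp' hγ
  exact (hL α hα).integrable_mul (hL β (memLp_of_continuousOn hS ho hβ))

/-- A square integrable form on an embedded piece vanishes if it is orthogonal to the restrictions
of all smooth forms supported near the piece. -/
theorem ae_eq_zero_of_test {d q m : ℕ} {S : Set (Eucl q)} (ho : IsOpen S)
    (hb : Bornology.IsBounded S) {Φ : Eucl q → Eucl d} (hΦ : ContinuousOn Φ S)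
    (hinj : Set.InjOn Φ S) {L : Eucl q → Eucl q →L[ℝ] Eucl d} (hL : ContinuousOn L (closure S))
    (himm : ∀ x ∈ S, Function.Injective (L x)) {W : Set (Eucl d)} (hW : IsOpen W)
    (hm : ∀ x ∈ S, Φ x ∈ W) {α : Eucl q → Alt q m} (hα : MemLp α 2 (volume.restrict S))
    (h : ∀ ψ : Eucl d → ℝ, ContDiff ℝ ∞ ψ → HasCompactSupport ψ → tsupport ψ ⊆ W → ∀ η : Alt d m,
      ∫ x in S, ∑ t, coeff (α x) t * coeff (ψ (Φ x) • η.compContinuousLinearMap (L x)) t = 0) :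
    α =ᵐ[volume.restrict S] 0 := by
  have hpull : ∀ η : Alt d m, ContinuousOn (fun x => η.compContinuousLinearMap (L x)) (closure S) :=
    fun η => (contDiffOn_zero (𝕜 := ℝ)).1 (contDiffOn_pullback bot_le contDiffOn_const
      ((contDiffOn_zero (𝕜 := ℝ)).2 hL))
  have h1 : ∀ η : Alt d m, ∀ᵐ x ∂volume.restrict S,
      ∑ t, coeff (α x) t * coeff (η.compContinuousLinearMap (L x)) t = 0 := by
    intro η
    refine ae_eq_zero_of_integral_comp ho.measurableSet hΦ hinj hW hm
      (integrable_finsetSum _ fun t _ => integrableOn_coeff_mul_of_memLp hb ho hα (hpull η) t) ?_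
    intro ψ hψ1 hψ2 hψ3
    rw [← h ψ hψ1 hψ2 hψ3 η]
    congr 1
    ext1 x
    rw [Finset.mul_sum]
    refine Finset.sum_congr rfl fun t _ => ?_
    rw [coeff_smul]
    ring
  have h2 : ∀ᵐ x ∂volume.restrict S, ∀ s : Fin m ↪o Fin d,
      ∑ t, coeff (α x) t * coeff ((dualForm s).compContinuousLinearMap (L x)) t = 0 :=
    ae_all_iff.2 fun s => h1 (dualForm s)
  filter_upwards [h2, ae_restrict_mem ho.measurableSet] with x hx hxS
  -- The form η depends on the point `x`, which is harmless: it is a combination of the finitely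
  -- many `dualForm s`, for which orthogonality holds simultaneously almost everywhere. So `α x` is
  -- orthogonal to itself.
  obtain ⟨η, hη⟩ := exists_comp_eq (himm x hxS) (α x)
  have h3 : ∑ t, coeff (α x) t * coeff (α x) t = 0 := by
    have e : ∀ t, coeff (α x) t = ∑ s, coeff η s *
        coeff ((dualForm s).compContinuousLinearMap (L x)) t := by
      intro t
      conv_lhs => rw [← hη, ← sum_coeff_dualForm η]
      simp [coeff]
    calc ∑ t, coeff (α x) t * coeff (α x) t
        = ∑ t, ∑ s, coeff η s * (coeff (α x) t *
          coeff ((dualForm s).compContinuousLinearMap (L x)) t) := by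
          refine Finset.sum_congr rfl fun t _ => ?_
          conv_lhs => rw [e t, Finset.mul_sum]
          refine Finset.sum_congr rfl fun s _ => ?_
          rw [← e t]; ring
      _ = 0 := by
          rw [Finset.sum_comm]
          refine Finset.sum_eq_zero fun s _ => ?_
          rw [← Finset.mul_sum, hx s, mul_zero]
  refine alt_ext fun t => ?_
  have h4 := (Finset.sum_eq_zero_iff_of_nonneg fun t _ => mul_self_nonneg (coeff (α x) t)).1 h3 t
    (Finset.mem_univ t)
  exact mul_self_eq_zero.1 h4

namespace ConformingForest

variable {n : ℕ} {F : ConformingForest n} {l j : F.Node}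

/-! ### Test forms -/

/-- The derivative of φ is injective with range in the kernel of a nonzero functional, hence in a
proper subspace. -/
theorem dim_lt (h : F.Desc l j) : F.dim j.1 < F.dim l.1 := by
  obtain ⟨x, hx⟩ := (F.isConnected_X j.1).nonempty
  obtain ⟨ρ, hρ⟩ := (F.smooth_X l.1).exists_defines (F.mapsTo_φ l j h hx)
  have hm : ∀ᶠ y in 𝓝 x, F.φ l j y ∈ frontier (F.X l.1) := by
    filter_upwards [(F.isOpen_X j.1).mem_nhds hx] with y hy
    exact F.mapsTo_φ l j h hy
  have hk := hρ.fderiv_comp_eq_zero (F.isOpen_X l.1) (differentiableAt_φ h hx) hm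
  have h1 : LinearMap.range (fderiv ℝ (F.φ l j) x).toLinearMap ≠ ⊤ := by
    intro htop
    apply hρ.2.1
    ext v
    obtain ⟨w, rfl⟩ := LinearMap.range_eq_top.1 htop v
    exact hk w
  have h2 := Submodule.finrank_lt h1
  rwa [LinearMap.finrank_range_of_inj (F.immersion_φ l j h x hx), finrank_euclideanSpace_fin,
    finrank_euclideanSpace_fin] at h2

open Classical in
/-- The form given on the roots by `R`, and on the branches by its traces. -/
def spread (R : (i : F.I) → GForm (F.dim i)) : F.MixedForm := fun j =>
  if j = F.rt (F.tree j) then R j.1 else F.trace (F.rt (F.tree j)) j (R (F.tree j))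

theorem spread_rt (R : (i : F.I) → GForm (F.dim i)) (i : F.I) : spread R (F.rt i) = R i := by
  rw [spread, if_pos (by rw [tree_rt])]
  rfl

theorem spread_of_desc (R : (i : F.I) → GForm (F.dim i)) {i : F.I} (h : F.Desc (F.rt i) j) :
    spread R j = F.trace (F.rt i) j (R i) := by
  have hi : i = F.tree j := by rw [← F.desc_tree _ _ h, tree_rt]
  subst hi
  rw [spread, if_neg]
  intro hj
  rw [← hj] at h
  exact F.desc_irrefl _ h

theorem node_cases (j : F.Node) : ∃ i, F.tree j = i ∧ (j = F.rt i ∨ F.Desc (F.rt i) j) :=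
  ⟨F.tree j, rfl, eq_rt_or j⟩

/-- Compatibility holds by construction. On the Dirichlet boundary the whole value of the root form
vanishes, which is more than its trace and passes to all branches through `telescope₀`. -/
theorem spread_mem {k : ℤ} {R : (i : F.I) → GForm (F.dim i)}
    (h1 : ∀ i m, ContDiffOn ℝ ∞ (R i m) (closure (F.X i)))
    (h2 : ∀ i (m : ℕ), (m : ℤ) ≠ k - (n - F.dim i) → R i m = 0)
    (h3 : ∀ i, ∀ x ∈ closure (F.X i), F.φ₀ i x ∈ F.bdD → ∀ m, R i m x = 0) :
    spread R ∈ F.C0Form k := by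
  refine ⟨⟨fun j m hm => ?_, fun j m => ?_, fun i j hj m x _ => ?_⟩, fun j m x hx hD v _ => ?_⟩
  · obtain ⟨i, hi, rfl | hj⟩ := node_cases j
    · rw [spread_rt]
      rw [hi] at hm
      exact h2 i m hm
    · rw [spread_of_desc R hj]
      rw [hi] at hm
      exact trace_eq_zero (h2 i m hm)
  · obtain ⟨i, -, rfl | hj⟩ := node_cases j
    · rw [spread_rt]; exact h1 i m
    · rw [spread_of_desc R hj]
      exact contDiffOn_trace hj (h1 i) m
  · rw [spread_of_desc R hj, spread_rt]
  · have hcl := frontier_subset_closure hx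
    obtain ⟨i, -, rfl | hj⟩ := node_cases j
    · rw [spread_rt, h3 i x hcl hD]; rfl
    · rw [spread_of_desc R hj]
      have h4 : R i m (F.φ (F.rt i) j x) = 0 := by
        refine h3 i _ (mapsTo_closure hj hcl) ?_ m
        have := F.telescope₀ _ _ hj x hcl
        change F.φ₀ i (F.φ (F.rt i) j x) = _ at this
        rwa [this]
      change (_ * R i m (F.φ (F.rt i) j x) fun r => _) = 0
      rw [h4]
      exact mul_zero _

/-- Pieces of at most the same dimension stay away from a given piece. -/
theorem φ_ne {i : F.I} {j j' : F.Node} (hj : F.Desc (F.rt i) j) (hj' : F.Desc (F.rt i) j')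
    (hne : j' ≠ j) (hd : F.dim j'.1 ≤ F.dim j.1) {x : Eucl (F.dim j.1)} (hx : x ∈ F.X j.1)
    {y : Eucl (F.dim j'.1)} (hy : y ∈ closure (F.X j'.1)) :
    F.φ (F.rt i) j' y ≠ F.φ (F.rt i) j x := by
  intro h
  have h0 : F.φ₀ j'.1 y = F.φ₀ j.1 x := by
    rw [← F.telescope₀ _ _ hj' y hy, h, F.telescope₀ _ _ hj x (subset_closure hx)]
  -- The point `y` may be on the frontier of `X j'`, but it has the same image in the ambient space
  -- as an interior point of another domain, hence is not Dirichlet. So it lies in `X j'` or in a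
  -- descendant `m`; the bound on dimensions rules out `m = j`.
  have hmem : y ∈ F.X j'.1 ∪ ⋃ m, ⋃ (_ : F.Desc j' m), F.φ j' m '' F.X m.1 := by
    rw [F.cover]
    refine ⟨hy, fun hD => notMem_bdD hx ?_⟩
    rw [← h0]; exact hD
  rcases hmem with hyX | hyX
  · exact Set.disjoint_left.1 (F.disjoint_cover _ j' j hj' hj hne) ⟨y, hyX, h⟩ ⟨x, hx, rfl⟩
  · obtain ⟨m, hyX⟩ := Set.mem_iUnion.1 hyX
    obtain ⟨hm, z, hz, rfl⟩ := Set.mem_iUnion.1 hyX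
    by_cases hmj : m = j
    · subst hmj
      exact absurd (dim_lt hm) (not_lt.2 hd)
    · refine Set.disjoint_left.1 (F.disjoint_cover _ m j (F.desc_trans _ _ _ hj' hm) hj hmj)
        ⟨z, hz, ?_⟩ ⟨x, hx, rfl⟩
      rw [← h]
      exact F.telescope _ _ _ hj' hm z (subset_closure hz)

end ConformingForest

/-! ### Inner products of square integrable forms -/

theorem innerOn_sub {d : ℕ} {S : Set (Eucl d)} (hS : Bornology.IsBounded S) (ho : IsOpen S)
    {a a' b : GForm d} (ha : ∀ m, MemLp (a m) 2 (volume.restrict S))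
    (ha' : ∀ m, MemLp (a' m) 2 (volume.restrict S)) (hb : ∀ m, ContinuousOn (b m) (closure S)) :
    innerOn S (fun m x => a m x - a' m x) b = innerOn S a b - innerOn S a' b := by
  simp only [innerOn]
  rw [← Finset.sum_sub_distrib]
  refine Finset.sum_congr rfl fun m _ => ?_
  rw [← integral_sub]
  · have e : ∀ (α β : Alt d m) t, coeff (α - β) t = coeff α t - coeff β t := fun _ _ _ => rfl
    simp only [e, sub_mul, Finset.sum_sub_distrib]
  · exact integrable_finsetSum _ fun t _ => integrableOn_coeff_mul_of_memLp hS ho (ha m) (hb m) t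
  · exact integrable_finsetSum _ fun t _ => integrableOn_coeff_mul_of_memLp hS ho (ha' m) (hb m) t

theorem innerOn_eq_zero_left {d : ℕ} {S : Set (Eucl d)} {a b : GForm d}
    (ha : ∀ m, a m =ᵐ[volume.restrict S] 0) : innerOn S a b = 0 := by
  refine Finset.sum_eq_zero fun m _ => integral_eq_zero_of_ae ?_
  filter_upwards [ha m] with x hx
  refine Finset.sum_eq_zero fun t _ => ?_
  rw [hx]
  exact zero_mul _

theorem innerOn_eq_zero_right {d : ℕ} {S : Set (Eucl d)} (hS : MeasurableSet S) {a b : GForm d}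
    (hb : ∀ m, ∀ x ∈ S, b m x = 0) : innerOn S a b = 0 := by
  rw [innerOn_comm]
  refine innerOn_eq_zero_left fun m => ?_
  filter_upwards [ae_restrict_mem hS] with x hx
  exact hb m x hx

theorem innerOn_single {d m : ℕ} {S : Set (Eucl d)} {a b : GForm d} (hm : m ≤ d)
    (hb : ∀ m', m' ≠ m → b m' = 0) :
    innerOn S a b = ∫ x in S, ∑ t : Fin m ↪o Fin d, coeff (a m x) t * coeff (b m x) t := by
  refine Finset.sum_eq_single m (fun m' _ hne => ?_) fun h => ?_
  · rw [hb m' hne]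
    simp [coeff_zero]
  · exact (h (Finset.mem_range.2 (by omega))).elim

theorem alt_eq_zero_of_lt {d m : ℕ} (h : d < m) (α : Alt d m) : α = 0 := by
  refine alt_ext fun t => ?_
  have := Fintype.card_le_of_embedding t.toEmbedding
  simp only [Fintype.card_fin] at this
  omega

namespace ConformingForest

variable {n : ℕ} {F : ConformingForest n} {l j : F.Node}

open Classical in
/-- The forms on the roots given by `ψ • η` on the root `i`, and vanishing on the others. -/
def testForm (i : F.I) (ψ : Eucl (F.dim i) → ℝ) {m : ℕ} (η : Alt (F.dim i) m) :
    (i' : F.I) → GForm (F.dim i') :=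
  Pi.single i fun m' x => ψ x • (Pi.single m η : (m' : ℕ) → Alt (F.dim i) m') m'

section

variable {i : F.I} {ψ : Eucl (F.dim i) → ℝ} {m : ℕ} {η : Alt (F.dim i) m}

theorem testForm_same (x : Eucl (F.dim i)) : testForm i ψ η i m x = ψ x • η := by
  simp only [testForm, Pi.single_eq_same]

theorem testForm_zero {x : Eucl (F.dim i)} (h : ψ x = 0) (m' : ℕ) : testForm i ψ η i m' x = 0 := by
  simp only [testForm, Pi.single_eq_same, h, zero_smul]

theorem testForm_degree {m' : ℕ} (h : m' ≠ m) : testForm i ψ η i m' = 0 := by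
  ext1 x
  simp only [testForm, Pi.single_eq_same, Pi.single_eq_of_ne h, smul_zero, Pi.zero_apply]

theorem testForm_of_ne {i' : F.I} (h : i' ≠ i) : testForm i ψ η i' = 0 := by
  classical
  exact Pi.single_eq_of_ne h _

theorem spread_testForm_mem {k : ℤ} (hψ : ContDiff ℝ ∞ ψ)
    (hm : (m : ℤ) = k - (n - F.dim i))
    (hD : ∀ x ∈ closure (F.X i), F.φ₀ i x ∈ F.bdD → ψ x = 0) :
    spread (testForm i ψ η) ∈ F.C0Form k := by
  refine spread_mem (fun i' m' => ?_) (fun i' m' hm' => ?_) fun i' x hx hxD m' => ?_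
  · by_cases hi : i' = i
    · subst hi
      by_cases h : m' = m
      · subst h
        have e : testForm i' ψ η i' m' = fun x => ψ x • η := funext testForm_same
        rw [e]
        exact (hψ.smul contDiff_const).contDiffOn
      · rw [testForm_degree h]; exact contDiffOn_const
    · rw [testForm_of_ne hi]; exact contDiffOn_const
  · by_cases hi : i' = i
    · subst hi
      exact testForm_degree fun h => hm' (by rw [h, hm])
    · rw [testForm_of_ne hi]; rfl
  · by_cases hi : i' = i
    · subst hi
      exact testForm_zero (hD x hx hxD) m'
    · rw [testForm_of_ne hi]; rfl

end

/-! ### Uniqueness -/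

/-- The part of the coordinate domain of a root away from the Dirichlet boundary and from the other
pieces of at most the dimension of `j`. -/
def testRegion (i : F.I) (j : F.Node) : Set (Eucl (F.dim i)) :=
  ((closure (F.X i) ∩ F.φ₀ i ⁻¹' F.bdD) ∪
    ⋃ j' ∈ {j' | F.Desc (F.rt i) j' ∧ j' ≠ j ∧ F.dim j'.1 ≤ F.dim j.1},
      F.φ (F.rt i) j' '' closure (F.X j'.1))ᶜ

/-- The excluded set is a closed Dirichlet part together with finitely many continuous images of
compact closures. -/
theorem isOpen_testRegion (i : F.I) (j : F.Node) : IsOpen (testRegion i j) := by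
  rw [testRegion, isOpen_compl_iff]
  refine IsClosed.union ?_ ((Set.toFinite _).isClosed_biUnion fun j' hj' => ?_)
  · exact (F.contDiffOn_φ₀ i).continuousOn.preimage_isClosed_of_isClosed isClosed_closure
      F.isClosed_bdD
  · exact ((isCompact_closure (F.isBounded_X _)).image_of_continuousOn
      (F.contDiffOn_φ _ _ hj'.1).continuousOn).isClosed

theorem mem_testRegion_root {i : F.I} {x : Eucl (F.dim i)} (hx : x ∈ F.X i) :
    x ∈ testRegion i (F.rt i) := by
  rintro (h | h)
  · exact notMem_bdD hx h.2
  · simp only [Set.mem_iUnion] at h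
    obtain ⟨j', ⟨h1, -, -⟩, y, hy, rfl⟩ := h
    have h2 := (F.mapsTo_φ _ _ h1).closure_of_continuousOn (F.contDiffOn_φ _ _ h1).continuousOn hy
    rw [isClosed_frontier.closure_eq] at h2
    change F.φ (F.rt i) j' y ∈ frontier (F.X i) at h2
    rw [(F.isOpen_X i).frontier_eq] at h2
    exact h2.2 hx

theorem mem_testRegion {i : F.I} {j : F.Node} (hj : F.Desc (F.rt i) j) {x : Eucl (F.dim j.1)}
    (hx : x ∈ F.X j.1) : F.φ (F.rt i) j x ∈ testRegion i j := by
  rintro (h | h)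
  · have h1 : F.φ₀ i (F.φ (F.rt i) j x) = F.φ₀ j.1 x := F.telescope₀ _ _ hj x (subset_closure hx)
    have h2 : F.φ₀ i (F.φ (F.rt i) j x) ∈ F.bdD := h.2
    rw [h1] at h2
    exact notMem_bdD hx h2
  · obtain ⟨j', ⟨h1, h2, h3⟩, y, hy, hxy⟩ := Set.mem_iUnion₂.1 h
    exact φ_ne hj h1 h2 h3 hx hy hxy

variable {k : ℤ} {e : F.MixedForm}

/-- All other terms of the inner product vanish: in other trees the test form is zero, in this tree
the nodes of larger dimension are covered by `hIH`, and the other branches of dimension at most that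
of `j` are avoided by the support of ψ. -/
theorem innerOn_testForm_eq_zero (horth : ∀ b ∈ F.C0Form k, F.innerF e b = 0) {i : F.I}
    (hj : j = F.rt i ∨ F.Desc (F.rt i) j)
    (hIH : ∀ j', F.tree j' = i → F.dim j.1 < F.dim j'.1 → ∀ m,
      e j' m =ᵐ[volume.restrict (F.X j'.1)] 0) {m : ℕ} (hm : (m : ℤ) = k - (n - F.dim i))
    {ψ : Eucl (F.dim i) → ℝ} (hψ : ContDiff ℝ ∞ ψ) (hψW : tsupport ψ ⊆ testRegion i j)
    (η : Alt (F.dim i) m) :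
    innerOn (F.X j.1) (e j) (spread (testForm i ψ η) j) = 0 := by
  have hz : ∀ x, x ∉ testRegion i j → ψ x = 0 := fun x hx =>
    image_eq_zero_of_notMem_tsupport fun h => hx (hψW h)
  have h0 : ∑ j', innerOn (F.X j'.1) (e j') (spread (testForm i ψ η) j') = 0 :=
    horth (spread (testForm i ψ η)) (spread_testForm_mem hψ hm fun x hx hD =>
      hz x fun h => h (Or.inl ⟨hx, hD⟩))
  refine (Finset.sum_eq_single_of_mem j (Finset.mem_univ j) fun j' _ hne => ?_).symm.trans h0
  obtain ⟨i', hi', hj'⟩ := node_cases j'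
  by_cases hii : i' = i
  · subst hii
    rcases hj' with rfl | hj'
    · refine innerOn_eq_zero_left (hIH _ hi' ?_)
      exact dim_lt (hj.resolve_left hne.symm)
    · by_cases hd : F.dim j'.1 ≤ F.dim j.1
      · refine innerOn_eq_zero_right (F.isOpen_X _).measurableSet fun m' x hx => ?_
        rw [spread_of_desc _ hj']
        ext v
        refine (trace_apply (l := F.rt i') hx _ m' v).trans ?_
        have h0 : testForm i' ψ η i' m' (F.φ (F.rt i') j' x) = 0 := by
          refine testForm_zero (hz _ fun h => h (Or.inr ?_)) m'
          exact Set.mem_iUnion₂.2 ⟨j', ⟨hj', hne, hd⟩, x, subset_closure hx, rfl⟩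
        rw [h0]
        exact mul_zero _
      · exact innerOn_eq_zero_left (hIH _ hi' (not_le.1 hd))
  · refine innerOn_eq_zero_right (F.isOpen_X _).measurableSet fun m' x hx => ?_
    rcases hj' with rfl | hj'
    · rw [spread_rt, testForm_of_ne hii]; rfl
    · rw [spread_of_desc _ hj']
      exact congrFun (trace_eq_zero (l := F.rt i') (congrFun (testForm_of_ne hii) m')) x

theorem ae_eq_zero_of_larger (he : F.IsForm k e)
    (hL : ∀ (j : F.Node) (m : ℕ), MemLp (e j m) 2 (volume.restrict (F.X j.1)))
    (horth : ∀ b ∈ F.C0Form k, F.innerF e b = 0) (j : F.Node)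
    (hIH : ∀ j', F.tree j' = F.tree j → F.dim j.1 < F.dim j'.1 → ∀ m,
      e j' m =ᵐ[volume.restrict (F.X j'.1)] 0) (m : ℕ) :
    e j m =ᵐ[volume.restrict (F.X j.1)] 0 := by
  obtain ⟨i, hi, hj⟩ := node_cases j
  rw [hi] at hIH
  by_cases hm : (m : ℤ) = k - (n - F.dim i)
  swap
  · rw [he j m (by rwa [hi])]
  -- The degree is fixed by the root and may exceed the dimension of the branch; such forms are zero
  -- and do not appear in `innerOn`.
  by_cases hmd : m ≤ F.dim j.1
  swap
  · exact Filter.Eventually.of_forall fun x => alt_eq_zero_of_lt (not_le.1 hmd) _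
  have key := fun (ψ : Eucl (F.dim i) → ℝ) (h1 : ContDiff ℝ ∞ ψ)
    (h2 : tsupport ψ ⊆ testRegion i j) (η : Alt (F.dim i) m) =>
    innerOn_testForm_eq_zero horth hj hIH hm h1 h2 η
  rcases hj with rfl | hj
  · refine ae_eq_zero_of_test (F.isOpen_X i) (F.isBounded_X i) (Φ := id) continuousOn_id
      (Set.injOn_id _) (L := fun _ => ContinuousLinearMap.id ℝ _) continuousOn_const
      (fun _ _ => Function.injective_id) (isOpen_testRegion i (F.rt i))
      (fun x hx => mem_testRegion_root hx) (hL (F.rt i) m) fun ψ h1 _ h2 η => ?_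
    have h3 := key ψ h1 h2 η
    rw [spread_rt] at h3
    have h4 := (innerOn_single (d := F.dim i) (S := F.X i) (a := e (F.rt i)) hmd
      fun m' hne => testForm_degree (ψ := ψ) (η := η) hne).symm.trans h3
    simp only [testForm_same] at h4
    exact h4
  · refine ae_eq_zero_of_test (F.isOpen_X j.1) (F.isBounded_X j.1) (Φ := F.φ (F.rt i) j)
      ((F.contDiffOn_φ _ _ hj).continuousOn.mono subset_closure)
      ((F.injOn_φ _ _ hj).mono subset_closure)
      (L := fderivWithin ℝ (F.φ (F.rt i) j) (closure (F.X j.1)))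
      ((F.contDiffOn_φ _ _ hj).continuousOn_fderivWithin (F.uniqueDiffOn _) (by simp))
      (fun x hx => by rw [fderivWithin_φ hx]; exact F.immersion_φ _ _ hj x hx)
      (isOpen_testRegion i j) (fun x hx => mem_testRegion hj hx) (hL j m) fun ψ h1 _ h2 η => ?_
    have h3 := key ψ h1 h2 η
    rw [spread_of_desc _ hj] at h3
    have h6 := (innerOn_single (S := F.X j.1) (a := e j) hmd fun m' hne =>
      trace_eq_zero (l := F.rt i) (j := j)
        (testForm_degree (i := i) (ψ := ψ) (η := η) hne)).symm.trans h3
    have h4 : ∀ x t, coeff (F.trace (F.rt i) j (testForm i ψ η i) m x) t =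
        (((F.orient j * F.orient (F.rt i) : ℤˣ) : ℤ) : ℝ) * coeff (ψ (F.φ (F.rt i) j x) •
          η.compContinuousLinearMap (fderivWithin ℝ (F.φ (F.rt i) j) (closure (F.X j.1)) x)) t := by
      intro x t
      have h5 := testForm_same (ψ := ψ) (η := η) (F.φ (F.rt i) j x)
      exact congrArg (fun α : Alt (F.dim i) m => (((F.orient j * F.orient (F.rt i) : ℤˣ) : ℤ) : ℝ) *
        α fun r => fderivWithin ℝ (F.φ (F.rt i) j) (closure (F.X j.1)) x (stdVec (t r))) h5
    simp only [h4, mul_left_comm (coeff (e j m _) _), ← Finset.mul_sum] at h6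
    rw [integral_const_mul] at h6
    -- The trace carries an orientation sign, which is nonzero and can be divided out.
    refine (mul_eq_zero.1 h6).resolve_left fun h0 => ?_
    have := unit_mul_self (F.orient j * F.orient (F.rt i))
    rw [h0, zero_mul] at this
    exact zero_ne_one this

/-- Strong induction on the codimension of a node in its tree, so that nodes of larger dimension in
the same tree come first. -/
theorem ae_eq_zero_of_orthogonal (he : F.IsForm k e)
    (hL : ∀ (j : F.Node) (m : ℕ), MemLp (e j m) 2 (volume.restrict (F.X j.1)))
    (horth : ∀ b ∈ F.C0Form k, F.innerF e b = 0) (j : F.Node) (m : ℕ) :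
    e j m =ᵐ[volume.restrict (F.X j.1)] 0 := by
  -- A node never exceeds the dimension of its root, so the truncated difference is the true
  -- codimension.
  have hle : ∀ j : F.Node, F.dim j.1 ≤ F.dim (F.tree j) := by
    intro j
    obtain ⟨i, hi, rfl | hj⟩ := node_cases j
    · rw [hi]; rfl
    · rw [hi]; exact (dim_lt hj).le
  obtain ⟨N, hN⟩ : ∃ N, F.dim (F.tree j) - F.dim j.1 = N := ⟨_, rfl⟩
  induction N using Nat.strong_induction_on generalizing j m with
  | _ N ih =>
    refine ae_eq_zero_of_larger he hL horth j (fun j' h1 h2 m' => ?_) m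
    have := hle j'
    rw [h1] at this
    exact ih _ (by rw [h1]; omega) j' m' rfl

/-- The difference of the two coderivatives is a square integrable form of order `k - 1`, orthogonal
to every admissible test form. -/
theorem IsCoderiv.ae_eq {a c : F.MixedForm} (ha : a ∈ F.CForm k) (hc : F.IsCoderiv k a c)
    (j : F.Node) (m : ℕ) :
    c j m =ᵐ[volume.restrict (F.X j.1)] F.explicitCoderiv k a j m := by
  have hx := explicitCoderiv_mem ha
  have h := ae_eq_zero_of_orthogonal (k := k - 1)
    (e := fun j m x => c j m x - F.explicitCoderiv k a j m x) ?_
    (fun j m => (hc.1.2 j m).sub (hx.2 j m)) ?_ j m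
  · filter_upwards [h] with x hx
    exact sub_eq_zero.1 hx
  · intro j m hm
    ext1 x
    simp only [hc.1.1 j m hm, hx.1 j m hm, Pi.zero_apply, sub_zero]
  · intro b hb
    have h1 := hc.2 b hb
    rw [← innerF_explicitCoderiv ha hb, ← sub_eq_zero] at h1
    rw [← h1]
    simp only [innerF]
    rw [← Finset.sum_sub_distrib]
    exact Finset.sum_congr rfl fun j _ => innerOn_sub (F.isBounded_X _) (F.isOpen_X _)
      (hc.1.2 j) (hx.2 j) fun m => (hb.1.2.1 j m).continuousOn

end ConformingForest

end MixedDim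

end

theorem mainTheorem10 {n : ℕ} (F : MixedDim.ConformingForest n) (k : ℤ)
    (a : F.MixedForm) (ha : a ∈ F.CForm k) :
    F.IsCoderiv k a (F.explicitCoderiv k a) ∧
      ∀ c : F.MixedForm, F.IsCoderiv k a c →
        ∀ (j : F.Node) (m : ℕ),
          c j m =ᵐ[MeasureTheory.volume.restrict (F.X j.1)] F.explicitCoderiv k a j m := by
  exact ⟨MixedDim.ConformingForest.isCoderiv_explicitCoderiv ha,
    fun _ hc j m => MixedDim.ConformingForest.IsCoderiv.ae_eq ha hc j m⟩
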